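/- Let $N\ge 2$, $s\in(0,1)$, and let $P:\mathbb R^N\to\mathbb R$ be a radially symmetric $C^1$ function such that, for some constants $C,C_{N,s}>0$, $$\frac{C^{-1}}{1+|y|^{N+2s}}\le P(y)\le \frac{C}{1+|y|^{N+2s}},\qquad |\nabla P(y)|\le \frac{C}{1+|y|^{N+2s+1}}\qquad(y\in\mathbb R^N),$$ and such that the kernel $\mathcal K_s(x,t)=t^{-N/(2s)}P(t^{-1/(2s)}x)$ satisfies $\lim_{t\to0^+}t^{-1}\mathcal K_s(y,t)=C_{N,s}|y|^{-N-2s}$ locally uniformly in $y\in\mathbb R^N\setminus\{0\}$. Let $E\subset\mathbb R^N$ be a set lying locally on one side of its boundary $\partial E$. Assume that $\partial E$ is of class $C^{1,\beta}$ for some $\beta\in(2s,1]$ if $s<1/2$, and of class $C^3$ if $s\ge 1/2$. That is, every $y\in\partial E$ has a unit vector $\nu(y)$ (the unit exterior normal) and a function $\gamma$ of that class on a ball around $0$ in the hyperplane $\nu(y)^\perp$, with $\gamma(0)=0$ and $\nabla\gamma(0)=0$, such that in a cylinder around $y$ with axis $\nu(y)$ the points $y+w+h\,\nu(y)$ ($w\perp\nu(y)$)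 with $h<\gamma(w)$ belong to $E$ and those with $h>\gamma(w)$ do not. Put $\tau_E=\mathbf 1_E-\mathbf 1_{\mathbb R^N\setminus\overline E}$ and, for $y\in\partial E$, $$H_s(y)=\lim_{\varepsilon\to0^+}\int_{\mathbb R^N\setminus B_\varepsilon(y)}\frac{\tau_E(z)}{|y-z|^{N+2s}}\,dz\quad(s<1/2),\qquad H(y)=\frac{\Delta\gamma(0)}{N-1}\quad(s\ge1/2)$$ (the fractional mean curvature and the normalized classical mean curvature). For $t>0$ (small, if $s=1/2$) let $\sigma(t)=t^{2s/(1+2s)}$ if $s<1/2$, $\sigma(t)=t^s$ if $s>1/2$, and, if $s=1/2$, let $\sigma(t)$ be the smallest positive solution $\sigma$ of $t=\sigma^2|\log\sigma|$. Let $$E_t=\Big\{x\in\mathbb R^N:\ \int_{\mathbb R^N}\mathcal K_s(x-z,\sigma(t))\,\tau_E(z)\,dz>0\Big\}.$$ Let $K\subset\partial E$ be compact. Then for all sufficiently small $t>0$ and every $y\in K$ there is exactly one real number $v=v(t,y)$ with $$y+vt\,\nu(y)\in\partial E_t\cap B\big(y,\sigma(t)^{1/(2s)}\big),$$ and, as $t\to0^+$,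 uniformly in $y\in K$: - if $s<1/2$, the limit defining $H_s$ exists at every point of $\partial E$, and $v(t,y)=a_{N,s}H_s(y)+o(1)$; - if $s=1/2$, $v(t,y)=b_N(t)H(y)+O\big(1/|\log\sigma(t)|\big)$; - if $s>1/2$, $v(t,y)=c_{N,s}H(y)+O\big(t^{(2s-1)/2}\big)$. Here the constants are positive ($b_N(t)$ for small $t$) and given by $$a_{N,s}=\frac{C_{N,s}}{2\int_{\mathbb R^{N-1}}P(y',0)\,dy'},\qquad b_N(t)=\frac{\int_{\{y'\in\mathbb R^{N-1}:\,|y'|<1/\sigma(t)\}}|y'|^2P(y',0)\,dy'}{2|\log\sigma(t)|\int_{\mathbb R^{N-1}}P(y',0)\,dy'},\qquad c_{N,s}=\frac{\int_{\mathbb R^{N-1}}|y'|^2P(y',0)\,dy'}{2\int_{\mathbb R^{N-1}}P(y',0)\,dy'}.$$ -/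

import Mathlib

open Set Filter Topology MeasureTheory Metric
open scoped RealInnerProductSpace

noncomputable section

/-- The space `ℝ^d` with its Euclidean norm. The ambient space is `ℝ^N` with `N = n + 1`, so that
`ℝ^(N-1)` is `Space n`. -/
abbrev Space (d : ℕ) : Type := EuclideanSpace ℝ (Fin d)

/-- The point `(y', 0)` of `ℝ^N`, for `y'` in `ℝ^(N-1)`. -/
def appendZero {n : ℕ} (y' : Space n) : Space (n + 1) :=
  WithLp.toLp 2 (Fin.snoc (α := fun _ => ℝ) (fun i => y' i) 0)

/-- `τ_E = 1_E - 1_{ℝ^N ∖ closure E}`. -/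
def signIndicator {n : ℕ} (E : Set (Space (n + 1))) (x : Space (n + 1)) : ℝ :=
  E.indicator (fun _ => (1 : ℝ)) x - (closure E)ᶜ.indicator (fun _ => (1 : ℝ)) x

/-! ### The boundary of `E` as a graph over its tangent plane -/

/-- In the cylinder of radius and half-height `r` around `y` with axis `ν`, the set `E` is the
region below the graph of `γ`, a function on the hyperplane `ν^⊥` with `γ 0 = 0` and `∇γ 0 = 0`.
(Nothing is said about which points of the graph itself belong to `E`.) -/
def IsGraphChart {n : ℕ} (E : Set (Space (n + 1))) (y ν : Space (n + 1)) (r : ℝ)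
    (γ : (Submodule.span ℝ {ν})ᗮ → ℝ) : Prop :=
  ‖ν‖ = 1 ∧ 0 < r ∧ γ 0 = 0 ∧ HasFDerivAt γ (0 : (Submodule.span ℝ {ν})ᗮ →L[ℝ] ℝ) 0 ∧
    ∀ w ∈ ball (0 : (Submodule.span ℝ {ν})ᗮ) r, ∀ h : ℝ, |h| < r →
      (h < γ w → y + (w : Space (n + 1)) + h • ν ∈ E) ∧
      (γ w < h → y + (w : Space (n + 1)) + h • ν ∉ E)

/-- `∂E` is of class `C^{1,β}`. -/
def HasC1HolderBoundary {n : ℕ} (E : Set (Space (n + 1))) (β : ℝ) : Prop :=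
  ∀ y ∈ frontier E, ∃ (ν : Space (n + 1)) (r : ℝ) (γ : (Submodule.span ℝ {ν})ᗮ → ℝ),
    IsGraphChart E y ν r γ ∧ ContDiffOn ℝ 1 γ (ball 0 r) ∧
    ∃ L : ℝ, ∀ w ∈ ball (0 : (Submodule.span ℝ {ν})ᗮ) r,
      ∀ w' ∈ ball (0 : (Submodule.span ℝ {ν})ᗮ) r,
        ‖fderiv ℝ γ w - fderiv ℝ γ w'‖ ≤ L * ‖w - w'‖ ^ β

/-- `∂E` is of class `C^3`. -/
def HasC3Boundary {n : ℕ} (E : Set (Space (n + 1))) : Prop :=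
  ∀ y ∈ frontier E, ∃ (ν : Space (n + 1)) (r : ℝ) (γ : (Submodule.span ℝ {ν})ᗮ → ℝ),
    IsGraphChart E y ν r γ ∧ ContDiffOn ℝ 3 γ (ball 0 r)

/-- `ν` is the unit exterior normal of `E` at `y`: it points to the side of the tangent plane
away from `E`. -/
def IsExteriorNormal {n : ℕ} (E : Set (Space (n + 1))) (y ν : Space (n + 1)) : Prop :=
  ∃ (r : ℝ) (γ : (Submodule.span ℝ {ν})ᗮ → ℝ),
    IsGraphChart E y ν r γ ∧ ContDiffOn ℝ 1 γ (ball 0 r)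

/-- The unit exterior normal `ν(y)`; at a point of a `C^1` boundary there is exactly one. -/
def exteriorNormal {n : ℕ} (E : Set (Space (n + 1))) (y : Space (n + 1)) : Space (n + 1) :=
  Classical.epsilon (IsExteriorNormal E y)

/-- `H` is the normalized mean curvature of `∂E` at `y`: `H = Δγ(0) / (N - 1)`, where near `y` the
set `E` lies below the graph of `γ` over the tangent plane, in the direction of the exterior
normal. (Thus `H` is negative for a ball.) -/
def IsMeanCurvature {n : ℕ} (E : Set (Space (n + 1))) (y : Space (n + 1)) (H : ℝ) : Prop :=
  ∃ (ν : Space (n + 1)) (r : ℝ) (γ : (Submodule.span ℝ {ν})ᗮ → ℝ),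
    IsGraphChart E y ν r γ ∧ ContDiffOn ℝ 2 γ (ball 0 r) ∧
    H = Laplacian.laplacian γ 0 / (n : ℝ)

/-- The normalized mean curvature `H(y)`; at a point of a `C^2` boundary there is exactly one. -/
def meanCurvature {n : ℕ} (E : Set (Space (n + 1))) (y : Space (n + 1)) : ℝ :=
  Classical.epsilon (IsMeanCurvature E y)

/-- `∫_{ℝ^N ∖ B_ε(y)} τ_E(z) / |y - z|^{N+2s} dz`. -/
def truncatedFracCurvature {n : ℕ} (s : ℝ) (E : Set (Space (n + 1))) (y : Space (n + 1))
    (ε : ℝ) : ℝ :=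
  ∫ z in (ball y ε)ᶜ, signIndicator E z / ‖y - z‖ ^ ((n + 1 : ℝ) + 2 * s)

/-- The fractional mean curvature `H_s(y)`, the principal value
`lim_{ε → 0} ∫_{ℝ^N ∖ B_ε(y)} τ_E(z) / |y - z|^{N+2s} dz`. -/
def fracMeanCurvature {n : ℕ} (s : ℝ) (E : Set (Space (n + 1))) (y : Space (n + 1)) : ℝ :=
  limUnder (𝓝[>] (0 : ℝ)) (truncatedFracCurvature s E y)

/-! ### The kernel and the evolving sets -/

/-- `𝒦_s(x,t) = t^{-N/(2s)} P(t^{-1/(2s)} x)`. -/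
def kernel {n : ℕ} (s : ℝ) (P : Space (n + 1) → ℝ) (x : Space (n + 1)) (t : ℝ) : ℝ :=
  t ^ (-((n + 1 : ℝ) / (2 * s))) * P (t ^ (-(1 / (2 * s))) • x)

/-- The assumptions on the profile `P = P_s`; `c` is the constant `C_{N,s}` of the small-time limit
and `C` the constant of the decay estimates. -/
structure IsAdmissibleProfile {n : ℕ} (s : ℝ) (P : Space (n + 1) → ℝ) (c C : ℝ) : Prop where
  c_pos : 0 < c
  C_pos : 0 < C
  contDiff : ContDiff ℝ 1 P
  radial : ∀ x y, ‖x‖ = ‖y‖ → P x = P y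
  lower : ∀ y, C⁻¹ / (1 + ‖y‖ ^ ((n + 1 : ℝ) + 2 * s)) ≤ P y
  upper : ∀ y, P y ≤ C / (1 + ‖y‖ ^ ((n + 1 : ℝ) + 2 * s))
  gradient_le : ∀ y, ‖gradient P y‖ ≤ C / (1 + ‖y‖ ^ ((n + 1 : ℝ) + 2 * s + 1))
  small_time : TendstoLocallyUniformlyOn (fun (t : ℝ) y => t⁻¹ * kernel s P y t)
    (fun y => c / ‖y‖ ^ ((n + 1 : ℝ) + 2 * s)) (𝓝[>] 0) {0}ᶜ

/-- The time scale `σ_s(t)`, for `t > 0`. For `s = 1/2` it is the smallest positive solution `σ`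
of `t = σ² |log σ|`, which is the one that tends to `0` with `t`. -/
def timeScale (s t : ℝ) : ℝ :=
  if s < 1 / 2 then t ^ (2 * s / (1 + 2 * s))
  else if s = 1 / 2 then sInf {σ : ℝ | 0 < σ ∧ t = σ ^ 2 * |Real.log σ|}
  else t ^ s

/-- `u(x,t) = (𝒦_s(·,t) ⋆ τ_E)(x)`. -/
def diffusion {n : ℕ} (s : ℝ) (P : Space (n + 1) → ℝ) (E : Set (Space (n + 1)))
    (x : Space (n + 1)) (t : ℝ) : ℝ :=
  ∫ z, kernel s P (x - z) t * signIndicator E z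

/-- `E_t = {x | u(x, σ_s(t)) > 0}`. -/
def evolvedSet {n : ℕ} (s : ℝ) (P : Space (n + 1) → ℝ) (E : Set (Space (n + 1))) (t : ℝ) :
    Set (Space (n + 1)) :=
  {x | 0 < diffusion s P E x (timeScale s t)}

/-- `v` is a value of the normal displacement speed at time `t` and at the point `y`:
`y + v t ν(y) ∈ ∂E_t ∩ B(y, σ_s(t)^{1/(2s)})`. -/
def IsNormalSpeed {n : ℕ} (s : ℝ) (P : Space (n + 1) → ℝ) (E : Set (Space (n + 1)))
    (t : ℝ) (y : Space (n + 1)) (v : ℝ) : Prop :=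
  y + (v * t) • exteriorNormal E y ∈
    frontier (evolvedSet s P E t) ∩ ball y (timeScale s t ^ (1 / (2 * s)))

/-! ### The constants -/

/-- `∫_{ℝ^(N-1)} P(y',0) dy'`. -/
def sliceMass {n : ℕ} (P : Space (n + 1) → ℝ) : ℝ :=
  ∫ y' : Space n, P (appendZero y')

/-- `a_{N,s}`, where `c` is the constant `C_{N,s}` of the small-time limit. -/
def coeffA {n : ℕ} (P : Space (n + 1) → ℝ) (c : ℝ) : ℝ :=
  c / (2 * sliceMass P)

/-- `b_N(t)`. -/
def coeffB {n : ℕ} (P : Space (n + 1) → ℝ) (t : ℝ) : ℝ :=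
  (∫ y' in ball (0 : Space n) (timeScale (1 / 2) t)⁻¹, ‖y'‖ ^ 2 * P (appendZero y')) /
    (2 * |Real.log (timeScale (1 / 2) t)| * sliceMass P)

/-- `c_{N,s}`. -/
def coeffC {n : ℕ} (P : Space (n + 1) → ℝ) : ℝ :=
  (∫ y' : Space n, ‖y'‖ ^ 2 * P (appendZero y')) / (2 * sliceMass P)

end

/-! Put ρ = σ(t)^{1/(2s)}. Blowing up at y by the factor 1/ρ, in coordinates (w, h) along the
tangent plane and the normal, turns the diffusion at y + ρην(y) into U(η) = ∫ P(w, h − η) f(w, h),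
where f is the phase of the blown-up set (`diffusion_eq_slideIntegral`). As ρ → 0 this set
approaches the half-space h < 0, for which U(η) = −2 ∫∫_0^η P ≈ −2Sη with S = ∫ P(y', 0) dy'. The
gradient bound on P lets the deviation from the half-space change increments of U only by O(ρ^β)(η −
η') (`exists_slideIntegral_increment`). So for small ρ the function U decreases strictly on [−1, 1],
has exactly one zero there once U(0) is small, and this zero is U(0)/(2S) up to O((ρ^β +
|U(0)|)|U(0)|) (`exists_normalSpeed_bounds`). The zero equals vt/ρ, so everything reduces to
expanding U(0), the diffusion u(y, σ(t)) at the boundary point itself.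

For s < 1/2 the half-space is subtracted, since an even kernel does not see it; what remains is
integrable against |x|^{−N−2s} because β > 2s, and dominated convergence gives u = σ(cH_s + o(1))
(`diffusion_sub_fracMeanCurvature`). Here t = ρσ. For s ≥ 1/2 the interface is a quadratic graph up
to a cubic error, and radial symmetry keeps only the trace of the quadratic form: u = ρH ∫_{|w|<r/ρ}
|w|²P(w, 0) dw + O(ρ^{2s}) (`diffusion_sub_meanCurvature`). For s > 1/2 the second moment converges
and t = ρ²; for s = 1/2 it grows at most like |log ρ| and t = ρ²|log ρ|.

The estimates see the boundary only through `BandPhase`: the phase is known outside a thin band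
around a graph. Bands with common constants come from a local defining function φ of slope one in a
fixed direction, whose first and second derivatives encode the normals and curvatures at all nearby
boundary points; compactness of K does the rest. -/

noncomputable section

/-! ### Radial integrals -/

/-- The surface measure of the unit sphere of `ℝ^d`. -/
def sphereArea (d : ℕ) : ℝ := d * volume.real (ball (0 : Space d) 1)

lemma sphereArea_nonneg (d : ℕ) : 0 ≤ sphereArea d := by unfold sphereArea; positivity

lemma nontrivial_space {d : ℕ} (hd : 1 ≤ d) : Nontrivial (Space d) := by
  have : Nonempty (Fin d) := ⟨⟨0, hd⟩⟩
  infer_instance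

lemma indicator_norm_eq {d : ℕ} (S : Set ℝ) (f : ℝ → ℝ) :
    ({x : Space d | ‖x‖ ∈ S}).indicator (fun x => f ‖x‖) = fun x => S.indicator f ‖x‖ := by
  ext x
  by_cases h : ‖x‖ ∈ S <;> simp [indicator, h]

/-- Radial powers are written with exponent `p - d` throughout, so that the Jacobian r^(d-1) leaves
r^(p-1) and the sign of p alone decides convergence. -/
lemma pow_smul_indicator_rpow {d : ℕ} (hd : 1 ≤ d) (S : Set ℝ) (p : ℝ) :
    EqOn (fun y : ℝ => y ^ (d - 1) • S.indicator (fun r => r ^ (p - d)) y)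
      (S.indicator (fun r => r ^ (p - 1))) (Ioi 0) := by
  intro y hy
  have hy : 0 < y := hy
  by_cases h : y ∈ S
  · simp only [h, indicator_of_mem, smul_eq_mul]
    rw [← Real.rpow_natCast, ← Real.rpow_add hy]
    congr 1
    push_cast [Nat.cast_sub hd]
    ring
  · simp [h]

lemma integrableOn_norm_rpow {d : ℕ} (hd : 1 ≤ d) {S : Set ℝ} (hS : MeasurableSet S)
    (hS0 : S ⊆ Ioi 0) (p : ℝ) :
    IntegrableOn (fun x : Space d => ‖x‖ ^ (p - d)) {x | ‖x‖ ∈ S} ↔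
      IntegrableOn (fun r : ℝ => r ^ (p - 1)) S := by
  have := nontrivial_space hd
  have hm : MeasurableSet {x : Space d | ‖x‖ ∈ S} := measurable_norm hS
  rw [← integrable_indicator_iff hm, indicator_norm_eq S (fun r => r ^ (p - d)),
    integrable_fun_norm_addHaar volume (f := S.indicator fun r => r ^ (p - d)),
    finrank_euclideanSpace_fin,
    integrableOn_congr_fun (pow_smul_indicator_rpow hd S p) measurableSet_Ioi,
    integrableOn_indicator_iff hS, inter_eq_left.mpr hS0]

lemma setIntegral_norm_rpow {d : ℕ} (hd : 1 ≤ d) {S : Set ℝ} (hS : MeasurableSet S)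
    (hS0 : S ⊆ Ioi 0) (p : ℝ) :
    ∫ x in {x : Space d | ‖x‖ ∈ S}, ‖x‖ ^ (p - d) = sphereArea d * ∫ r in S, r ^ (p - 1) := by
  have := nontrivial_space hd
  have hm : MeasurableSet {x : Space d | ‖x‖ ∈ S} := measurable_norm hS
  rw [← integral_indicator hm, indicator_norm_eq S (fun r => r ^ (p - d)),
    integral_fun_norm_addHaar volume (S.indicator fun r => r ^ (p - d)),
    finrank_euclideanSpace_fin,
    setIntegral_congr_fun measurableSet_Ioi (pow_smul_indicator_rpow hd S p),
    setIntegral_indicator hS, inter_eq_right.mpr hS0]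
  simp [sphereArea, mul_assoc]

lemma setOf_norm_mem_Ioo_ae_eq {d : ℕ} (hd : 1 ≤ d) (R : ℝ) :
    ({x : Space d | ‖x‖ ∈ Ioo 0 R} : Set (Space d)) =ᵐ[volume] ball 0 R := by
  have := nontrivial_space hd
  have h0 : ∀ᵐ x : Space d, x ≠ 0 := by simp [ae_iff, measure_singleton]
  refine Filter.eventuallyEq_set.mpr ?_
  filter_upwards [h0] with x hx
  simp [hx]

lemma setOf_norm_mem_Ici {d : ℕ} (R : ℝ) :
    ({x : Space d | ‖x‖ ∈ Ici R} : Set (Space d)) = (ball 0 R)ᶜ := by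
  ext x; simp

lemma integrableOn_ball_norm_rpow {d : ℕ} (hd : 1 ≤ d) {a R : ℝ} (ha : 0 < a) :
    IntegrableOn (fun x : Space d => ‖x‖ ^ (a - d)) (ball 0 R) := by
  rw [← integrableOn_congr_set_ae (setOf_norm_mem_Ioo_ae_eq hd R)]
  rcases le_or_gt R 0 with hR | hR
  · simp [Ioo_eq_empty_of_le hR]
  · rw [integrableOn_norm_rpow hd measurableSet_Ioo Ioo_subset_Ioi_self,
      intervalIntegral.integrableOn_Ioo_rpow_iff hR]
    linarith

lemma setIntegral_ball_norm_rpow {d : ℕ} (hd : 1 ≤ d) {a R : ℝ} (ha : 0 < a) (hR : 0 ≤ R) :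
    ∫ x in ball (0 : Space d) R, ‖x‖ ^ (a - d) = sphereArea d * (R ^ a / a) := by
  rw [← setIntegral_congr_set (setOf_norm_mem_Ioo_ae_eq hd R),
    setIntegral_norm_rpow hd measurableSet_Ioo Ioo_subset_Ioi_self, ← integral_Ioc_eq_integral_Ioo,
    ← intervalIntegral.integral_of_le hR, integral_rpow (by left; linarith)]
  simp [Real.zero_rpow ha.ne']

lemma integrableOn_compl_ball_norm_rpow {d : ℕ} (hd : 1 ≤ d) {a R : ℝ} (ha : 0 < a) (hR : 0 < R) :
    IntegrableOn (fun x : Space d => ‖x‖ ^ (-a - d)) (ball 0 R)ᶜ := by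
  rw [← setOf_norm_mem_Ici, integrableOn_norm_rpow hd measurableSet_Ici (Ici_subset_Ioi.mpr hR),
    integrableOn_Ici_iff_integrableOn_Ioi]
  exact integrableOn_Ioi_rpow_of_lt (by linarith) hR

lemma setIntegral_compl_ball_norm_rpow {d : ℕ} (hd : 1 ≤ d) {a R : ℝ} (ha : 0 < a) (hR : 0 < R) :
    ∫ x in (ball (0 : Space d) R)ᶜ, ‖x‖ ^ (-a - d) = sphereArea d * (R ^ (-a) / a) := by
  rw [← setOf_norm_mem_Ici, setIntegral_norm_rpow hd measurableSet_Ici (Ici_subset_Ioi.mpr hR),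
    integral_Ici_eq_integral_Ioi, integral_Ioi_rpow_of_lt (by linarith) hR]
  congr 1
  rw [show -a - 1 + 1 = -a by ring]
  field_simp

lemma setIntegral_annulus_norm_rpow {d : ℕ} (hd : 1 ≤ d) {R₁ R₂ : ℝ} (h₁ : 0 < R₁)
    (h₂ : R₁ ≤ R₂) :
    ∫ x in {x : Space d | ‖x‖ ∈ Ico R₁ R₂}, ‖x‖ ^ (0 - d : ℝ) =
      sphereArea d * Real.log (R₂ / R₁) := by
  rw [setIntegral_norm_rpow hd measurableSet_Ico
    (fun x hx => lt_of_lt_of_le h₁ hx.1), integral_Ico_eq_integral_Ioo,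
    ← integral_Ioc_eq_integral_Ioo, ← intervalIntegral.integral_of_le h₂]
  congr 1
  rw [← integral_inv_of_pos h₁ (h₁.trans_le h₂)]
  simp [Real.rpow_neg_one]

lemma integrableOn_annulus_norm_rpow {d : ℕ} (hd : 1 ≤ d) {R₁ R₂ : ℝ} (h₁ : 0 < R₁) :
    IntegrableOn (fun x : Space d => ‖x‖ ^ (0 - d : ℝ)) {x : Space d | ‖x‖ ∈ Ico R₁ R₂} := by
  rw [integrableOn_norm_rpow hd measurableSet_Ico (fun x hx => lt_of_lt_of_le h₁ hx.1)]
  refine IntegrableOn.mono_set (t := Icc R₁ R₂) ?_ Ico_subset_Icc_self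
  refine ContinuousOn.integrableOn_Icc fun x hx => ContinuousAt.continuousWithinAt ?_
  exact Real.continuousAt_rpow_const _ _ (Or.inl (h₁.trans_le hx.1).ne')

/-! ### Quadratic forms against radial weights -/

/-- The reflection in the hyperplane orthogonal to u − v sends u to v and preserves the norm and the
volume. -/
lemma integral_inner_sq_eq {d : ℕ} (f : ℝ → ℝ) {u v : Space d} (h : ‖u‖ = ‖v‖) :
    ∫ w : Space d, ⟪u, w⟫ ^ 2 * f ‖w‖ = ∫ w : Space d, ⟪v, w⟫ ^ 2 * f ‖w‖ := by
  let T := (ℝ ∙ (u - v))ᗮ.reflection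
  have hT : T u = v := Submodule.reflection_sub h
  rw [← T.measurePreserving.integral_comp T.toHomeomorph.measurableEmbedding
    (fun w => ⟪v, w⟫ ^ 2 * f ‖w‖)]
  refine integral_congr_ae (Eventually.of_forall fun w => ?_)
  simp only [LinearIsometryEquiv.norm_map]
  rw [← hT, LinearIsometryEquiv.inner_map_map]

/-- Comparing the directions e_i + e_j and e_i − e_j kills the mixed moments, and comparing e_i with
e_j makes the pure ones equal, each 1/d of the full second moment. Only the trace of B survives,
which is how the mean curvature appears. -/
lemma integral_bilin_mul_radial {d : ℕ} (hd : 1 ≤ d) (B : Space d →L[ℝ] Space d →L[ℝ] ℝ)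
    {f : ℝ → ℝ} (hf : Measurable f) (hi : Integrable fun w : Space d => ‖w‖ ^ 2 * f ‖w‖) :
    ∫ w : Space d, B w w * f ‖w‖ =
      (∑ i, B (EuclideanSpace.single i 1) (EuclideanSpace.single i 1)) / d *
        ∫ w : Space d, ‖w‖ ^ 2 * f ‖w‖ := by
  have hdom : ∀ g : Space d → ℝ, Measurable g → (∀ w, |g w| ≤ ‖w‖ ^ 2) →
      Integrable fun w : Space d => g w * f ‖w‖ := by
    intro g hg hb
    refine hi.mono (hg.mul (hf.comp measurable_norm)).aestronglyMeasurable
      (Eventually.of_forall fun w => ?_)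
    simp only [norm_mul, Real.norm_eq_abs, abs_pow, abs_norm]
    exact mul_le_mul_of_nonneg_right (hb w) (abs_nonneg _)
  have hc : ∀ (w : Space d) i, |w i| ≤ ‖w‖ := fun w i => by
    simpa using PiLp.norm_apply_le w i
  have hcm : ∀ i, Measurable fun w : Space d => w i := fun i => by fun_prop
  have hij : ∀ i j, Integrable fun w : Space d => w i * w j * f ‖w‖ := fun i j => by
    refine hdom (fun w => w i * w j) ((hcm i).mul (hcm j)) fun w => ?_
    rw [abs_mul, sq]
    exact mul_le_mul (hc w i) (hc w j) (abs_nonneg _) (norm_nonneg _)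
  have hin : ∀ i (w : Space d), ⟪(EuclideanSpace.single i 1 : Space d), w⟫ = w i := by
    intro i w; simp [EuclideanSpace.inner_single_left]
  have hoff : ∀ i j, i ≠ j → ∫ w : Space d, w i * w j * f ‖w‖ = 0 := by
    intro i j h
    have hn : ‖(EuclideanSpace.single i 1 + EuclideanSpace.single j 1 : Space d)‖ =
        ‖(EuclideanSpace.single i 1 - EuclideanSpace.single j 1 : Space d)‖ := by
      rw [← sq_eq_sq₀ (norm_nonneg _) (norm_nonneg _), norm_add_sq_real, norm_sub_sq_real, hin]
      simp [h]
    have key := integral_inner_sq_eq f hn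
    simp only [inner_add_left, inner_sub_left, hin] at key
    have e : ∀ w : Space d, (w i + w j) ^ 2 * f ‖w‖ =
        (w i - w j) ^ 2 * f ‖w‖ + 4 * (w i * w j * f ‖w‖) := fun w => by ring
    simp only [e] at key
    rw [integral_add, integral_const_mul] at key
    · linarith
    · have : (fun w : Space d => (w i - w j) ^ 2 * f ‖w‖) = fun w =>
          w i * w i * f ‖w‖ - 2 * (w i * w j * f ‖w‖) + w j * w j * f ‖w‖ := by ext w; ring
      rw [this]
      exact ((hij i i).sub ((hij i j).const_mul 2)).add (hij j j)
    · exact (hij i j).const_mul 4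
  have hdiag : ∀ i j, ∫ w : Space d, w i * w i * f ‖w‖ = ∫ w : Space d, w j * w j * f ‖w‖ := by
    intro i j
    have := integral_inner_sq_eq f (u := EuclideanSpace.single i 1)
      (v := (EuclideanSpace.single j 1 : Space d)) (by simp)
    simp only [hin] at this
    simpa only [sq] using this
  have hsum : ∀ i, (d : ℝ) * ∫ w : Space d, w i * w i * f ‖w‖ =
      ∫ w : Space d, ‖w‖ ^ 2 * f ‖w‖ := by
    intro i
    have : ∀ w : Space d, ‖w‖ ^ 2 * f ‖w‖ = ∑ j, w j * w j * f ‖w‖ := fun w => by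
      rw [EuclideanSpace.real_norm_sq_eq, Finset.sum_mul]
      simp only [sq]
    simp only [this]
    rw [integral_finsetSum _ fun j _ => hij j j, Finset.sum_congr rfl fun j _ => hdiag j i]
    simp
  have hB : ∀ w : Space d, B w w * f ‖w‖ =
      ∑ i, ∑ j, B (EuclideanSpace.single i 1) (EuclideanSpace.single j 1) *
        (w i * w j * f ‖w‖) := by
    intro w
    have hw : w = ∑ i, w i • (EuclideanSpace.single i 1 : Space d) := by
      simpa using ((EuclideanSpace.basisFun (Fin d) ℝ).sum_repr w).symm
    have hBw : B w w = ∑ i, ∑ j,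
        B (EuclideanSpace.single i 1) (EuclideanSpace.single j 1) * (w i * w j) := calc
      B w w = B (∑ i, w i • (EuclideanSpace.single i 1 : Space d))
          (∑ i, w i • (EuclideanSpace.single i 1 : Space d)) := by rw [← hw]
      _ = _ := by
        simp only [map_sum, map_smul, sum_apply, smul_apply, smul_eq_mul, Finset.mul_sum]
        rw [Finset.sum_comm]
        refine Finset.sum_congr rfl fun i _ => Finset.sum_congr rfl fun j _ => by ring
    rw [hBw]
    simp only [Finset.sum_mul]
    refine Finset.sum_congr rfl fun i _ => Finset.sum_congr rfl fun j _ => by ring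
  have hd0 : (d : ℝ) ≠ 0 := by positivity
  simp only [hB]
  rw [integral_finsetSum _ fun i _ => integrable_finsetSum _ fun j _ => (hij i j).const_mul _]
  have : ∀ i, ∫ w : Space d, ∑ j, B (EuclideanSpace.single i 1) (EuclideanSpace.single j 1) *
      (w i * w j * f ‖w‖) = B (EuclideanSpace.single i 1) (EuclideanSpace.single i 1) *
        ((∫ w : Space d, ‖w‖ ^ 2 * f ‖w‖) / d) := by
    intro i
    rw [integral_finsetSum _ fun j _ => (hij i j).const_mul _]
    simp only [integral_const_mul]
    rw [Finset.sum_eq_single i (fun j _ hj => by rw [hoff i j hj.symm, mul_zero]) (by simp),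
      ← hsum i]
    field_simp
  simp only [this, ← Finset.sum_mul]
  ring

/-! ### Integrals over bands and of even functions against a sign -/

/-- Fubini over vertical segments of length 2b. It bounds the contribution of the band around an
interface, where nothing is known about the phase. -/
lemma integrable_band {X : Type*} [MeasurableSpace X] {μ : Measure X} [SFinite μ]
    {F a b : X → ℝ} (hF : AEStronglyMeasurable F μ) (ha : Measurable a) (hb : Measurable b)
    (hb0 : ∀ x, 0 ≤ b x) (hi : Integrable (fun x => F x * b x) μ) :
    Integrable ({p : X × ℝ | |p.2 - a p.1| ≤ b p.1}.indicator fun p => F p.1) (μ.prod volume) ∧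
      ∫ p, {p : X × ℝ | |p.2 - a p.1| ≤ b p.1}.indicator (fun p => F p.1) p ∂(μ.prod volume) =
        2 * ∫ x, F x * b x ∂μ := by
  have hS : MeasurableSet {p : X × ℝ | |p.2 - a p.1| ≤ b p.1} :=
    measurableSet_le (by fun_prop) (by fun_prop)
  have hind : ∀ x y, {p : X × ℝ | |p.2 - a p.1| ≤ b p.1}.indicator (fun p => F p.1) (x, y) =
      (Icc (a x - b x) (a x + b x)).indicator (fun _ => F x) y := by
    intro x y
    have : |y - a x| ≤ b x ↔ y ∈ Icc (a x - b x) (a x + b x) := by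
      rw [abs_le, mem_Icc]; constructor <;> rintro ⟨h, h'⟩ <;> constructor <;> linarith
    by_cases h : |y - a x| ≤ b x
    · simp only [indicator, mem_ofPred_eq, h, if_true, this.mp h]
    · simp only [indicator, mem_ofPred_eq, h, if_false, mt this.mpr h]
  have hval : ∀ x (c : ℝ), ∫ y, (Icc (a x - b x) (a x + b x)).indicator (fun _ => c) y =
      2 * (c * b x) := by
    intro x c
    rw [integral_indicator measurableSet_Icc, setIntegral_const, Real.volume_real_Icc_of_le
      (by linarith [hb0 x]), smul_eq_mul]
    ring
  have hm : AEStronglyMeasurable ({p : X × ℝ | |p.2 - a p.1| ≤ b p.1}.indicator fun p => F p.1)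
      (μ.prod volume) := hF.comp_fst.indicator hS
  have hint : Integrable ({p : X × ℝ | |p.2 - a p.1| ≤ b p.1}.indicator fun p => F p.1)
      (μ.prod volume) := by
    rw [integrable_prod_iff hm]
    refine ⟨Eventually.of_forall fun x => ?_, ?_⟩
    · simp only [hind]
      rw [integrable_indicator_iff measurableSet_Icc]
      exact integrableOn_const (by simp)
    · simp only [hind, norm_indicator_eq_indicator_norm]
      simp only [hval]
      refine (hi.norm.const_mul 2).congr (Eventually.of_forall fun x => ?_)
      simp [abs_of_nonneg (hb0 x)]
  refine ⟨hint, ?_⟩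
  rw [integral_prod _ hint]
  simp only [hind, hval, integral_const_mul]

/-- The sign is 2·1_{h<a} − 1, and by evenness the half-lines on both sides of 0 carry the same
mass. -/
lemma integral_even_mul_step {f : ℝ → ℝ} (hf : Integrable f) (hev : ∀ x, f (-x) = f x) (a : ℝ) :
    ∫ h, f h * (if h < a then (1 : ℝ) else -1) = 2 * ∫ h in (0 : ℝ)..a, f h := by
  have hs : ∀ h, f h * (if h < a then (1 : ℝ) else -1) = 2 * (Iio a).indicator f h - f h := by
    intro h
    by_cases hh : h < a <;> simp [hh, indicator] ; ring
  simp only [hs]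
  rw [integral_sub ((hf.indicator measurableSet_Iio).const_mul 2) hf, integral_const_mul,
    integral_indicator measurableSet_Iio, ← integral_Iic_eq_integral_Iio,
    ← intervalIntegral.integral_Iic_sub_Iic hf.integrableOn hf.integrableOn,
    ← intervalIntegral.integral_Iic_add_Ioi (b := 0) hf.integrableOn hf.integrableOn]
  have : ∫ x in Ioi (0 : ℝ), f x = ∫ x in Iic (0 : ℝ), f x := by
    have := integral_comp_neg_Iic 0 f
    simp only [hev, neg_zero] at this
    exact this.symm
  rw [this]
  ring

end

noncomputable section

/-! ### Splitting off the last coordinate -/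

/-- The point `(w, h)` of `ℝ^(n+1)`. -/
def joinLast {n : ℕ} (w : Space n) (h : ℝ) : Space (n + 1) :=
  WithLp.toLp 2 (Fin.snoc (α := fun _ => ℝ) (fun i => w i) h)

@[simp] lemma joinLast_castSucc {n : ℕ} (w : Space n) (h : ℝ) (i : Fin n) :
    joinLast w h i.castSucc = w i := by simp [joinLast]

@[simp] lemma joinLast_last {n : ℕ} (w : Space n) (h : ℝ) : joinLast w h (Fin.last n) = h := by
  simp [joinLast]

lemma joinLast_ext {n : ℕ} {w : Space n} {h : ℝ} {x : Space (n + 1)}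
    (h₁ : ∀ i : Fin n, w i = x i.castSucc) (h₂ : h = x (Fin.last n)) : joinLast w h = x := by
  ext i
  refine Fin.lastCases ?_ (fun i => ?_) i
  · simpa using h₂
  · simpa using h₁ i

lemma joinLast_add {n : ℕ} (w w' : Space n) (h h' : ℝ) :
    joinLast (w + w') (h + h') = joinLast w h + joinLast w' h' := joinLast_ext (by simp) (by simp)

lemma joinLast_sub {n : ℕ} (w w' : Space n) (h h' : ℝ) :
    joinLast (w - w') (h - h') = joinLast w h - joinLast w' h' := joinLast_ext (by simp) (by simp)

lemma smul_joinLast {n : ℕ} (c : ℝ) (w : Space n) (h : ℝ) :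
    c • joinLast w h = joinLast (c • w) (c * h) := (joinLast_ext (by simp) (by simp)).symm

lemma norm_joinLast_sq {n : ℕ} (w : Space n) (h : ℝ) : ‖joinLast w h‖ ^ 2 = ‖w‖ ^ 2 + h ^ 2 := by
  simp [EuclideanSpace.real_norm_sq_eq, Fin.sum_univ_castSucc]

lemma norm_joinLast_zero {n : ℕ} (w : Space n) : ‖joinLast w 0‖ = ‖w‖ := by
  have := norm_joinLast_sq w 0
  rw [← sq_eq_sq₀ (norm_nonneg _) (norm_nonneg _), this]; ring

lemma norm_joinLast_zero_left {n : ℕ} (h : ℝ) : ‖joinLast (0 : Space n) h‖ = |h| := by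
  have := norm_joinLast_sq (0 : Space n) h
  rw [← sq_eq_sq₀ (norm_nonneg _) (abs_nonneg _), this]; simp

lemma norm_le_norm_joinLast {n : ℕ} (w : Space n) (h : ℝ) : ‖w‖ ≤ ‖joinLast w h‖ := by
  rw [← sq_le_sq₀ (norm_nonneg _) (norm_nonneg _), norm_joinLast_sq]; nlinarith [sq_nonneg h]

lemma abs_le_norm_joinLast {n : ℕ} (w : Space n) (h : ℝ) : |h| ≤ ‖joinLast w h‖ := by
  rw [← sq_le_sq₀ (abs_nonneg _) (norm_nonneg _), norm_joinLast_sq, sq_abs]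
  nlinarith [sq_nonneg ‖w‖]

lemma norm_joinLast_neg {n : ℕ} (w : Space n) (h : ℝ) : ‖joinLast w (-h)‖ = ‖joinLast w h‖ := by
  rw [← sq_eq_sq₀ (norm_nonneg _) (norm_nonneg _), norm_joinLast_sq, norm_joinLast_sq]; simp

lemma inner_joinLast {n : ℕ} (w w' : Space n) (h h' : ℝ) :
    ⟪joinLast w h, joinLast w' h'⟫ = ⟪w, w'⟫ + h * h' := by
  simp [PiLp.inner_apply, Fin.sum_univ_castSucc]; ring

lemma continuous_joinLast {n : ℕ} : Continuous fun p : Space n × ℝ => joinLast p.1 p.2 := by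
  have : Continuous fun p : Space n × ℝ =>
      (Fin.snoc (α := fun _ => ℝ) (fun i => p.1 i) p.2 : Fin (n + 1) → ℝ) := by
    refine continuous_pi fun i => ?_
    refine Fin.lastCases ?_ (fun i => ?_) i
    · simpa using continuous_snd
    · simp only [Fin.snoc_castSucc]; fun_prop
  exact (PiLp.continuous_toLp 2 _).comp this

/-- `(w, h) ↦ (w, h)` as a measurable equivalence `ℝ^n × ℝ ≃ ℝ^(n+1)`. -/
def joinEquiv (n : ℕ) : Space n × ℝ ≃ᵐ Space (n + 1) where
  toFun p := joinLast p.1 p.2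
  invFun x := (WithLp.toLp 2 fun i : Fin n => x i.castSucc, x (Fin.last n))
  left_inv p := by ext <;> simp
  right_inv x := joinLast_ext (by simp) (by simp)
  measurable_toFun := continuous_joinLast.measurable
  measurable_invFun := by
    refine Measurable.prodMk ?_ (by fun_prop)
    exact (WithLp.measurable_toLp 2 _).comp (by fun_prop)

lemma measurePreserving_joinEquiv (n : ℕ) : MeasurePreserving (joinEquiv n) := by
  have h1 : MeasurePreserving (Prod.map (WithLp.ofLp : Space n → _) (id : ℝ → ℝ)) volume volume :=
    (PiLp.volume_preserving_ofLp (Fin n)).prod (MeasurePreserving.id volume)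
  have h2 : MeasurePreserving (Prod.swap : (Fin n → ℝ) × ℝ → ℝ × (Fin n → ℝ)) volume volume :=
    Measure.measurePreserving_swap
  have h3 := (volume_preserving_piFinSuccAbove (fun _ : Fin (n + 1) => ℝ) (Fin.last n)).symm
  have h4 := PiLp.volume_preserving_toLp (Fin (n + 1))
  have := h4.comp (h3.comp (h2.comp h1))
  convert! this using 1
  ext p i
  simp [joinEquiv, MeasurableEquiv.piFinSuccAbove, Fin.insertNthEquiv, joinLast]

/-- Any isometry taking the last axis to ν serves as a frame: the profile is radial, so the choice
inside the tangent plane is immaterial. -/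
lemma exists_isometry_apply_joinLast {n : ℕ} {ν : Space (n + 1)} (hν : ‖ν‖ = 1) :
    ∃ T : Space (n + 1) ≃ₗᵢ[ℝ] Space (n + 1), T (joinLast 0 1) = ν :=
  ⟨_, Submodule.reflection_sub (v := joinLast 0 1) (by rw [norm_joinLast_zero_left, hν]; simp)⟩

lemma integral_frame {n : ℕ} (T : Space (n + 1) ≃ₗᵢ[ℝ] Space (n + 1)) (y : Space (n + 1))
    (F : Space (n + 1) → ℝ) :
    ∫ z, F z = ∫ p : Space n × ℝ, F (y + T (joinLast p.1 p.2)) := by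
  rw [← integral_add_left_eq_self F y,
    ← T.measurePreserving.integral_comp T.toHomeomorph.measurableEmbedding,
    ← (measurePreserving_joinEquiv n).integral_comp (joinEquiv n).measurableEmbedding]
  rfl

lemma integral_joinLast {n : ℕ} (F : Space (n + 1) → ℝ) :
    ∫ z, F z = ∫ p : Space n × ℝ, F (joinLast p.1 p.2) := by
  rw [← (measurePreserving_joinEquiv n).integral_comp (joinEquiv n).measurableEmbedding]
  rfl

lemma integrable_joinLast_iff {n : ℕ} {F : Space (n + 1) → ℝ} :
    Integrable (fun p : Space n × ℝ => F (joinLast p.1 p.2)) ↔ Integrable F :=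
  (measurePreserving_joinEquiv n).integrable_comp_emb (joinEquiv n).measurableEmbedding

end

noncomputable section

/-! ### Estimates on the profile -/

/-- The factor 2^q comes from 1 + a ≤ 2 max(1, a). Powers of 1 + a have no singularity at the
origin, and their products add exponents. -/
lemma inv_one_add_rpow_le {a q : ℝ} (ha : 0 ≤ a) (hq : 0 ≤ q) :
    1 / (1 + a ^ q) ≤ 2 ^ q * (1 + a) ^ (-q) := by
  rw [Real.rpow_neg (by positivity), ← div_eq_mul_inv, div_le_div_iff₀ (by positivity)
    (by positivity), one_mul]
  rcases le_total a 1 with h | h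
  · calc (1 + a) ^ q ≤ 2 ^ q := Real.rpow_le_rpow (by positivity) (by linarith) hq
      _ ≤ _ := le_mul_of_one_le_right (by positivity) (by linarith [Real.rpow_nonneg ha q])
  · calc (1 + a) ^ q ≤ (2 * a) ^ q := Real.rpow_le_rpow (by positivity) (by linarith) hq
      _ = 2 ^ q * a ^ q := Real.mul_rpow (by norm_num) ha
      _ ≤ _ := by gcongr; linarith

lemma integrable_one_add_norm_space {d : ℕ} {r : ℝ} (hr : (d : ℝ) < r) :
    Integrable fun w : Space d => (1 + ‖w‖) ^ (-r) :=
  integrable_one_add_norm (by simpa using hr)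

namespace IsAdmissibleProfile

variable {n : ℕ} {s : ℝ} {P : Space (n + 1) → ℝ} {c C : ℝ}

lemma pos (hP : IsAdmissibleProfile s P c C) (y : Space (n + 1)) : 0 < P y :=
  lt_of_lt_of_le (by have := hP.C_pos; positivity) (hP.lower y)

lemma le_rpow (hP : IsAdmissibleProfile s P c C) {y : Space (n + 1)} (hy : y ≠ 0) :
    P y ≤ C * ‖y‖ ^ (-((n + 1 : ℝ) + 2 * s)) := by
  refine (hP.upper y).trans ?_
  have : 0 < ‖y‖ ^ ((n + 1 : ℝ) + 2 * s) := Real.rpow_pos_of_pos (norm_pos_iff.mpr hy) _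
  rw [Real.rpow_neg (norm_nonneg _), ← div_eq_mul_inv]
  have := hP.C_pos
  gcongr
  linarith

lemma le_one_add (hP : IsAdmissibleProfile s P c C) (hs : 0 < s) (y : Space (n + 1)) :
    P y ≤ C * 2 ^ ((n + 1 : ℝ) + 2 * s) * (1 + ‖y‖) ^ (-((n + 1 : ℝ) + 2 * s)) := by
  refine (hP.upper y).trans ?_
  have := mul_le_mul_of_nonneg_left
    (inv_one_add_rpow_le (norm_nonneg y) (q := (n + 1 : ℝ) + 2 * s) (by positivity)) hP.C_pos.le
  rw [mul_one_div, ← mul_assoc] at this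
  exact this

lemma continuous (hP : IsAdmissibleProfile s P c C) : Continuous P := hP.contDiff.continuous

lemma integrable (hP : IsAdmissibleProfile s P c C) (hs : 0 < s) : Integrable P := by
  refine ((integrable_one_add_norm_space (d := n + 1) (r := (n + 1 : ℝ) + 2 * s)
    (by push_cast; linarith)).const_mul (C * 2 ^ ((n + 1 : ℝ) + 2 * s))).mono'
    hP.continuous.aestronglyMeasurable (Eventually.of_forall fun y => ?_)
  rw [Real.norm_of_nonneg (hP.pos y).le]
  exact hP.le_one_add hs y

lemma slice_integrable (hP : IsAdmissibleProfile s P c C) (hs : 0 < s) (h : ℝ) :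
    Integrable fun w : Space n => P (joinLast w h) := by
  have hC := hP.C_pos
  refine ((integrable_one_add_norm_space (d := n) (r := (n + 1 : ℝ) + 2 * s)
    (by linarith)).const_mul (C * 2 ^ ((n + 1 : ℝ) + 2 * s))).mono'
    (hP.continuous.comp (continuous_joinLast.comp
      (by fun_prop : Continuous fun w : Space n => (w, h)))).aestronglyMeasurable
    (Eventually.of_forall fun w => ?_)
  rw [Real.norm_of_nonneg (hP.pos _).le]
  refine (hP.le_one_add hs _).trans ?_
  refine mul_le_mul_of_nonneg_left ?_ (by positivity)
  exact Real.rpow_le_rpow_of_nonpos (by positivity) (by gcongr; exact norm_le_norm_joinLast w h)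
    (by linarith [(n.cast_nonneg : (0 : ℝ) ≤ n)])

lemma continuous_vertical (hP : IsAdmissibleProfile s P c C) (w : Space n) :
    Continuous fun h : ℝ => P (joinLast w h) :=
  hP.continuous.comp (continuous_joinLast.comp (by fun_prop : Continuous fun h : ℝ => (w, h)))

lemma vertical_integrable (hP : IsAdmissibleProfile s P c C) (hn : 1 ≤ n) (hs : 0 < s)
    (w : Space n) : Integrable fun h : ℝ => P (joinLast w h) := by
  have hC := hP.C_pos
  have hn' : (1 : ℝ) ≤ n := by exact_mod_cast hn
  refine ((integrable_one_add_norm (E := ℝ) (μ := volume) (r := (n + 1 : ℝ) + 2 * s)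
    (by simp; linarith)).const_mul (C * 2 ^ ((n + 1 : ℝ) + 2 * s))).mono'
    (hP.continuous_vertical w).aestronglyMeasurable (Eventually.of_forall fun h => ?_)
  rw [Real.norm_of_nonneg (hP.pos _).le]
  refine (hP.le_one_add hs _).trans ?_
  refine mul_le_mul_of_nonneg_left ?_ (by positivity)
  exact Real.rpow_le_rpow_of_nonpos (by positivity) (by gcongr; exact abs_le_norm_joinLast w h)
    (by linarith)

lemma vertical_even (hP : IsAdmissibleProfile s P c C) (w : Space n) (h : ℝ) :
    P (joinLast w (-h)) = P (joinLast w h) :=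
  hP.radial _ _ (norm_joinLast_neg w h)

/-- The Lipschitz constant appearing in the increment estimates. -/
def lipConst (_ : IsAdmissibleProfile s P c C) : ℝ := C * 2 ^ ((n + 1 : ℝ) + 2 * s + 1)

lemma lipConst_pos (hP : IsAdmissibleProfile s P c C) : 0 < hP.lipConst := by
  have := hP.C_pos
  unfold lipConst; positivity

/-- The mean value inequality on a convex set where 1 + ‖z‖ is bounded below by k. It is applied to
vertical lines, with k = 1 + ‖w‖, and to unit balls. -/
lemma abs_sub_le (hP : IsAdmissibleProfile s P c C) (hs : 0 < s) {S : Set (Space (n + 1))}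
    (hS : Convex ℝ S) {k : ℝ} (hk : 0 < k) (hSk : ∀ z ∈ S, k ≤ 1 + ‖z‖)
    {x x' : Space (n + 1)} (hx : x ∈ S) (hx' : x' ∈ S) :
    |P x - P x'| ≤ hP.lipConst * k ^ (-((n + 1 : ℝ) + 2 * s + 1)) * ‖x - x'‖ := by
  have hC := hP.C_pos
  rw [← Real.norm_eq_abs]
  refine hS.norm_image_sub_le_of_norm_fderiv_le (𝕜 := ℝ)
    (fun z _ => (hP.contDiff.differentiable one_ne_zero) z) (fun z hz => ?_) hx' hx
  have : ‖fderiv ℝ P z‖ = ‖gradient P z‖ := by simp [gradient]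
  rw [this]
  refine (hP.gradient_le z).trans ?_
  have h1 := mul_le_mul_of_nonneg_left
    (inv_one_add_rpow_le (norm_nonneg z) (q := (n + 1 : ℝ) + 2 * s + 1) (by positivity)) hC.le
  rw [mul_one_div, ← mul_assoc] at h1
  refine h1.trans ?_
  unfold lipConst
  refine mul_le_mul_of_nonneg_left ?_ (by positivity)
  exact Real.rpow_le_rpow_of_nonpos hk (hSk z hz)
    (by linarith [(n.cast_nonneg : (0 : ℝ) ≤ n)])

lemma abs_vertical_sub_le (hP : IsAdmissibleProfile s P c C) (hs : 0 < s) (w : Space n)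
    (h h' : ℝ) : |P (joinLast w h) - P (joinLast w h')| ≤
      hP.lipConst * (1 + ‖w‖) ^ (-((n + 1 : ℝ) + 2 * s + 1)) * |h - h'| := by
  have hS : Convex ℝ (range fun h => joinLast w h) := by
    rintro _ ⟨h₁, rfl⟩ _ ⟨h₂, rfl⟩ a b _ _ hab
    refine ⟨a * h₁ + b * h₂, ?_⟩
    simp only [smul_joinLast, ← joinLast_add, ← add_smul, hab, one_smul]
  have := hP.abs_sub_le hs hS (k := 1 + ‖w‖) (by positivity)
    (by rintro _ ⟨h, rfl⟩; linarith [norm_le_norm_joinLast w h]) ⟨h, rfl⟩ ⟨h', rfl⟩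
  rwa [← joinLast_sub, sub_self, norm_joinLast_zero_left] at this

lemma abs_sub_le_of_closedBall (hP : IsAdmissibleProfile s P c C) (hs : 0 < s)
    {z x x' : Space (n + 1)} (hx : ‖x - z‖ ≤ 1) (hx' : ‖x' - z‖ ≤ 1) :
    |P x - P x'| ≤ hP.lipConst * 2 ^ ((n + 1 : ℝ) + 2 * s + 1) *
      (1 + ‖z‖) ^ (-((n + 1 : ℝ) + 2 * s + 1)) * ‖x - x'‖ := by
  -- For u in the unit ball around z both 1 + ‖u‖ ≥ ‖z‖ and 1 + ‖u‖ ≥ 1 hold; k is the average of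
  -- the two bounds.
  have := hP.abs_sub_le hs (convex_closedBall z 1) (k := (1 + ‖z‖) / 2) (by positivity)
    (fun u hu => ?_) (mem_closedBall_iff_norm.mpr hx) (mem_closedBall_iff_norm.mpr hx')
  · rwa [Real.div_rpow (by positivity) (by norm_num), Real.rpow_neg (by norm_num : (0 : ℝ) ≤ 2),
      div_inv_eq_mul, mul_comm (_ ^ _) (2 ^ _), ← mul_assoc] at this
  · have h1 := norm_sub_norm_le z u
    rw [mem_closedBall_iff_norm, ← norm_neg, neg_sub] at hu
    linarith [norm_nonneg u]

end IsAdmissibleProfile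

/-! ### Increments of the rescaled diffusion along the normal -/

/-- The diffusion of the phase `f`, evaluated at `(0, η)`. -/
def slideIntegral {n : ℕ} (P : Space (n + 1) → ℝ) (f : Space n × ℝ → ℝ) (η : ℝ) : ℝ :=
  ∫ p : Space n × ℝ, P (joinLast p.1 (p.2 - η)) * f p

/-- The phase `1` below and `-1` above `a`. -/
def step (a h : ℝ) : ℝ := if h < a then 1 else -1

lemma abs_step (a h : ℝ) : |step a h| = 1 := by unfold step; split_ifs <;> simp

lemma measurable_step {X : Type*} [MeasurableSpace X] {f g : X → ℝ} (hf : Measurable f)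
    (hg : Measurable g) : Measurable fun x => step (f x) (g x) :=
  Measurable.ite (measurableSet_lt hg hf) measurable_const measurable_const

/-- On `|w|, |h| < R`, outside the band `|h - a w| ≤ b w`, the phase `f` is `1` below and `-1`
above. -/
def BandPhase {n : ℕ} (f : Space n × ℝ → ℝ) (R : ℝ) (a b : Space n → ℝ) : Prop :=
  ∀ w h, ‖w‖ < R → |h| < R → b w < |h - a w| → f (w, h) = step (a w) h

section increments

variable {n : ℕ} {s : ℝ} {P : Space (n + 1) → ℝ} {c C : ℝ}

lemma integrable_slide (hP : IsAdmissibleProfile s P c C) (hs : 0 < s) (η : ℝ) :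
    Integrable fun p : Space n × ℝ => P (joinLast p.1 (p.2 - η)) := by
  have : (fun p : Space n × ℝ => P (joinLast p.1 (p.2 - η))) =
      fun p => (fun z => P (z - joinLast 0 η)) (joinLast p.1 p.2) := by
    ext p; simp [← joinLast_sub]
  rw [this, integrable_joinLast_iff (F := fun z => P (z - joinLast 0 η))]
  exact (hP.integrable hs).comp_sub_right _

lemma integrable_slide_mul (hP : IsAdmissibleProfile s P c C) (hs : 0 < s) (η : ℝ)
    {f : Space n × ℝ → ℝ} (hf : Measurable f) (hf1 : ∀ p, |f p| ≤ 1) :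
    Integrable fun p : Space n × ℝ => P (joinLast p.1 (p.2 - η)) * f p :=
  (integrable_slide hP hs η).mul_bdd (c := 1) hf.aestronglyMeasurable
    (Eventually.of_forall fun p => by simpa using hf1 p)

/-- Translating by η moves the jump to −η, where the evenness of the vertical profile applies. The
minus sign reflects that moving up leaves the set. -/
lemma integral_vertical_step (hP : IsAdmissibleProfile s P c C) (hn : 1 ≤ n) (hs : 0 < s)
    (w : Space n) (η : ℝ) :
    ∫ h, P (joinLast w (h - η)) * step 0 h = -2 * ∫ h in (0 : ℝ)..η, P (joinLast w h) := by
  rw [← integral_add_right_eq_self _ η]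
  have : ∀ h, P (joinLast w (h + η - η)) * step 0 (h + η) =
      P (joinLast w h) * (if h < -η then 1 else -1) := by
    intro h
    simp only [add_sub_cancel_right, step]
    congr 1
    refine if_congr ⟨fun h => by linarith, fun h => by linarith⟩ rfl rfl
  simp only [this]
  rw [integral_even_mul_step (hP.vertical_integrable hn hs w) (hP.vertical_even w) (-η)]
  have := intervalIntegral.integral_comp_neg (a := 0) (b := η) (fun h => P (joinLast w h))
  simp only [hP.vertical_even, neg_zero] at this
  rw [this, intervalIntegral.integral_symm]
  ring

/-- The lower bound yields strict monotonicity on all of [−1, 1]; the second estimate identifies the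
slope near 0. -/
lemma vertical_average_bounds (hP : IsAdmissibleProfile s P c C) (hs : 0 < s) (w : Space n)
    {η η' : ℝ} (hη : |η| ≤ 1) (hη' : |η'| ≤ 1) (hle : η' ≤ η) :
    (η - η') * (C⁻¹ / (1 + (‖w‖ + 1) ^ ((n + 1 : ℝ) + 2 * s))) ≤
        ∫ h in η'..η, P (joinLast w h) ∧
      |(∫ h in η'..η, P (joinLast w h)) - (η - η') * P (joinLast w 0)| ≤
        (η - η') * (max |η| |η'| * (hP.lipConst * (1 + ‖w‖) ^ (-((n + 1 : ℝ) + 2 * s + 1)))) := by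
  have hC := hP.C_pos
  have hii : IntervalIntegrable (fun h => P (joinLast w h)) volume η' η :=
    (hP.continuous_vertical w).intervalIntegrable _ _
  constructor
  · have := intervalIntegral.integral_mono_on hle
      (f := fun _ => C⁻¹ / (1 + (‖w‖ + 1) ^ ((n + 1 : ℝ) + 2 * s))) (by simp) hii ?_
    · rwa [intervalIntegral.integral_const, smul_eq_mul] at this
    · intro h hh
      refine le_trans ?_ (hP.lower _)
      have h1 : |h| ≤ 1 := abs_le.mpr ⟨by linarith [(abs_le.mp hη').1, hh.1],
        by linarith [(abs_le.mp hη).2, hh.2]⟩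
      have h2 : ‖joinLast w h‖ ≤ ‖w‖ + 1 := by
        have : joinLast w h = joinLast w 0 + joinLast 0 h := by simp [← joinLast_add]
        rw [this]
        refine (norm_add_le _ _).trans ?_
        rw [norm_joinLast_zero, norm_joinLast_zero_left]
        linarith
      gcongr
  · have h1 : (∫ h in η'..η, P (joinLast w h)) - (η - η') * P (joinLast w 0) =
        ∫ h in η'..η, (P (joinLast w h) - P (joinLast w 0)) := by
      rw [intervalIntegral.integral_sub hii (by simp), intervalIntegral.integral_const, smul_eq_mul]
    rw [h1, ← Real.norm_eq_abs]
    have := intervalIntegral.norm_integral_le_of_norm_le_const (a := η') (b := η)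
      (f := fun h => P (joinLast w h) - P (joinLast w 0))
      (C := max |η| |η'| * (hP.lipConst * (1 + ‖w‖) ^ (-((n + 1 : ℝ) + 2 * s + 1)))) ?_
    · rwa [abs_of_nonneg (sub_nonneg.mpr hle), mul_comm] at this
    · intro h hh
      rw [uIoc_of_le hle] at hh
      rw [Real.norm_eq_abs, mul_comm]
      refine (hP.abs_vertical_sub_le hs w h 0).trans ?_
      have := hP.lipConst_pos
      refine mul_le_mul_of_nonneg_left ?_ (by positivity)
      rw [sub_zero]
      rcases le_total 0 h with h0 | h0
      · rw [abs_of_nonneg h0]; exact (hh.2.trans (le_abs_self _)).trans (le_max_left _ _)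
      · rw [abs_of_nonpos h0]
        exact (by linarith [neg_abs_le η', hh.1] : -h ≤ |η'|).trans (le_max_right _ _)

end increments

end

/-! ### Increments of the diffusion for a nearly flat interface -/

noncomputable section

variable {n : ℕ} {s : ℝ} {P : Space (n + 1) → ℝ} {c C : ℝ}

/-- The weighted size of the region where a phase with a flat interface in the band of
half-width `M |w|^{1+β}` may deviate from the half-space. -/
lemma exists_weight_deviation_le (hs : 0 < s) {β : ℝ} (hβ0 : 0 < β) (hβ1 : β ≤ 1) :
    ∃ A > 0, ∀ (f : Space n × ℝ → ℝ) (R M : ℝ), Measurable f → (∀ p, |f p| ≤ 1) → 0 < R → 0 ≤ M →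
      BandPhase f R 0 (fun w => M * ‖w‖ ^ (1 + β)) →
      Integrable (fun p : Space n × ℝ =>
        (1 + ‖joinLast p.1 p.2‖) ^ (-((n + 1 : ℝ) + 2 * s + 1)) * |f p - step 0 p.2|) ∧
      ∫ p : Space n × ℝ, (1 + ‖joinLast p.1 p.2‖) ^ (-((n + 1 : ℝ) + 2 * s + 1)) *
        |f p - step 0 p.2| ≤ A * (M + R ^ (-β)) := by
  set q : ℝ := (n + 1 : ℝ) + 2 * s + 1 with hq
  have hn0 : (0 : ℝ) ≤ n := n.cast_nonneg
  -- Inside the cylinder the deviation sits in the band, whose width M|w|^(1+β) costs 1 + β powers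
  -- of decay; q − (1 + β) > n remains because β ≤ 1. Outside it 1 + ‖x‖ ≥ R, so giving up β powers
  -- of decay gains the factor R^(-β).
  have hI1 := integrable_one_add_norm_space (d := n) (r := q - (1 + β)) (by linarith)
  have hI2 := integrable_joinLast_iff.mpr
    (integrable_one_add_norm_space (d := n + 1) (r := q - β) (by push_cast; linarith))
  have hI3 := integrable_joinLast_iff.mpr
    (integrable_one_add_norm_space (d := n + 1) (r := q) (by push_cast; linarith))
  set A₁ := ∫ w : Space n, (1 + ‖w‖) ^ (-(q - (1 + β))) with hA₁
  set A₂ := ∫ p : Space n × ℝ, (1 + ‖joinLast p.1 p.2‖) ^ (-(q - β)) with hA₂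
  have hA₁0 : 0 ≤ A₁ := integral_nonneg fun w => by positivity
  have hA₂0 : 0 ≤ A₂ := integral_nonneg fun w => by positivity
  refine ⟨4 * A₁ + 2 * A₂ + 1, by positivity, fun f R M hf hf1 hR hM hband => ?_⟩
  have hint : Integrable (fun p : Space n × ℝ =>
      (1 + ‖joinLast p.1 p.2‖) ^ (-q) * |f p - step 0 p.2|) := by
    refine hI3.mul_bdd (c := 2)
      (hf.sub (measurable_step measurable_const measurable_snd)).abs.aestronglyMeasurable
      (Eventually.of_forall fun p => ?_)
    rw [Real.norm_eq_abs, abs_abs]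
    exact (abs_sub _ _).trans (by linarith [hf1 p, abs_step 0 p.2])
  refine ⟨hint, ?_⟩
  have hle : ∀ w : Space n, 2 * (1 + ‖w‖) ^ (-q) * (M * ‖w‖ ^ (1 + β)) ≤
      2 * M * (1 + ‖w‖) ^ (-(q - (1 + β))) := by
    intro w
    have e : (1 + ‖w‖) ^ (-(q - (1 + β))) = (1 + ‖w‖) ^ (-q) * (1 + ‖w‖) ^ (1 + β) := by
      rw [← Real.rpow_add (by positivity)]; congr 1; ring
    rw [e]
    have : ‖w‖ ^ (1 + β) ≤ (1 + ‖w‖) ^ (1 + β) :=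
      Real.rpow_le_rpow (by positivity) (by linarith) (by linarith)
    calc _ = 2 * M * (1 + ‖w‖) ^ (-q) * ‖w‖ ^ (1 + β) := by ring
      _ ≤ 2 * M * (1 + ‖w‖) ^ (-q) * (1 + ‖w‖) ^ (1 + β) := by gcongr
      _ = _ := by ring
  have hcont : Continuous fun w : Space n => (1 + ‖w‖) ^ (-q) :=
    (by fun_prop : Continuous fun w : Space n => 1 + ‖w‖).rpow_const
      fun w => Or.inl (by positivity)
  have hbm : Measurable fun w : Space n => M * ‖w‖ ^ (1 + β) := by fun_prop
  have hbI : Integrable fun w : Space n => 2 * (1 + ‖w‖) ^ (-q) * (M * ‖w‖ ^ (1 + β)) := by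
    refine (hI1.const_mul (2 * M)).mono'
      ((hcont.measurable.const_mul 2).mul hbm).aestronglyMeasurable
      (Eventually.of_forall fun w => ?_)
    rw [Real.norm_of_nonneg (by positivity)]
    exact hle w
  obtain ⟨hB1, hB2⟩ := integrable_band (μ := (volume : Measure (Space n)))
    (F := fun w => 2 * (1 + ‖w‖) ^ (-q)) (a := 0) (b := fun w => M * ‖w‖ ^ (1 + β))
    (hcont.const_mul 2).aestronglyMeasurable
    measurable_const hbm (fun w => by positivity) hbI
  rw [← Measure.volume_eq_prod] at hB1 hB2
  have hpt : ∀ p : Space n × ℝ, (1 + ‖joinLast p.1 p.2‖) ^ (-q) * |f p - step 0 p.2| ≤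
      {p : Space n × ℝ | |p.2 - (0 : Space n → ℝ) p.1| ≤ M * ‖p.1‖ ^ (1 + β)}.indicator
        (fun p => 2 * (1 + ‖p.1‖) ^ (-q)) p +
      2 * R ^ (-β) * (1 + ‖joinLast p.1 p.2‖) ^ (-(q - β)) := by
    rintro ⟨w, h⟩
    have hind : 0 ≤ {p : Space n × ℝ | |p.2 - (0 : Space n → ℝ) p.1| ≤
        M * ‖p.1‖ ^ (1 + β)}.indicator (fun p => 2 * (1 + ‖p.1‖) ^ (-q)) (w, h) :=
      indicator_nonneg (fun p _ => by positivity) _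
    have hsec : 0 ≤ 2 * R ^ (-β) * (1 + ‖joinLast w h‖) ^ (-(q - β)) := by positivity
    have h2 : |f (w, h) - step 0 h| ≤ 2 :=
      (abs_sub _ _).trans (by linarith [hf1 (w, h), abs_step 0 h])
    by_cases hc : ‖w‖ < R ∧ |h| < R
    · by_cases hb : M * ‖w‖ ^ (1 + β) < |h|
      · have := hband w h hc.1 hc.2 (by simpa using hb)
        simp only [this, Pi.zero_apply, sub_self, abs_zero, mul_zero]
        exact add_nonneg hind hsec
      · have hmem : (w, h) ∈ {p : Space n × ℝ | |p.2 - (0 : Space n → ℝ) p.1| ≤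
            M * ‖p.1‖ ^ (1 + β)} := by simpa using not_lt.mp hb
        rw [indicator_of_mem hmem]
        have : (1 + ‖joinLast w h‖) ^ (-q) ≤ (1 + ‖w‖) ^ (-q) :=
          Real.rpow_le_rpow_of_nonpos (by positivity) (by gcongr; exact norm_le_norm_joinLast w h)
            (by linarith)
        have h3 : (1 + ‖joinLast w h‖) ^ (-q) * |f (w, h) - step 0 h| ≤
            (1 + ‖w‖) ^ (-q) * 2 := by gcongr
        dsimp only
        linarith
    · have hRn : R ≤ 1 + ‖joinLast w h‖ := by
        by_contra hcon
        exact hc ⟨by linarith [norm_le_norm_joinLast w h], by linarith [abs_le_norm_joinLast w h]⟩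
      have e : (1 + ‖joinLast w h‖) ^ (-(q - β)) =
          (1 + ‖joinLast w h‖) ^ (-q) * (1 + ‖joinLast w h‖) ^ β := by
        rw [← Real.rpow_add (by positivity)]; congr 1; ring
      have h4 : 1 ≤ R ^ (-β) * (1 + ‖joinLast w h‖) ^ β := by
        rw [Real.rpow_neg hR.le, inv_mul_eq_div, one_le_div (by positivity)]
        exact Real.rpow_le_rpow hR.le hRn hβ0.le
      have h5 : (1 + ‖joinLast w h‖) ^ (-q) * |f (w, h) - step 0 h| ≤
          (1 + ‖joinLast w h‖) ^ (-q) * 2 := by gcongr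
      have h6 : (1 + ‖joinLast w h‖) ^ (-q) * 2 ≤
          2 * R ^ (-β) * (1 + ‖joinLast w h‖) ^ (-(q - β)) := by
        rw [e]
        calc _ ≤ (1 + ‖joinLast w h‖) ^ (-q) * 2 * (R ^ (-β) * (1 + ‖joinLast w h‖) ^ β) :=
              le_mul_of_one_le_right (by positivity) h4
          _ = _ := by ring
      dsimp only
      linarith
  have hmono := integral_mono hint (hB1.add (hI2.const_mul (2 * R ^ (-β)))) hpt
  refine hmono.trans ?_
  have hadd := integral_add hB1 (hI2.const_mul (2 * R ^ (-β)))
  rw [integral_const_mul, ← hA₂] at hadd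
  refine hadd.le.trans ?_
  have : ∫ p : Space n × ℝ, {p : Space n × ℝ | |p.2 - (0 : Space n → ℝ) p.1| ≤
      M * ‖p.1‖ ^ (1 + β)}.indicator (fun p => 2 * (1 + ‖p.1‖) ^ (-q)) p ≤ 2 * (2 * M * A₁) := by
    refine hB2.le.trans ?_
    rw [hA₁, ← integral_const_mul (2 * M)]
    exact mul_le_mul_of_nonneg_left (integral_mono hbI (hI1.const_mul _) hle) (by norm_num)
  have hRb : 0 ≤ R ^ (-β) := by positivity
  nlinarith [mul_nonneg hA₁0 hRb, mul_nonneg hA₂0 hM]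

lemma slideIntegral_step (hP : IsAdmissibleProfile s P c C) (hn : 1 ≤ n) (hs : 0 < s) (η : ℝ) :
    Integrable (fun w : Space n => ∫ h in (0 : ℝ)..η, P (joinLast w h)) ∧
      slideIntegral P (fun p => step 0 p.2) η =
        -2 * ∫ w : Space n, ∫ h in (0 : ℝ)..η, P (joinLast w h) := by
  have hI := integrable_slide_mul hP hs η (f := fun p => step 0 p.2)
    (measurable_step measurable_const measurable_snd) (fun p => (abs_step 0 p.2).le)
  have h1 := hI.integral_prod_left
  simp only [integral_vertical_step hP hn hs] at h1
  refine ⟨?_, ?_⟩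
  · have := h1.const_mul (-1 / 2)
    refine this.congr (Eventually.of_forall fun w => ?_)
    ring
  · unfold slideIntegral
    rw [Measure.volume_eq_prod, integral_prod _ hI]
    simp only [integral_vertical_step hP hn hs, integral_const_mul]

lemma sliceMass_eq : sliceMass P = ∫ w : Space n, P (joinLast w 0) := rfl

lemma sliceMass_pos (hP : IsAdmissibleProfile s P c C) (hs : 0 < s) : 0 < sliceMass P := by
  rw [sliceMass_eq, integral_pos_iff_support_of_nonneg (fun w => (hP.pos _).le)
    (hP.slice_integrable hs 0)]
  have : Function.support (fun w : Space n => P (joinLast w 0)) = univ := by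
    ext w; simp [(hP.pos _).ne']
  rw [this]
  exact isOpen_univ.measure_pos _ univ_nonempty

/-- The increments of the diffusion along the normal, at the natural scale. -/
theorem exists_slideIntegral_increment (hP : IsAdmissibleProfile s P c C) (hn : 1 ≤ n)
    (hs : 0 < s) {β : ℝ} (hβ0 : 0 < β) (hβ1 : β ≤ 1) :
    ∃ A > 0, ∃ m > 0, ∀ (f : Space n × ℝ → ℝ) (R M : ℝ), Measurable f → (∀ p, |f p| ≤ 1) →
      0 < R → 0 ≤ M → BandPhase f R 0 (fun w => M * ‖w‖ ^ (1 + β)) →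
      ∀ η η' : ℝ, |η| ≤ 1 → |η'| ≤ 1 → η' ≤ η →
        |slideIntegral P f η - slideIntegral P f η' + 2 * sliceMass P * (η - η')| ≤
          A * (M + R ^ (-β) + max |η| |η'|) * (η - η') ∧
        (m - A * (M + R ^ (-β))) * (η - η') ≤ slideIntegral P f η' - slideIntegral P f η := by
  obtain ⟨A₀, hA₀, hdev⟩ := exists_weight_deviation_le (n := n) hs hβ0 hβ1
  set q : ℝ := (n + 1 : ℝ) + 2 * s + 1 with hq
  have hn0 : (0 : ℝ) ≤ n := n.cast_nonneg
  have hC := hP.C_pos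
  have hL := hP.lipConst_pos
  have hI := (integrable_one_add_norm_space (d := n) (r := q) (by linarith)).const_mul hP.lipConst
  set A₁ := ∫ w : Space n, hP.lipConst * (1 + ‖w‖) ^ (-q) with hA₁
  have hA₁0 : 0 ≤ A₁ := integral_nonneg fun w => by positivity
  set low : Space n → ℝ := fun w => C⁻¹ / (1 + (‖w‖ + 1) ^ ((n + 1 : ℝ) + 2 * s)) with hlow
  have hlowpos : ∀ w, 0 < low w := fun w => by positivity
  have hlowc : Continuous low := by
    refine continuous_const.div ?_ fun w => by positivity
    exact continuous_const.add ((by fun_prop : Continuous fun w : Space n => ‖w‖ + 1).rpow_const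
      fun w => Or.inl (by positivity))
  have hlowI : Integrable low := by
    refine (hP.slice_integrable hs 0).mono' hlowc.aestronglyMeasurable
      (Eventually.of_forall fun w => ?_)
    rw [Real.norm_of_nonneg (hlowpos w).le]
    refine le_trans ?_ (hP.lower _)
    rw [norm_joinLast_zero]
    simp only [hlow]
    gcongr
    linarith
  have hm0 : 0 < ∫ w, low w := by
    rw [integral_pos_iff_support_of_nonneg (fun w => (hlowpos w).le) hlowI]
    have : Function.support low = univ := by ext w; simp [(hlowpos w).ne']
    rw [this]
    exact isOpen_univ.measure_pos _ univ_nonempty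
  -- `low` bounds P(w, h) below for all |h| ≤ 1, so the second constant is a lower slope for the
  -- half-space valid on the whole interval. The first collects the deviation from the half-space
  -- and the vertical Lipschitz error.
  refine ⟨hP.lipConst * 2 ^ q * A₀ + 2 * A₁, by positivity, 2 * ∫ w, low w, by positivity,
    fun f R M hf hf1 hR hM hband η η' hη hη' hle => ?_⟩
  obtain ⟨hJ, hJle⟩ := hdev f R M hf hf1 hR hM hband
  have hRb : 0 ≤ R ^ (-β) := by positivity
  have hle0 : 0 ≤ η - η' := sub_nonneg.mpr hle
  have hmax : 0 ≤ max |η| |η'| := (abs_nonneg _).trans (le_max_left _ _)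
  set U₀ := slideIntegral P (fun p : Space n × ℝ => step 0 p.2) with hU₀
  have hstepm : Measurable fun p : Space n × ℝ => step 0 p.2 :=
    measurable_step measurable_const measurable_snd
  have hstep1 : ∀ p : Space n × ℝ, |step 0 p.2| ≤ 1 := fun p => (abs_step 0 p.2).le
  -- the flat interface
  have hflat : U₀ η - U₀ η' = -2 * ∫ w : Space n, ∫ h in η'..η, P (joinLast w h) := by
    rw [hU₀, (slideIntegral_step hP hn hs η).2, (slideIntegral_step hP hn hs η').2, ← mul_sub,
      ← integral_sub (slideIntegral_step hP hn hs η).1 (slideIntegral_step hP hn hs η').1]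
    congr 2
    ext w
    have hii : ∀ a b, IntervalIntegrable (fun h => P (joinLast w h)) volume a b :=
      fun a b => (hP.continuous_vertical w).intervalIntegrable _ _
    rw [intervalIntegral.integral_interval_sub_left (hii _ _) (hii _ _)]
  have hφI : Integrable fun w : Space n => ∫ h in η'..η, P (joinLast w h) := by
    refine ((slideIntegral_step hP hn hs η).1.sub (slideIntegral_step hP hn hs η').1).congr
      (Eventually.of_forall fun w => ?_)
    have hii : ∀ a b, IntervalIntegrable (fun h => P (joinLast w h)) volume a b :=
      fun a b => (hP.continuous_vertical w).intervalIntegrable _ _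
    exact intervalIntegral.integral_interval_sub_left (hii _ _) (hii _ _)
  have hφlow : (η - η') * ∫ w, low w ≤ ∫ w : Space n, ∫ h in η'..η, P (joinLast w h) := by
    rw [← integral_const_mul]
    exact integral_mono (hlowI.const_mul _) hφI fun w =>
      (vertical_average_bounds hP hs w hη hη' hle).1
  have hφ : |(∫ w : Space n, ∫ h in η'..η, P (joinLast w h)) - (η - η') * sliceMass P| ≤
      (η - η') * (max |η| |η'| * A₁) := by
    rw [sliceMass_eq, ← integral_const_mul, ← integral_sub hφI
      ((hP.slice_integrable hs 0).const_mul _), hA₁, ← integral_const_mul, ← integral_const_mul]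
    refine (abs_integral_le_integral_abs).trans ?_
    refine integral_mono ((hφI.sub ((hP.slice_integrable hs 0).const_mul _)).abs)
      ((hI.const_mul _).const_mul _) fun w => ?_
    exact (vertical_average_bounds hP hs w hη hη' hle).2
  -- the deviation from the flat interface
  have hdiff : |(slideIntegral P f η - slideIntegral P f η') - (U₀ η - U₀ η')| ≤
      hP.lipConst * 2 ^ q * (η - η') * (A₀ * (M + R ^ (-β))) := by
    have hi := integrable_slide_mul hP hs η hf hf1
    have hi' := integrable_slide_mul hP hs η' hf hf1
    have hj := integrable_slide_mul hP hs η hstepm hstep1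
    have hj' := integrable_slide_mul hP hs η' hstepm hstep1
    have e : (slideIntegral P f η - slideIntegral P f η') - (U₀ η - U₀ η') =
        ∫ p : Space n × ℝ, (P (joinLast p.1 (p.2 - η)) - P (joinLast p.1 (p.2 - η'))) *
          (f p - step 0 p.2) := by
      simp only [hU₀, slideIntegral]
      have e₃ := integral_sub (hi.sub hi') (hj.sub hj')
      simp only [Pi.sub_apply] at e₃
      rw [← integral_sub hi hi', ← integral_sub hj hj', ← e₃]
      congr 1
      ext p
      ring
    rw [e]
    refine (abs_integral_le_integral_abs).trans ?_
    -- Increments of P decay one power faster than P. This extra power absorbs the growth |w|^(1+β)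
    -- of the band even when β ≥ 2s, where P itself would not.
    have hb : ∀ p : Space n × ℝ, |(P (joinLast p.1 (p.2 - η)) - P (joinLast p.1 (p.2 - η'))) *
        (f p - step 0 p.2)| ≤ hP.lipConst * 2 ^ q * (η - η') *
          ((1 + ‖joinLast p.1 p.2‖) ^ (-q) * |f p - step 0 p.2|) := by
      rintro ⟨w, h⟩
      rw [abs_mul]
      have hsub : ∀ a b : ℝ, ‖joinLast w a - joinLast w b‖ = |a - b| := fun a b => by
        rw [← joinLast_sub, sub_self, norm_joinLast_zero_left]
      have := hP.abs_sub_le_of_closedBall hs (z := joinLast w h) (x := joinLast w (h - η))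
        (x' := joinLast w (h - η')) (by rw [hsub]; simpa using hη) (by rw [hsub]; simpa using hη')
      rw [hsub, show h - η - (h - η') = -(η - η') by ring, abs_neg, abs_of_nonneg hle0] at this
      calc _ ≤ hP.lipConst * 2 ^ q * (1 + ‖joinLast w h‖) ^ (-q) * (η - η') *
            |f (w, h) - step 0 h| := by gcongr
        _ = _ := by ring
    refine (integral_mono_of_nonneg (Eventually.of_forall fun p => abs_nonneg _)
      (hJ.const_mul _) (Eventually.of_forall hb)).trans ?_
    rw [integral_const_mul]
    gcongr
  have hK : 0 ≤ hP.lipConst * 2 ^ q * A₀ := by positivity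
  have hMR : 0 ≤ M + R ^ (-β) := by positivity
  have hle1 : hP.lipConst * 2 ^ q * (η - η') * (A₀ * (M + R ^ (-β))) +
      2 * ((η - η') * (max |η| |η'| * A₁)) ≤
      (hP.lipConst * 2 ^ q * A₀ + 2 * A₁) * (M + R ^ (-β) + max |η| |η'|) * (η - η') := by
    nlinarith [mul_nonneg (mul_nonneg hK hmax) hle0, mul_nonneg (mul_nonneg hA₁0 hMR) hle0]
  rw [abs_le] at hdiff hφ
  constructor
  · rw [abs_le]
    constructor <;> linarith [hdiff.1, hdiff.2, hφ.1, hφ.2]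
  · have : 0 ≤ 2 * A₁ * (M + R ^ (-β)) * (η - η') := by positivity
    nlinarith [hdiff.1, hdiff.2]

end

/-! ### Decay of the slice and tails of the profile -/

noncomputable section

variable {n : ℕ} {s : ℝ} {P : Space (n + 1) → ℝ} {c C : ℝ}

lemma integrableOn_ball_of_continuous {d : ℕ} {g : Space d → ℝ} (hg : Continuous g) (R : ℝ) :
    IntegrableOn g (ball 0 R) :=
  (hg.continuousOn.integrableOn_compact (isCompact_closedBall 0 R)).mono_set ball_subset_closedBall

namespace IsAdmissibleProfile

lemma continuous_slice (hP : IsAdmissibleProfile s P c C) (h : ℝ) :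
    Continuous fun w : Space n => P (joinLast w h) :=
  hP.continuous.comp (continuous_joinLast.comp (by fun_prop : Continuous fun w : Space n => (w, h)))

lemma slice_zero_eq (hP : IsAdmissibleProfile s P c C) (w : Space n) :
    P (joinLast w 0) = P (joinLast 0 ‖w‖) :=
  hP.radial _ _ (by rw [norm_joinLast_zero, norm_joinLast_zero_left, abs_norm])

/-- This exponent separates the regimes: at infinity the second moment of the slice converges for s
> 1/2 and grows at most logarithmically for s = 1/2. -/
lemma norm_sq_mul_slice_le (hP : IsAdmissibleProfile s P c C) {w : Space n} (hw : w ≠ 0) :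
    ‖w‖ ^ 2 * P (joinLast w 0) ≤ C * ‖w‖ ^ ((1 - 2 * s) - n) := by
  have hw0 : 0 < ‖w‖ := norm_pos_iff.mpr hw
  have hne : joinLast w 0 ≠ 0 := by rw [← norm_pos_iff, norm_joinLast_zero]; exact hw0
  have h1 := hP.le_rpow hne
  rw [norm_joinLast_zero] at h1
  calc _ ≤ ‖w‖ ^ 2 * (C * ‖w‖ ^ (-((n + 1 : ℝ) + 2 * s))) := by gcongr
    _ = C * (‖w‖ ^ (2 : ℝ) * ‖w‖ ^ (-((n + 1 : ℝ) + 2 * s))) := by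
      rw [Real.rpow_two]; ring
    _ = _ := by rw [← Real.rpow_add hw0]; congr 2; ring

lemma integral_compl_ball_le (hP : IsAdmissibleProfile s P c C) (hs : 0 < s) {R : ℝ}
    (hR : 0 < R) : ∫ x in (ball (0 : Space (n + 1)) R)ᶜ, P x ≤
      C * (sphereArea (n + 1) * (R ^ (-(2 * s)) / (2 * s))) := by
  rw [← setIntegral_compl_ball_norm_rpow (by omega : 1 ≤ n + 1) (by positivity : 0 < 2 * s) hR,
    ← integral_const_mul]
  refine setIntegral_mono_on (hP.integrable hs).integrableOn
    ((integrableOn_compl_ball_norm_rpow (by omega) (by positivity) hR).const_mul C)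
    measurableSet_ball.compl fun x hx => ?_
  have hx0 : x ≠ 0 := by rintro rfl; simp at hx; linarith
  refine (hP.le_rpow hx0).trans (le_of_eq ?_)
  congr 2
  push_cast
  ring

/-! ### Second moments of the slice -/

lemma integrable_second_moment (hP : IsAdmissibleProfile s P c C) (hn : 1 ≤ n) (hs : 1 / 2 < s) :
    Integrable fun w : Space n => ‖w‖ ^ 2 * P (joinLast w 0) := by
  have hcont : Continuous fun w : Space n => ‖w‖ ^ 2 * P (joinLast w 0) :=
    (continuous_norm.pow 2).mul (hP.continuous_slice 0)
  rw [← integrableOn_univ, ← union_compl_self (ball (0 : Space n) 1)]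
  refine (integrableOn_ball_of_continuous hcont 1).union ?_
  have := (integrableOn_compl_ball_norm_rpow hn (by linarith : 0 < 2 * s - 1) one_pos).const_mul C
  refine Integrable.mono' this hcont.aestronglyMeasurable ?_
  refine (ae_restrict_mem measurableSet_ball.compl).mono fun w hw => ?_
  have hw0 : w ≠ 0 := by rintro rfl; simp at hw
  rw [Real.norm_of_nonneg (mul_nonneg (by positivity) (hP.pos _).le)]
  refine (hP.norm_sq_mul_slice_le hw0).trans (le_of_eq ?_)
  congr 2
  ring

lemma abs_second_moment_sub_le (hP : IsAdmissibleProfile s P c C) (hn : 1 ≤ n) (hs : 1 / 2 < s)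
    {R : ℝ} (hR : 0 < R) :
    |(∫ w : Space n, ‖w‖ ^ 2 * P (joinLast w 0)) -
      ∫ w in ball (0 : Space n) R, ‖w‖ ^ 2 * P (joinLast w 0)| ≤
      C * (sphereArea n * (R ^ (-(2 * s - 1)) / (2 * s - 1))) := by
  have hI := hP.integrable_second_moment hn hs
  rw [← integral_add_compl measurableSet_ball hI, add_sub_cancel_left, abs_of_nonneg
    (integral_nonneg fun w => mul_nonneg (by positivity) (hP.pos _).le),
    ← setIntegral_compl_ball_norm_rpow hn (by linarith : 0 < 2 * s - 1) hR, ← integral_const_mul]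
  refine setIntegral_mono_on hI.integrableOn
    ((integrableOn_compl_ball_norm_rpow hn (by linarith) hR).const_mul C)
    measurableSet_ball.compl fun w hw => ?_
  have hw0 : w ≠ 0 := by rintro rfl; simp at hw; linarith
  refine (hP.norm_sq_mul_slice_le hw0).trans (le_of_eq ?_)
  congr 2
  ring

/-- Used twice in the critical case: for radii in a fixed ratio the difference stays bounded, and
from radius 1 to 1/ρ it gives growth O(|log ρ|). -/
lemma second_moment_log (hP : IsAdmissibleProfile (1 / 2) P c C) (hn : 1 ≤ n)
    {R₁ R₂ : ℝ} (h₁ : 0 < R₁) (h₂ : R₁ ≤ R₂) :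
    |(∫ w in ball (0 : Space n) R₂, ‖w‖ ^ 2 * P (joinLast w 0)) -
      ∫ w in ball (0 : Space n) R₁, ‖w‖ ^ 2 * P (joinLast w 0)| ≤
      C * (sphereArea n * Real.log (R₂ / R₁)) := by
  have hcont : Continuous fun w : Space n => ‖w‖ ^ 2 * P (joinLast w 0) :=
    (continuous_norm.pow 2).mul (hP.continuous_slice 0)
  have hu : ball (0 : Space n) R₂ = ball 0 R₁ ∪ {x : Space n | ‖x‖ ∈ Ico R₁ R₂} := by
    ext x
    simp only [mem_ball_zero_iff, mem_union, mem_ofPred_eq, mem_Ico]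
    constructor
    · intro h; rcases lt_or_ge ‖x‖ R₁ with h' | h'
      · exact Or.inl h'
      · exact Or.inr ⟨h', h⟩
    · rintro (h | h)
      · exact h.trans_le h₂
      · exact h.2
  have hm : MeasurableSet {x : Space n | ‖x‖ ∈ Ico R₁ R₂} := measurable_norm measurableSet_Ico
  have hdis : Disjoint (ball (0 : Space n) R₁) {x : Space n | ‖x‖ ∈ Ico R₁ R₂} := by
    rw [Set.disjoint_left]
    intro x hx hx'
    exact absurd hx'.1 (not_le.mpr (by simpa using hx))
  have hI : IntegrableOn (fun w : Space n => ‖w‖ ^ 2 * P (joinLast w 0))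
      {x : Space n | ‖x‖ ∈ Ico R₁ R₂} :=
    (integrableOn_ball_of_continuous hcont R₂).mono_set (hu ▸ subset_union_right)
  rw [hu, setIntegral_union hdis hm (integrableOn_ball_of_continuous hcont R₁) hI,
    add_sub_cancel_left, abs_of_nonneg
    (integral_nonneg fun w => mul_nonneg (by positivity) (hP.pos _).le),
    ← setIntegral_annulus_norm_rpow hn h₁ h₂, ← integral_const_mul]
  refine setIntegral_mono_on hI ((integrableOn_annulus_norm_rpow hn h₁).const_mul C)
    hm fun w hw => ?_
  have hw0 : w ≠ 0 := by rintro rfl; simp at hw; linarith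
  refine (hP.norm_sq_mul_slice_le hw0).trans (le_of_eq ?_)
  congr 2
  ring

lemma second_moment_pos (hP : IsAdmissibleProfile s P c C) (hn : 1 ≤ n) {R : ℝ} (hR : 0 < R) :
    0 < ∫ w in ball (0 : Space n) R, ‖w‖ ^ 2 * P (joinLast w 0) := by
  have := nontrivial_space hn
  have hcont : Continuous fun w : Space n => ‖w‖ ^ 2 * P (joinLast w 0) :=
    (continuous_norm.pow 2).mul (hP.continuous_slice 0)
  rw [setIntegral_pos_iff_support_of_nonneg_ae
    (Eventually.of_forall fun w => mul_nonneg (by positivity) (hP.pos _).le)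
    (integrableOn_ball_of_continuous hcont R)]
  have : Function.support (fun w : Space n => ‖w‖ ^ 2 * P (joinLast w 0)) = {0}ᶜ := by
    ext w; simp [(hP.pos _).ne']
  rw [this, inter_comm, ← sdiff_eq, measure_sdiff_null (measure_singleton _)]
  exact measure_ball_pos _ _ hR

end IsAdmissibleProfile

/-! ### The diffusion at the boundary point for a quadratic interface -/

lemma integral_vertical_step_at (hP : IsAdmissibleProfile s P c C) (hn : 1 ≤ n) (hs : 0 < s)
    (w : Space n) (a : ℝ) :
    ∫ h, P (joinLast w h) * step a h = 2 * ∫ h in (0 : ℝ)..a, P (joinLast w h) :=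
  integral_even_mul_step (hP.vertical_integrable hn hs w) (hP.vertical_even w) a

lemma abs_vertical_interval_sub_le (hP : IsAdmissibleProfile s P c C) (hs : 0 < s)
    (w : Space n) (a : ℝ) :
    |(∫ h in (0 : ℝ)..a, P (joinLast w h)) - a * P (joinLast w 0)| ≤
      hP.lipConst * (1 + ‖w‖) ^ (-((n + 1 : ℝ) + 2 * s + 1)) * a ^ 2 := by
  have hL := hP.lipConst_pos
  have hii : IntervalIntegrable (fun h => P (joinLast w h)) volume 0 a :=
    (hP.continuous_vertical w).intervalIntegrable _ _
  have h1 : (∫ h in (0 : ℝ)..a, P (joinLast w h)) - a * P (joinLast w 0) =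
      ∫ h in (0 : ℝ)..a, (P (joinLast w h) - P (joinLast w 0)) := by
    rw [intervalIntegral.integral_sub hii (by simp), intervalIntegral.integral_const, smul_eq_mul,
      sub_zero]
  rw [h1, ← Real.norm_eq_abs]
  have := intervalIntegral.norm_integral_le_of_norm_le_const (a := 0) (b := a)
    (f := fun h => P (joinLast w h) - P (joinLast w 0))
    (C := hP.lipConst * (1 + ‖w‖) ^ (-((n + 1 : ℝ) + 2 * s + 1)) * |a|) ?_
  · rwa [sub_zero, mul_assoc, ← sq, sq_abs] at this
  · intro h hh
    rw [Real.norm_eq_abs]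
    refine (hP.abs_vertical_sub_le hs w h 0).trans ?_
    refine mul_le_mul_of_nonneg_left ?_ (by positivity)
    have := abs_sub_left_of_mem_uIcc (uIoc_subset_uIcc hh)
    simpa using this

lemma norm_pow_mul_one_add_rpow_le {d : ℕ} (w : Space d) {k : ℕ} (hk : k ≠ 0) {q e : ℝ}
    (hq : 0 ≤ q) (he : e = k - q) :
    ‖w‖ ^ k * (1 + ‖w‖) ^ (-q) ≤ ‖w‖ ^ e := by
  rcases eq_or_ne w 0 with rfl | hw
  · rw [norm_zero, zero_pow hk, zero_mul]
    exact Real.rpow_nonneg le_rfl _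
  · have hw0 : 0 < ‖w‖ := norm_pos_iff.mpr hw
    calc _ ≤ ‖w‖ ^ k * ‖w‖ ^ (-q) := by
          refine mul_le_mul_of_nonneg_left ?_ (by positivity)
          exact Real.rpow_le_rpow_of_nonpos hw0 (by linarith) (by linarith)
      _ = _ := by rw [← Real.rpow_natCast, ← Real.rpow_add hw0, he, sub_eq_add_neg]

/-- The phase is replaced by one with the exact quadratic interface a(w) = ρB(w,w)/2. Vertical
integration gives 2 ∫_0^{a(w)} P(w, h) dh ≈ 2a(w)P(w, 0), and radial symmetry leaves the trace of B.
The Lipschitz error of order a² and the cubic band are both dominated by ρ²|w|^(2−2s−n), integrable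
at 0 since s < 1, with integral of order ρ^(2s) over the ball of radius r/ρ. The tail of P beyond
that radius has the same order. -/
theorem exists_slideIntegral_zero_quadratic (hP : IsAdmissibleProfile s P c C) (hn : 1 ≤ n)
    (hs : 0 < s) (hs1 : s < 1) {r M : ℝ} (hr : 0 < r) (hM : 0 ≤ M) :
    ∃ A > 0, ∀ (ρ : ℝ) (f : Space n × ℝ → ℝ) (B : Space n →L[ℝ] Space n →L[ℝ] ℝ), 0 < ρ →
      Measurable f → (∀ p, |f p| ≤ 1) → ‖B‖ ≤ M →
      BandPhase f (r / ρ) (fun w => ρ * (B w w / 2)) (fun w => M * ρ ^ 2 * ‖w‖ ^ 3) →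
      |slideIntegral P f 0 -
        ρ * ((∑ i, B (EuclideanSpace.single i 1) (EuclideanSpace.single i 1)) / n *
          ∫ w in ball (0 : Space n) (r / ρ), ‖w‖ ^ 2 * P (joinLast w 0))| ≤ A * ρ ^ (2 * s) := by
  have hC := hP.C_pos
  have hL := hP.lipConst_pos
  have hn0 : (0 : ℝ) ≤ n := n.cast_nonneg
  set p₀ : ℝ := (n + 1 : ℝ) + 2 * s with hp₀
  have hp₀0 : 0 ≤ p₀ := by positivity
  have hκ := sphereArea_nonneg n
  have hκ' := sphereArea_nonneg (n + 1)
  set A₁ := sphereArea n * (r ^ (2 - 2 * s) / (2 - 2 * s)) with hA₁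
  have hs2 : 0 < 2 - 2 * s := by linarith
  have hA₁0 : 0 ≤ A₁ := by positivity
  set A₂ := C * (sphereArea (n + 1) * (r ^ (-(2 * s)) / (2 * s))) with hA₂
  have hA₂0 : 0 ≤ A₂ := by positivity
  refine ⟨hP.lipConst * M ^ 2 * A₁ + 4 * (C * 2 ^ p₀) * M * A₁ + 2 * A₂ + 1, by positivity,
    fun ρ f B hρ hf hf1 hB hband => ?_⟩
  set R := r / ρ with hR
  have hR0 : 0 < R := by positivity
  have hcubic : ∫ w in ball (0 : Space n) R, ‖w‖ ^ (2 - 2 * s - n) =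
      A₁ * ρ ^ (2 * s) * (ρ ^ 2)⁻¹ := by
    rw [setIntegral_ball_norm_rpow hn hs2 hR0.le, hR, Real.div_rpow hr.le hρ.le, hA₁,
      show (2 - 2 * s : ℝ) = 2 - (2 * s) by ring, Real.rpow_sub hρ, Real.rpow_two]
    field_simp
  have hcubicI := integrableOn_ball_norm_rpow hn (R := R) hs2
  have hBw : ∀ w, |B w w| ≤ M * ‖w‖ ^ 2 := fun w => by
    have := B.le_opNorm₂ w w
    rw [Real.norm_eq_abs] at this
    calc _ ≤ ‖B‖ * ‖w‖ * ‖w‖ := this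
      _ ≤ M * ‖w‖ * ‖w‖ := by gcongr
      _ = _ := by ring
  have hBc : Continuous fun w : Space n => B w w := by fun_prop
  -- the comparison phase
  set a : Space n → ℝ := (ball 0 R).indicator fun w => ρ * (B w w / 2) with ha
  have ham : Measurable a := Measurable.indicator (by fun_prop) measurableSet_ball
  set f₀ : Space n × ℝ → ℝ := fun p => step (a p.1) p.2 with hf₀
  have hf₀m : Measurable f₀ := measurable_step (ham.comp measurable_fst) measurable_snd
  have hPI : Integrable fun p : Space n × ℝ => P (joinLast p.1 p.2) :=
    integrable_joinLast_iff.mpr (hP.integrable hs)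
  have hi := integrable_slide_mul hP hs 0 hf hf1
  have hi₀ := integrable_slide_mul hP hs 0 hf₀m fun p => (abs_step _ _).le
  simp only [sub_zero] at hi hi₀
  -- its diffusion
  have hmain : |(∫ p : Space n × ℝ, P (joinLast p.1 p.2) * f₀ p) -
      ρ * ((∑ i, B (EuclideanSpace.single i 1) (EuclideanSpace.single i 1)) / n *
        ∫ w in ball (0 : Space n) R, ‖w‖ ^ 2 * P (joinLast w 0))| ≤
      hP.lipConst * M ^ 2 * A₁ * ρ ^ (2 * s) := by
    have hII := hi₀.integral_prod_left
    simp only [hf₀, integral_vertical_step_at hP hn hs] at hII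
    have e1 : ∫ p : Space n × ℝ, P (joinLast p.1 p.2) * f₀ p =
        ∫ w, 2 * ∫ h in (0 : ℝ)..a w, P (joinLast w h) := by
      rw [Measure.volume_eq_prod, integral_prod _ hi₀]
      simp only [hf₀, integral_vertical_step_at hP hn hs]
    -- Cutting off the radial weight makes its second moment finite for every s, so that
    -- `integral_bilin_mul_radial` applies.
    set g : ℝ → ℝ := (Iio R).indicator fun r => P (joinLast 0 r) with hg
    have hgm : Measurable g :=
      (hP.continuous_vertical 0).measurable.indicator measurableSet_Iio
    have hgw : ∀ F : Space n → ℝ, (fun w => F w * g ‖w‖) =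
        (ball 0 R).indicator fun w => F w * P (joinLast w 0) := by
      intro F
      ext w
      by_cases h : ‖w‖ < R
      · simp [hg, indicator, h, hP.slice_zero_eq]
      · simp [hg, indicator, h]
    have hgi : Integrable fun w : Space n => ‖w‖ ^ 2 * g ‖w‖ := by
      rw [hgw fun w => ‖w‖ ^ 2, integrable_indicator_iff measurableSet_ball]
      exact integrableOn_ball_of_continuous ((continuous_norm.pow 2).mul (hP.continuous_slice 0)) R
    have hbil := integral_bilin_mul_radial hn B hgm hgi
    rw [hgw fun w => ‖w‖ ^ 2, hgw fun w => B w w, integral_indicator measurableSet_ball,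
      integral_indicator measurableSet_ball] at hbil
    have hI2 : Integrable fun w => 2 * (a w * P (joinLast w 0)) := by
      have : (fun w => 2 * (a w * P (joinLast w 0))) = (ball 0 R).indicator fun w =>
          ρ * (B w w * P (joinLast w 0)) := by
        ext w
        by_cases h : w ∈ ball (0 : Space n) R
        · simp only [ha, indicator_of_mem h]; ring
        · simp only [ha, indicator_of_notMem h]; ring
      rw [this, integrable_indicator_iff measurableSet_ball]
      exact integrableOn_ball_of_continuous (continuous_const.mul (hBc.mul (hP.continuous_slice 0)))
        R
    have e2 : ρ * ((∑ i, B (EuclideanSpace.single i 1) (EuclideanSpace.single i 1)) / n *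
        ∫ w in ball (0 : Space n) R, ‖w‖ ^ 2 * P (joinLast w 0)) =
        ∫ w, 2 * (a w * P (joinLast w 0)) := by
      rw [← hbil, ← integral_const_mul, ← integral_indicator measurableSet_ball]
      congr 1
      ext w
      by_cases h : w ∈ ball (0 : Space n) R
      · simp only [ha, indicator_of_mem h]; ring
      · simp only [ha, indicator_of_notMem h]; ring
    rw [e1, e2, ← integral_sub hII hI2]
    refine abs_integral_le_integral_abs.trans ?_
    have hdom : Integrable ((ball (0 : Space n) R).indicator fun w =>
        hP.lipConst * M ^ 2 * ρ ^ 2 * ‖w‖ ^ (2 - 2 * s - n)) := by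
      rw [integrable_indicator_iff measurableSet_ball]
      exact hcubicI.const_mul _
    refine (integral_mono (hII.sub hI2).abs hdom fun w => ?_).trans (le_of_eq ?_)
    · have h1 := abs_vertical_interval_sub_le hP hs w (a w)
      simp only [Pi.sub_apply]
      rw [← mul_sub, abs_mul, abs_two]
      by_cases h : w ∈ ball (0 : Space n) R
      · rw [indicator_of_mem h]
        have haw : a w = ρ * (B w w / 2) := by simp only [ha, indicator_of_mem h]
        have ha2 : a w ^ 2 ≤ (ρ ^ 2 * M ^ 2 / 4) * ‖w‖ ^ 4 := by
          rw [haw]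
          have : (B w w) ^ 2 ≤ (M * ‖w‖ ^ 2) ^ 2 := by
            rw [← sq_abs]; exact pow_le_pow_left₀ (abs_nonneg _) (hBw w) 2
          nlinarith [mul_le_mul_of_nonneg_left this (sq_nonneg ρ)]
        have h2 := norm_pow_mul_one_add_rpow_le w (k := 4) (by norm_num) (q := p₀ + 1)
          (e := 2 - 2 * s - n) (by positivity) (by push_cast; rw [hp₀]; ring)
        calc _ ≤ 2 * (hP.lipConst * (1 + ‖w‖) ^ (-(p₀ + 1)) * ((ρ ^ 2 * M ^ 2 / 4) * ‖w‖ ^ 4)) := by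
              refine mul_le_mul_of_nonneg_left (h1.trans ?_) (by norm_num)
              gcongr
          _ = hP.lipConst * M ^ 2 * ρ ^ 2 / 2 * (‖w‖ ^ 4 * (1 + ‖w‖) ^ (-(p₀ + 1))) := by ring
          _ ≤ hP.lipConst * M ^ 2 * ρ ^ 2 / 2 * ‖w‖ ^ (2 - 2 * s - n) := by gcongr
          _ ≤ _ := by
            refine mul_le_mul_of_nonneg_right ?_ (by positivity)
            exact half_le_self (by positivity)
      · have haw : a w = 0 := by simp only [ha, indicator_of_notMem h]
        rw [indicator_of_notMem h, haw]
        simp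
    · rw [integral_indicator measurableSet_ball, integral_const_mul, hcubic]
      field_simp
  -- the error caused by the phase
  have herr : |(∫ p : Space n × ℝ, P (joinLast p.1 p.2) * f p) -
      ∫ p : Space n × ℝ, P (joinLast p.1 p.2) * f₀ p| ≤
      (4 * (C * 2 ^ p₀) * M * A₁ + 2 * A₂) * ρ ^ (2 * s) := by
    rw [← integral_sub hi hi₀]
    refine abs_integral_le_integral_abs.trans ?_
    set F : Space n → ℝ := (ball 0 R).indicator fun w => 2 * (C * 2 ^ p₀ * (1 + ‖w‖) ^ (-p₀))
      with hF
    have hcont : Continuous fun w : Space n => (1 + ‖w‖) ^ (-p₀) :=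
      (by fun_prop : Continuous fun w : Space n => 1 + ‖w‖).rpow_const
        fun w => Or.inl (by positivity)
    have hFm : Measurable F :=
      (by fun_prop : Measurable fun w : Space n =>
        2 * (C * 2 ^ p₀ * (1 + ‖w‖) ^ (-p₀))).indicator measurableSet_ball
    have hF0 : ∀ w, 0 ≤ F w := fun w => indicator_nonneg (fun w _ => by positivity) w
    have hFb : ∀ w, F w * (M * ρ ^ 2 * ‖w‖ ^ 3) ≤ (ball (0 : Space n) R).indicator (fun w =>
        2 * (C * 2 ^ p₀) * M * ρ ^ 2 * ‖w‖ ^ (2 - 2 * s - n)) w := by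
      intro w
      by_cases h : w ∈ ball (0 : Space n) R
      · simp only [hF, indicator_of_mem h]
        have h2 := norm_pow_mul_one_add_rpow_le w (k := 3) (by norm_num) (q := p₀)
          (e := 2 - 2 * s - n) (by positivity) (by push_cast; rw [hp₀]; ring)
        calc _ = 2 * (C * 2 ^ p₀) * M * ρ ^ 2 * (‖w‖ ^ 3 * (1 + ‖w‖) ^ (-p₀)) := by ring
          _ ≤ _ := by gcongr
      · simp only [hF, indicator_of_notMem h]; simp
    have hdom : Integrable ((ball (0 : Space n) R).indicator fun w =>
        2 * (C * 2 ^ p₀) * M * ρ ^ 2 * ‖w‖ ^ (2 - 2 * s - n)) := by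
      rw [integrable_indicator_iff measurableSet_ball]
      exact hcubicI.const_mul _
    have hbm : Measurable fun w : Space n => M * ρ ^ 2 * ‖w‖ ^ 3 := by fun_prop
    have hFbI : Integrable fun w => F w * (M * ρ ^ 2 * ‖w‖ ^ 3) := by
      refine hdom.mono' (hFm.mul hbm).aestronglyMeasurable (Eventually.of_forall fun w => ?_)
      rw [Real.norm_of_nonneg (mul_nonneg (hF0 w) (by positivity))]
      exact hFb w
    obtain ⟨hb1, hb2⟩ := integrable_band (μ := (volume : Measure (Space n))) (a := a)
      hFm.aestronglyMeasurable ham hbm (fun w => by positivity) hFbI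
    rw [← Measure.volume_eq_prod] at hb1 hb2
    have htI : Integrable fun p : Space n × ℝ =>
        2 * ((ball (0 : Space (n + 1)) R)ᶜ.indicator P) (joinLast p.1 p.2) :=
      (integrable_joinLast_iff.mpr
        ((hP.integrable hs).indicator measurableSet_ball.compl)).const_mul 2
    have htail : ∫ p : Space n × ℝ, 2 * ((ball (0 : Space (n + 1)) R)ᶜ.indicator P)
        (joinLast p.1 p.2) ≤ 2 * (A₂ * ρ ^ (2 * s)) := by
      rw [integral_const_mul, ← integral_joinLast, integral_indicator measurableSet_ball.compl]
      refine mul_le_mul_of_nonneg_left ((hP.integral_compl_ball_le hs hR0).trans (le_of_eq ?_))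
        (by norm_num)
      rw [hR, Real.div_rpow hr.le hρ.le, hA₂, Real.rpow_neg hρ.le]
      field_simp
    have hbandle : ∫ p : Space n × ℝ, {p : Space n × ℝ | |p.2 - a p.1| ≤
        M * ρ ^ 2 * ‖p.1‖ ^ 3}.indicator (fun p => F p.1) p ≤
        4 * (C * 2 ^ p₀) * M * A₁ * ρ ^ (2 * s) := by
      refine hb2.le.trans ?_
      refine (mul_le_mul_of_nonneg_left (integral_mono hFbI hdom hFb) (by norm_num)).trans
        (le_of_eq ?_)
      rw [integral_indicator measurableSet_ball, integral_const_mul, hcubic]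
      field_simp
      ring
    have hpt : ∀ p : Space n × ℝ, |P (joinLast p.1 p.2) * f p - P (joinLast p.1 p.2) * f₀ p| ≤
        {p : Space n × ℝ | |p.2 - a p.1| ≤ M * ρ ^ 2 * ‖p.1‖ ^ 3}.indicator (fun p => F p.1) p +
          2 * ((ball (0 : Space (n + 1)) R)ᶜ.indicator P) (joinLast p.1 p.2) := by
      rintro ⟨w, h⟩
      have hind : 0 ≤ {p : Space n × ℝ | |p.2 - a p.1| ≤ M * ρ ^ 2 * ‖p.1‖ ^ 3}.indicator
          (fun p => F p.1) (w, h) := indicator_nonneg (fun p _ => hF0 _) _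
      have hsec : 0 ≤ 2 * ((ball (0 : Space (n + 1)) R)ᶜ.indicator P) (joinLast w h) :=
        mul_nonneg (by norm_num) (indicator_nonneg (fun x _ => (hP.pos x).le) _)
      have h2 : |f (w, h) - f₀ (w, h)| ≤ 2 :=
        (abs_sub _ _).trans (by linarith [hf1 (w, h), abs_step (a w) h])
      rw [← mul_sub, abs_mul, abs_of_pos (hP.pos _)]
      have hP0 := (hP.pos (joinLast w h)).le
      have h3 : P (joinLast w h) * |f (w, h) - f₀ (w, h)| ≤ P (joinLast w h) * 2 := by gcongr
      dsimp only at h3 ⊢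
      by_cases hc : ‖w‖ < R ∧ |h| < R
      · have hwm : w ∈ ball (0 : Space n) R := by simpa using hc.1
        have haw : a w = ρ * (B w w / 2) := by simp only [ha, indicator_of_mem hwm]
        by_cases hb : M * ρ ^ 2 * ‖w‖ ^ 3 < |h - a w|
        · have := hband w h hc.1 hc.2 (by rwa [haw] at hb)
          simp only [this, hf₀, haw, sub_self, abs_zero, mul_zero]
          exact add_nonneg hind hsec
        · have hmem : (w, h) ∈ {p : Space n × ℝ | |p.2 - a p.1| ≤ M * ρ ^ 2 * ‖p.1‖ ^ 3} :=
            not_lt.mp hb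
          rw [indicator_of_mem hmem]
          have h4 : P (joinLast w h) ≤ C * 2 ^ p₀ * (1 + ‖w‖) ^ (-p₀) := by
            refine (hP.le_one_add hs _).trans ?_
            refine mul_le_mul_of_nonneg_left ?_ (by positivity)
            exact Real.rpow_le_rpow_of_nonpos (by positivity)
              (by gcongr; exact norm_le_norm_joinLast w h) (by linarith)
          have : F w = 2 * (C * 2 ^ p₀ * (1 + ‖w‖) ^ (-p₀)) := by
            simp only [hF, indicator_of_mem hwm]
          dsimp only
          linarith
      · have hmem : joinLast w h ∈ (ball (0 : Space (n + 1)) R)ᶜ := by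
          simp only [mem_compl_iff, mem_ball_zero_iff]
          intro hcon
          exact hc ⟨(norm_le_norm_joinLast w h).trans_lt hcon,
            (abs_le_norm_joinLast w h).trans_lt hcon⟩
        rw [indicator_of_mem hmem]
        linarith
    refine (integral_mono (hi.sub hi₀).abs (hb1.add htI) hpt).trans ?_
    refine (integral_add hb1 htI).le.trans ?_
    linarith
  have hfin := (abs_sub_le _ _ _).trans (add_le_add herr hmain)
  have e : slideIntegral P f 0 = ∫ p : Space n × ℝ, P (joinLast p.1 p.2) * f p := by
    simp [slideIntegral]
  rw [e]
  refine hfin.trans ?_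
  have : 0 < ρ ^ (2 * s) := by positivity
  nlinarith

end

noncomputable section

variable {n : ℕ} {s : ℝ} {P : Space (n + 1) → ℝ} {c C : ℝ}

/-! ### The fractional mean curvature as an absolutely convergent integral -/

lemma ae_snd_ne_zero : ∀ᵐ p : Space n × ℝ, p.2 ≠ 0 := by
  have h : ∀ᵐ x : ℝ, x ≠ 0 := by simp [ae_iff, measure_singleton]
  exact Measure.quasiMeasurePreserving_snd.ae h

lemma joinLast_neg (w : Space n) (h : ℝ) : joinLast (-w) (-h) = -joinLast w h := by
  have := smul_joinLast (-1) w h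
  simpa using this.symm

/-- Even kernels do not see the half-space. -/
lemma integral_even_mul_step_zero {g : Space (n + 1) → ℝ} (hg : ∀ x, g (-x) = g x) :
    ∫ p : Space n × ℝ, g (joinLast p.1 p.2) * step 0 p.2 = 0 := by
  have hmp : MeasurePreserving (((MeasurableEquiv.neg (Space n)).prodCongr (MeasurableEquiv.neg ℝ)))
      (volume : Measure (Space n × ℝ)) volume :=
    (Measure.measurePreserving_neg volume).prod (Measure.measurePreserving_neg volume)
  have h := hmp.integral_comp (MeasurableEquiv.measurableEmbedding _)
    (fun p : Space n × ℝ => g (joinLast p.1 p.2) * step 0 p.2)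
  have h' : ∫ p : Space n × ℝ, g (joinLast (-p.1) (-p.2)) * step 0 (-p.2) =
      ∫ p : Space n × ℝ, -(g (joinLast p.1 p.2) * step 0 p.2) := by
    -- `step 0` is odd only off h = 0, because `step 0 0 = -1`.
    refine integral_congr_ae (ae_snd_ne_zero.mono fun p hp => ?_)
    have hs : step 0 (-p.2) = -step 0 p.2 := by
      unfold step
      rcases lt_or_gt_of_ne hp with h | h
      · simp [h, not_lt.mpr h.le]
      · simp [h, not_lt.mpr h.le]
    simp only [joinLast_neg, hg, hs, mul_neg]
  have h'' := h'.symm.trans h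
  rw [integral_neg] at h''
  linarith

/-- The region where a phase with a flat interface at the origin may deviate from the
half-space. -/
def deviationSet (n : ℕ) (β r M : ℝ) : Set (Space n × ℝ) :=
  {p | (‖p.1‖ < r ∧ |p.2| ≤ M * ‖p.1‖ ^ (1 + β)) ∨ r ≤ ‖joinLast p.1 p.2‖}

lemma measurableSet_deviationSet (n : ℕ) {β r M : ℝ} :
    MeasurableSet (deviationSet n β r M) := by
  have h₁ : MeasurableSet {p : Space n × ℝ | ‖p.1‖ < r} :=
    measurableSet_lt (by fun_prop) measurable_const
  have h₂ : MeasurableSet {p : Space n × ℝ | |p.2| ≤ M * ‖p.1‖ ^ (1 + β)} :=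
    measurableSet_le (by fun_prop) (by fun_prop)
  exact (h₁.inter h₂).union (measurableSet_le measurable_const continuous_joinLast.norm.measurable)

lemma abs_sub_step_le {β r M : ℝ} {f : Space n × ℝ → ℝ} (hf1 : ∀ p, |f p| ≤ 1)
    (hband : BandPhase f r 0 fun w => M * ‖w‖ ^ (1 + β)) (p : Space n × ℝ) :
    |f p - step 0 p.2| ≤ (deviationSet n β r M).indicator (fun _ => 2) p := by
  obtain ⟨w, h⟩ := p
  by_cases hp : (w, h) ∈ deviationSet n β r M
  · rw [indicator_of_mem hp]
    exact (abs_sub _ _).trans (by linarith [hf1 (w, h), abs_step 0 h])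
  · rw [indicator_of_notMem hp]
    simp only [deviationSet, mem_ofPred_eq, not_or, not_and, not_le] at hp
    have hw : ‖w‖ < r := (norm_le_norm_joinLast w h).trans_lt hp.2
    have hh : |h| < r := (abs_le_norm_joinLast w h).trans_lt hp.2
    have := hband w h hw hh (by simpa using hp.1 hw)
    simp [this]

/-- In the band the weight integrates vertically to a multiple of |w|^(β−2s−n), which is integrable
at 0 exactly because β > 2s. Far away the kernel is integrable because s > 0. The resulting function
dominates the deviation of every phase with the given β, r and M. -/
lemma integrable_deviation_weight (hn : 1 ≤ n) (hs : 0 < s) {β r M : ℝ} (hβ : 2 * s < β)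
    (hr : 0 < r) (hM : 0 ≤ M) :
    Integrable fun p : Space n × ℝ => (deviationSet n β r M).indicator (fun _ => (2 : ℝ)) p *
      ‖joinLast p.1 p.2‖ ^ (-((n + 1 : ℝ) + 2 * s)) := by
  set p₀ : ℝ := (n + 1 : ℝ) + 2 * s with hp₀
  have hn0 : (0 : ℝ) ≤ n := n.cast_nonneg
  have hp0 : 0 < p₀ := by positivity
  set F : Space n → ℝ := (ball 0 r).indicator fun w => 2 * ‖w‖ ^ (-p₀) with hF
  have hFm : Measurable F :=
    (by fun_prop : Measurable fun w : Space n => 2 * ‖w‖ ^ (-p₀)).indicator measurableSet_ball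
  have hF0 : ∀ w, 0 ≤ F w := fun w => indicator_nonneg (fun w _ => by positivity) w
  have hbm : Measurable fun w : Space n => M * ‖w‖ ^ (1 + β) := by fun_prop
  have hFbI : Integrable fun w => F w * (M * ‖w‖ ^ (1 + β)) := by
    have hdom : Integrable ((ball (0 : Space n) r).indicator fun w =>
        2 * M * ‖w‖ ^ ((β - 2 * s) - n)) := by
      rw [integrable_indicator_iff measurableSet_ball]
      exact (integrableOn_ball_norm_rpow hn (by linarith)).const_mul _
    refine hdom.mono' (hFm.mul hbm).aestronglyMeasurable (Eventually.of_forall fun w => ?_)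
    rw [Real.norm_of_nonneg (mul_nonneg (hF0 w) (by positivity))]
    by_cases h : w ∈ ball (0 : Space n) r
    · simp only [hF, indicator_of_mem h]
      rcases eq_or_ne w 0 with rfl | hw
      · rw [norm_zero, Real.zero_rpow (by linarith : -p₀ ≠ 0), mul_zero, zero_mul]
        exact mul_nonneg (by positivity) (Real.rpow_nonneg le_rfl _)
      · have hw0 : 0 < ‖w‖ := norm_pos_iff.mpr hw
        refine le_of_eq ?_
        calc _ = 2 * M * (‖w‖ ^ (-p₀) * ‖w‖ ^ (1 + β)) := by ring
          _ = _ := by rw [← Real.rpow_add hw0]; congr 2; rw [hp₀]; ring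
    · simp only [hF, indicator_of_notMem h]; simp
  obtain ⟨hb1, -⟩ := integrable_band (μ := (volume : Measure (Space n))) (a := 0)
    hFm.aestronglyMeasurable measurable_const hbm (fun w => by positivity) hFbI
  have hT : Integrable fun p : Space n × ℝ => ((ball (0 : Space (n + 1)) r)ᶜ.indicator fun x =>
      2 * ‖x‖ ^ (-(2 * s) - ((n + 1 : ℕ) : ℝ))) (joinLast p.1 p.2) := by
    rw [integrable_joinLast_iff, integrable_indicator_iff measurableSet_ball.compl]
    exact (integrableOn_compl_ball_norm_rpow (by omega) (by positivity) hr).const_mul 2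
  have hjm : Measurable fun p : Space n × ℝ => ‖joinLast p.1 p.2‖ :=
    continuous_joinLast.norm.measurable
  refine (hb1.add hT).mono'
    ((measurable_const.indicator (measurableSet_deviationSet n)).mul
      (hjm.pow_const _)).aestronglyMeasurable (Eventually.of_forall ?_)
  rintro ⟨w, h⟩
  have h0 : 0 ≤ (deviationSet n β r M).indicator (fun _ => (2 : ℝ)) (w, h) :=
    indicator_nonneg (fun _ _ => by norm_num) _
  rw [Real.norm_of_nonneg (mul_nonneg h0 (by positivity)), Pi.add_apply]
  have hind : 0 ≤ {p : Space n × ℝ | |p.2 - (0 : Space n → ℝ) p.1| ≤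
      M * ‖p.1‖ ^ (1 + β)}.indicator (fun p => F p.1) (w, h) :=
    indicator_nonneg (fun p _ => hF0 _) _
  have hsec : 0 ≤ ((ball (0 : Space (n + 1)) r)ᶜ.indicator fun x =>
      2 * ‖x‖ ^ (-(2 * s) - ((n + 1 : ℕ) : ℝ))) (joinLast w h) :=
    indicator_nonneg (fun x _ => by positivity) _
  by_cases hp : (w, h) ∈ deviationSet n β r M
  · rw [indicator_of_mem hp]
    by_cases hfar : r ≤ ‖joinLast w h‖
    · have hmem : joinLast w h ∈ (ball (0 : Space (n + 1)) r)ᶜ := by simpa using hfar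
      rw [indicator_of_mem hmem (fun x => 2 * ‖x‖ ^ (-(2 * s) - ((n + 1 : ℕ) : ℝ)))]
      rw [show -(2 * s) - ((n + 1 : ℕ) : ℝ) = -p₀ by rw [hp₀]; push_cast; ring]
      linarith
    · obtain ⟨hw, hh⟩ := hp.resolve_right hfar
      have hwm : w ∈ ball (0 : Space n) r := by simpa using hw
      have hmem : (w, h) ∈ {p : Space n × ℝ | |p.2 - (0 : Space n → ℝ) p.1| ≤
          M * ‖p.1‖ ^ (1 + β)} := by simpa using hh
      rw [indicator_of_mem hmem]
      have hFw : F w = 2 * ‖w‖ ^ (-p₀) := by simp only [hF, indicator_of_mem hwm]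
      dsimp only
      rw [hFw]
      have : ‖joinLast w h‖ ^ (-p₀) ≤ ‖w‖ ^ (-p₀) := by
        -- With the convention `0 ^ (-p₀) = 0` the right side vanishes at w = 0; there the band
        -- forces h = 0, so the left side vanishes too.
        rcases eq_or_ne w 0 with rfl | hw0
        · have hh0 : h = 0 := by
            have : |h| ≤ 0 := by
              simpa [Real.zero_rpow (by linarith : 1 + β ≠ 0)] using hh
            exact abs_nonpos_iff.mp this
          rw [hh0, norm_joinLast_zero]
        · exact Real.rpow_le_rpow_of_nonpos (norm_pos_iff.mpr hw0) (norm_le_norm_joinLast w h)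
            (by linarith)
      linarith
  · rw [indicator_of_notMem hp, zero_mul]
    exact add_nonneg hind hsec

/-- The regularized fractional curvature integral of a phase with interface tangent to the
half-space. -/
def fracIntegral (s : ℝ) (f : Space n × ℝ → ℝ) : ℝ :=
  ∫ p : Space n × ℝ, (f p - step 0 p.2) * ‖joinLast p.1 p.2‖ ^ (-((n + 1 : ℝ) + 2 * s))

section

variable {β r M : ℝ}

lemma measurable_norm_joinLast_rpow (q : ℝ) :
    Measurable fun p : Space n × ℝ => ‖joinLast p.1 p.2‖ ^ q :=
  continuous_joinLast.norm.measurable.pow_const _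

lemma measurable_sub_step {f : Space n × ℝ → ℝ} (hf : Measurable f) :
    Measurable fun p => f p - step 0 p.2 :=
  hf.sub (measurable_step measurable_const measurable_snd)

lemma abs_frac_integrand_le {f : Space n × ℝ → ℝ} (hf1 : ∀ p, |f p| ≤ 1)
    (hband : BandPhase f r 0 fun w => M * ‖w‖ ^ (1 + β)) (p : Space n × ℝ) (q : ℝ) :
    |(f p - step 0 p.2) * ‖joinLast p.1 p.2‖ ^ q| ≤
      (deviationSet n β r M).indicator (fun _ => (2 : ℝ)) p * ‖joinLast p.1 p.2‖ ^ q := by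
  rw [abs_mul, abs_of_nonneg (by positivity : 0 ≤ ‖joinLast p.1 p.2‖ ^ q)]
  exact mul_le_mul_of_nonneg_right (abs_sub_step_le hf1 hband p) (by positivity)

lemma integrable_fracIntegral (hn : 1 ≤ n) (hs : 0 < s) (hβ : 2 * s < β) (hr : 0 < r) (hM : 0 ≤ M)
    {f : Space n × ℝ → ℝ} (hf : Measurable f) (hf1 : ∀ p, |f p| ≤ 1)
    (hband : BandPhase f r 0 fun w => M * ‖w‖ ^ (1 + β)) :
    Integrable fun p : Space n × ℝ =>
      (f p - step 0 p.2) * ‖joinLast p.1 p.2‖ ^ (-((n + 1 : ℝ) + 2 * s)) :=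
  (integrable_deviation_weight hn hs hβ hr hM).mono'
    ((measurable_sub_step hf).mul (measurable_norm_joinLast_rpow _)).aestronglyMeasurable
    (Eventually.of_forall fun p => abs_frac_integrand_le hf1 hband p _)

/-- The bound depends on the phase only through β, r and M; this makes H_s bounded on K. -/
theorem exists_abs_fracIntegral_le (hn : 1 ≤ n) (hs : 0 < s) (hβ : 2 * s < β) (hr : 0 < r)
    (hM : 0 ≤ M) : ∃ A, ∀ f : Space n × ℝ → ℝ, Measurable f → (∀ p, |f p| ≤ 1) →
      BandPhase f r 0 (fun w => M * ‖w‖ ^ (1 + β)) → |fracIntegral s f| ≤ A :=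
  ⟨_, fun _ _ hf1 hband => abs_integral_le_integral_abs.trans
    (integral_mono_of_nonneg (Eventually.of_forall fun _ => abs_nonneg _)
      (integrable_deviation_weight hn hs hβ hr hM)
      (Eventually.of_forall fun p => abs_frac_integrand_le hf1 hband p _))⟩

/-- Each truncated kernel is even and integrable, so the half-space can be subtracted at no cost
before letting ε → 0. The principal value becomes an absolutely convergent integral. -/
lemma tendsto_truncated_fracIntegral (hn : 1 ≤ n) (hs : 0 < s) (hβ : 2 * s < β) (hr : 0 < r)
    (hM : 0 ≤ M) {f : Space n × ℝ → ℝ} (hf : Measurable f) (hf1 : ∀ p, |f p| ≤ 1)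
    (hband : BandPhase f r 0 fun w => M * ‖w‖ ^ (1 + β)) :
    Tendsto (fun ε : ℝ => ∫ p : Space n × ℝ, ((ball (0 : Space (n + 1)) ε)ᶜ.indicator fun x =>
      ‖x‖ ^ (-((n + 1 : ℝ) + 2 * s))) (joinLast p.1 p.2) * f p) (𝓝[>] 0)
      (𝓝 (fracIntegral s f)) := by
  set p₀ : ℝ := (n + 1 : ℝ) + 2 * s with hp₀
  set k : ℝ → Space (n + 1) → ℝ := fun ε =>
    (ball (0 : Space (n + 1)) ε)ᶜ.indicator fun x => ‖x‖ ^ (-p₀) with hk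
  have hkm : ∀ ε, Measurable (k ε) := fun ε =>
    (by fun_prop : Measurable fun x : Space (n + 1) => ‖x‖ ^ (-p₀)).indicator
      measurableSet_ball.compl
  have hkj : ∀ ε, Measurable fun p : Space n × ℝ => k ε (joinLast p.1 p.2) := fun ε =>
    (hkm ε).comp continuous_joinLast.measurable
  have hkI : ∀ ε, 0 < ε → Integrable fun p : Space n × ℝ => k ε (joinLast p.1 p.2) := by
    intro ε hε
    rw [integrable_joinLast_iff, hk, integrable_indicator_iff measurableSet_ball.compl]
    refine (integrableOn_compl_ball_norm_rpow (d := n + 1) (by omega)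
      (by positivity : 0 < 2 * s) hε).congr (Eventually.of_forall fun x => ?_)
    simp only
    congr 1
    rw [hp₀]
    push_cast
    ring
  have heq : ∀ ε, 0 < ε → ∫ p : Space n × ℝ, k ε (joinLast p.1 p.2) * f p =
      ∫ p : Space n × ℝ, (f p - step 0 p.2) * k ε (joinLast p.1 p.2) := by
    intro ε hε
    have h0 : ∫ p : Space n × ℝ, k ε (joinLast p.1 p.2) * step 0 p.2 = 0 := by
      refine integral_even_mul_step_zero fun x => ?_
      simp only [hk, indicator, mem_compl_iff, mem_ball_zero_iff, norm_neg]
    have i1 : Integrable fun p : Space n × ℝ => k ε (joinLast p.1 p.2) * f p :=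
      (hkI ε hε).mul_bdd (c := 1) hf.aestronglyMeasurable
        (Eventually.of_forall fun p => by simpa using hf1 p)
    have i2 : Integrable fun p : Space n × ℝ => k ε (joinLast p.1 p.2) * step 0 p.2 :=
      (hkI ε hε).mul_bdd (c := 1)
        (measurable_step measurable_const measurable_snd).aestronglyMeasurable
        (Eventually.of_forall fun p => by simp [abs_step])
    have h1 := integral_sub i1 i2
    rw [h0, sub_zero] at h1
    rw [← h1]
    congr 1
    ext p
    ring
  refine Tendsto.congr' (f₁ := fun ε => ∫ p : Space n × ℝ,
    (f p - step 0 p.2) * k ε (joinLast p.1 p.2)) ?_ ?_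
  · filter_upwards [self_mem_nhdsWithin] with ε hε
    exact (heq ε hε).symm
  · refine tendsto_integral_filter_of_dominated_convergence
      (fun p : Space n × ℝ => (deviationSet n β r M).indicator (fun _ => (2 : ℝ)) p *
        ‖joinLast p.1 p.2‖ ^ (-p₀)) ?_ ?_ (integrable_deviation_weight hn hs hβ hr hM) ?_
    · exact Eventually.of_forall fun ε =>
        ((measurable_sub_step hf).mul (hkj ε)).aestronglyMeasurable
    · refine Eventually.of_forall fun ε => Eventually.of_forall fun p => ?_
      refine le_trans ?_ (abs_frac_integrand_le hf1 hband p _)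
      rw [Real.norm_eq_abs, abs_mul, abs_mul]
      refine mul_le_mul_of_nonneg_left ?_ (abs_nonneg _)
      simp only [hk, indicator]
      split_ifs
      · exact le_rfl
      · simp
    · filter_upwards [ae_snd_ne_zero] with p hp
      refine tendsto_const_nhds.congr' ?_
      have hpos : 0 < ‖joinLast p.1 p.2‖ := (abs_pos.mpr hp).trans_le (abs_le_norm_joinLast _ _)
      filter_upwards [Ioo_mem_nhdsGT hpos] with ε hε
      have : joinLast p.1 p.2 ∈ (ball (0 : Space (n + 1)) ε)ᶜ := by simpa using hε.2.le
      simp only [hk, indicator_of_mem this, hp₀]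

/-! ### The small-time limit of the diffusion -/

/-- All powers of σ cancel, so the rescaled kernels share one dominating function. -/
lemma kernel_pos_scale (hP : IsAdmissibleProfile s P c C) (hs : 0 < s) {σ : ℝ} (hσ : 0 < σ)
    {x : Space (n + 1)} (hx : x ≠ 0) :
    0 ≤ σ⁻¹ * kernel s P x σ ∧
      σ⁻¹ * kernel s P x σ ≤ C * ‖x‖ ^ (-((n + 1 : ℝ) + 2 * s)) := by
  unfold kernel
  have hP0 := (hP.pos (σ ^ (-(1 / (2 * s))) • x)).le
  refine ⟨by positivity, ?_⟩
  have hσ' : 0 < σ ^ (-(1 / (2 * s))) := by positivity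
  have h1 := hP.le_rpow (smul_ne_zero hσ'.ne' hx)
  rw [norm_smul, Real.norm_of_nonneg hσ'.le, Real.mul_rpow hσ'.le (norm_nonneg _),
    ← Real.rpow_mul hσ.le] at h1
  calc _ ≤ σ⁻¹ * (σ ^ (-((n + 1 : ℝ) / (2 * s))) *
        (C * (σ ^ (-(1 / (2 * s)) * -((n + 1 : ℝ) + 2 * s)) *
          ‖x‖ ^ (-((n + 1 : ℝ) + 2 * s))))) := by gcongr
    _ = (σ ^ (-1 : ℝ) * σ ^ (-((n + 1 : ℝ) / (2 * s))) *
        σ ^ (-(1 / (2 * s)) * -((n + 1 : ℝ) + 2 * s))) *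
          (C * ‖x‖ ^ (-((n + 1 : ℝ) + 2 * s))) := by rw [Real.rpow_neg_one]; ring
    _ = _ := by
      rw [← Real.rpow_add hσ, ← Real.rpow_add hσ]
      have : -1 + -((n + 1 : ℝ) / (2 * s)) + -(1 / (2 * s)) * -((n + 1 : ℝ) + 2 * s) = 0 := by
        field_simp; ring
      rw [this, Real.rpow_zero, one_mul]

lemma continuous_kernel (hP : IsAdmissibleProfile s P c C) (σ : ℝ) :
    Continuous fun x => kernel s P x σ := by
  unfold kernel
  exact continuous_const.mul (hP.continuous.comp (continuous_const_smul _))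

lemma integrable_kernel (hP : IsAdmissibleProfile s P c C) (hs : 0 < s) {σ : ℝ} (hσ : 0 < σ) :
    Integrable fun x => kernel s P x σ := by
  unfold kernel
  exact ((hP.integrable hs).comp_smul (Real.rpow_pos_of_pos hσ _).ne').const_mul _

lemma kernel_neg (hP : IsAdmissibleProfile s P c C) (σ : ℝ) (x : Space (n + 1)) :
    kernel s P (-x) σ = kernel s P x σ := by
  unfold kernel
  rw [hP.radial (σ ^ (-(1 / (2 * s))) • -x) (σ ^ (-(1 / (2 * s))) • x) (by simp)]

/-- Uniformity in f: dominated convergence is applied once, to |σ⁻¹K_σ − c|x|^(−N−2s)| times the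
common majorant of all the deviations, and not to each phase separately. -/
theorem diffusion_small_time (hP : IsAdmissibleProfile s P c C) (hn : 1 ≤ n) (hs : 0 < s)
    (hβ : 2 * s < β) (hr : 0 < r) (hM : 0 ≤ M) {ε : ℝ} (hε : 0 < ε) :
    ∀ᶠ σ in 𝓝[>] (0 : ℝ), ∀ f : Space n × ℝ → ℝ, Measurable f → (∀ p, |f p| ≤ 1) →
      BandPhase f r 0 (fun w => M * ‖w‖ ^ (1 + β)) →
      |σ⁻¹ * (∫ p : Space n × ℝ, kernel s P (joinLast p.1 p.2) σ * f p) -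
        c * fracIntegral s f| ≤ ε := by
  set p₀ : ℝ := (n + 1 : ℝ) + 2 * s with hp₀
  set d : Space n × ℝ → ℝ := (deviationSet n β r M).indicator fun _ => (2 : ℝ) with hd
  have hd0 : ∀ p, 0 ≤ d p := fun p => indicator_nonneg (fun _ _ => by norm_num) p
  have hdm : Measurable d := measurable_const.indicator (measurableSet_deviationSet n)
  have hW := integrable_deviation_weight hn hs hβ hr hM
  set g : ℝ → Space n × ℝ → ℝ := fun σ p =>
    |σ⁻¹ * kernel s P (joinLast p.1 p.2) σ - c * ‖joinLast p.1 p.2‖ ^ (-p₀)| * d p with hg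
  have hne : ∀ p : Space n × ℝ, p.2 ≠ 0 → joinLast p.1 p.2 ≠ 0 := fun p hp => by
    rw [← norm_pos_iff]
    exact (abs_pos.mpr hp).trans_le (abs_le_norm_joinLast _ _)
  have hKm : ∀ σ, Measurable fun p : Space n × ℝ => kernel s P (joinLast p.1 p.2) σ := fun σ =>
    ((continuous_kernel hP σ).comp continuous_joinLast).measurable
  have hgm : ∀ σ, AEStronglyMeasurable (g σ) volume := fun σ =>
    (((((hKm σ).const_mul _).sub ((measurable_norm_joinLast_rpow _).const_mul c)).norm).mul
      hdm).aestronglyMeasurable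
  have hc := hP.c_pos
  have hgb : ∀ σ, 0 < σ → ∀ᵐ p : Space n × ℝ, ‖g σ p‖ ≤
      (C + c) * (d p * ‖joinLast p.1 p.2‖ ^ (-p₀)) := by
    intro σ hσ
    filter_upwards [ae_snd_ne_zero] with p hp
    rw [Real.norm_of_nonneg (mul_nonneg (abs_nonneg _) (hd0 p))]
    obtain ⟨h1, h2⟩ := kernel_pos_scale hP hs hσ (hne p hp)
    have h3 : 0 ≤ c * ‖joinLast p.1 p.2‖ ^ (-p₀) := by positivity
    have : |σ⁻¹ * kernel s P (joinLast p.1 p.2) σ - c * ‖joinLast p.1 p.2‖ ^ (-p₀)| ≤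
        (C + c) * ‖joinLast p.1 p.2‖ ^ (-p₀) := by
      rw [abs_le]; constructor <;> nlinarith
    calc _ ≤ (C + c) * ‖joinLast p.1 p.2‖ ^ (-p₀) * d p :=
          mul_le_mul_of_nonneg_right this (hd0 p)
      _ = _ := by ring
  have hlim : Tendsto (fun σ => ∫ p, g σ p) (𝓝[>] 0) (𝓝 (∫ _ : Space n × ℝ, (0 : ℝ))) := by
    refine tendsto_integral_filter_of_dominated_convergence
      (fun p => (C + c) * (d p * ‖joinLast p.1 p.2‖ ^ (-p₀))) (Eventually.of_forall hgm) ?_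
      (hW.const_mul _) ?_
    · filter_upwards [self_mem_nhdsWithin] with σ hσ using hgb σ hσ
    · filter_upwards [ae_snd_ne_zero] with p hp
      have ht : Tendsto (fun σ => σ⁻¹ * kernel s P (joinLast p.1 p.2) σ) (𝓝[>] 0)
          (𝓝 (c / ‖joinLast p.1 p.2‖ ^ p₀)) := hP.small_time.tendsto_at (a := joinLast p.1 p.2) (hne p hp)
      have e : c * ‖joinLast p.1 p.2‖ ^ (-p₀) = c / ‖joinLast p.1 p.2‖ ^ p₀ := by
        rw [Real.rpow_neg (norm_nonneg _), div_eq_mul_inv]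
      have := ((ht.sub_const (c * ‖joinLast p.1 p.2‖ ^ (-p₀))).abs).mul_const (d p)
      rw [e] at this
      simpa [hg, e] using this
  rw [integral_zero] at hlim
  filter_upwards [hlim.eventually (ge_mem_nhds hε), self_mem_nhdsWithin] with σ hσε hσ
    f hf hf1 hband
  have hσ : 0 < σ := hσ
  have hKI : Integrable fun p : Space n × ℝ => kernel s P (joinLast p.1 p.2) σ :=
    integrable_joinLast_iff.mpr (integrable_kernel hP hs hσ)
  have i1 : Integrable fun p : Space n × ℝ => kernel s P (joinLast p.1 p.2) σ * f p :=
    hKI.mul_bdd (c := 1) hf.aestronglyMeasurable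
      (Eventually.of_forall fun p => by simpa using hf1 p)
  have i2 : Integrable fun p : Space n × ℝ => kernel s P (joinLast p.1 p.2) σ * step 0 p.2 :=
    hKI.mul_bdd (c := 1)
      (measurable_step measurable_const measurable_snd).aestronglyMeasurable
      (Eventually.of_forall fun p => by simp [abs_step])
  have i3 := integrable_fracIntegral hn hs hβ hr hM hf hf1 hband
  have h0 := integral_even_mul_step_zero (g := fun x => kernel s P x σ) (kernel_neg hP σ)
  have e : σ⁻¹ * (∫ p : Space n × ℝ, kernel s P (joinLast p.1 p.2) σ * f p) -
      c * fracIntegral s f = ∫ p : Space n × ℝ, (σ⁻¹ * kernel s P (joinLast p.1 p.2) σ -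
        c * ‖joinLast p.1 p.2‖ ^ (-p₀)) * (f p - step 0 p.2) := by
    have h1 := integral_sub i1 i2
    rw [h0, sub_zero] at h1
    have i4 := (i1.sub i2).const_mul σ⁻¹
    simp only [Pi.sub_apply] at i4
    rw [← h1, fracIntegral, ← integral_const_mul, ← integral_const_mul,
      ← integral_sub i4 (i3.const_mul c)]
    congr 1
    ext p
    ring
  rw [e]
  refine (abs_integral_le_integral_abs.trans ?_).trans hσε
  have hgI : Integrable (g σ) := (hW.const_mul (C + c)).mono' (hgm σ) (hgb σ hσ)
  refine integral_mono_of_nonneg (Eventually.of_forall fun _ => abs_nonneg _) hgI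
    (Eventually.of_forall fun p => ?_)
  simp only [abs_mul, hg]
  exact mul_le_mul_of_nonneg_left (abs_sub_step_le hf1 hband p) (abs_nonneg _)

end

end

noncomputable section

variable {n : ℕ} {E : Set (Space (n + 1))}

/-! ### Defining functions of the boundary -/

/-- The projection onto the hyperplane `ν^⊥`. -/
abbrev hypProj (ν : Space (n + 1)) : Space (n + 1) →L[ℝ] (Submodule.span ℝ {ν})ᗮ :=
  (Submodule.span ℝ {ν})ᗮ.orthogonalProjectionOnto

lemma coe_hypProj {ν : Space (n + 1)} (hν : ‖ν‖ = 1) (x : Space (n + 1)) :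
    (hypProj ν x : Space (n + 1)) = x - ⟪ν, x⟫ • ν := by
  have h1 : (hypProj ν x : Space (n + 1)) = (Submodule.span ℝ {ν})ᗮ.starProjection x := rfl
  rw [h1, Submodule.starProjection_orthogonal_val, Submodule.starProjection_unit_singleton ℝ hν]

lemma norm_hypProj_le (ν : Space (n + 1)) : ‖hypProj ν‖ ≤ 1 :=
  Submodule.orthogonalProjectionOnto_norm_le _

lemma hypProj_self (ν : Space (n + 1)) : hypProj ν ν = 0 :=
  Submodule.orthogonalProjectionOnto_orthogonalComplement_singleton_eq_zero ν

/-- In the ball `B(y₀, δ)` the set `E` is the sublevel set of `φ`, which has slope one in the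
direction `ν₀`. -/
structure IsDefiningFunction (E : Set (Space (n + 1))) (y₀ ν₀ : Space (n + 1)) (δ : ℝ)
    (φ : Space (n + 1) → ℝ) : Prop where
  pos : 0 < δ
  norm_normal : ‖ν₀‖ = 1
  mem : ∀ x ∈ ball y₀ δ, φ x < 0 → x ∈ E
  notMem : ∀ x ∈ ball y₀ δ, 0 < φ x → x ∉ E
  add_smul : ∀ x t, φ (x + t • ν₀) = φ x + t
  contDiffOn : ContDiffOn ℝ 1 φ (ball y₀ δ)

/-- The defining function of a graph. -/
def graphFunction (y₀ ν₀ : Space (n + 1)) (γ : (Submodule.span ℝ {ν₀})ᗮ → ℝ)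
    (x : Space (n + 1)) : ℝ :=
  ⟪ν₀, x - y₀⟫ - γ (hypProj ν₀ (x - y₀))

lemma hypProj_mem_ball {y₀ ν₀ x : Space (n + 1)} {r : ℝ} (hx : x ∈ ball y₀ r) :
    hypProj ν₀ (x - y₀) ∈ ball 0 r := by
  rw [mem_ball_zero_iff]
  rw [mem_ball_iff_norm] at hx
  exact (((hypProj ν₀).le_of_opNorm_le (norm_hypProj_le ν₀) _).trans (by rw [one_mul])).trans_lt hx

lemma contDiffOn_graphFunction {y₀ ν₀ : Space (n + 1)} {r : ℝ} {k : WithTop ℕ∞}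
    {γ : (Submodule.span ℝ {ν₀})ᗮ → ℝ} (hγ : ContDiffOn ℝ k γ (ball 0 r)) :
    ContDiffOn ℝ k (graphFunction y₀ ν₀ γ) (ball y₀ r) := by
  refine ContDiffOn.sub ?_ ?_
  · exact (contDiff_const.inner ℝ (contDiff_id.sub contDiff_const)).contDiffOn
  · exact hγ.comp ((hypProj ν₀).contDiff.comp (contDiff_id.sub contDiff_const)).contDiffOn
      fun x hx => hypProj_mem_ball hx

lemma isDefiningFunction_graphFunction {y₀ ν₀ : Space (n + 1)} {r : ℝ}
    {γ : (Submodule.span ℝ {ν₀})ᗮ → ℝ} (hc : IsGraphChart E y₀ ν₀ r γ)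
    (hγ : ContDiffOn ℝ 1 γ (ball 0 r)) :
    IsDefiningFunction E y₀ ν₀ r (graphFunction y₀ ν₀ γ) := by
  obtain ⟨hν, hr, -, -, hE⟩ := hc
  have hdec : ∀ x : Space (n + 1),
      y₀ + (hypProj ν₀ (x - y₀) : Space (n + 1)) + ⟪ν₀, x - y₀⟫ • ν₀ = x := fun x => by
    rw [coe_hypProj hν]; abel
  have hh : ∀ x ∈ ball y₀ r, |⟪ν₀, x - y₀⟫| < r := fun x hx => by
    rw [mem_ball_iff_norm] at hx
    exact ((abs_real_inner_le_norm _ _).trans (by rw [hν, one_mul])).trans_lt hx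
  refine ⟨hr, hν, fun x hx hφ => ?_, fun x hx hφ => ?_, fun x t => ?_,
    contDiffOn_graphFunction hγ⟩
  · have := (hE _ (hypProj_mem_ball hx) _ (hh x hx)).1 (by unfold graphFunction at hφ; linarith)
    rwa [hdec] at this
  · have := (hE _ (hypProj_mem_ball hx) _ (hh x hx)).2 (by unfold graphFunction at hφ; linarith)
    rwa [hdec] at this
  · unfold graphFunction
    rw [add_sub_right_comm, map_add, map_smul, hypProj_self, smul_zero, add_zero, inner_add_right,
      inner_smul_right, real_inner_self_eq_norm_sq, hν]
    ring

lemma hasFDerivAt_graphFunction {y₀ ν₀ x : Space (n + 1)} {r : ℝ}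
    {γ : (Submodule.span ℝ {ν₀})ᗮ → ℝ} (hγ : ContDiffOn ℝ 1 γ (ball 0 r)) (hx : x ∈ ball y₀ r) :
    HasFDerivAt (graphFunction y₀ ν₀ γ)
      (innerSL ℝ ν₀ - (fderiv ℝ γ (hypProj ν₀ (x - y₀))).comp (hypProj ν₀)) x := by
  have h1 : HasFDerivAt (fun x => x - y₀) (ContinuousLinearMap.id ℝ (Space (n + 1))) x :=
    (hasFDerivAt_id x).sub_const y₀
  have h2 : HasFDerivAt γ (fderiv ℝ γ (hypProj ν₀ (x - y₀))) (hypProj ν₀ (x - y₀)) :=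
    ((hγ.differentiableOn one_ne_zero).differentiableAt
      (isOpen_ball.mem_nhds (hypProj_mem_ball hx))).hasFDerivAt
  have h3 := ((innerSL ℝ ν₀).hasFDerivAt (x := x - y₀)).comp x h1
  have h4 := h2.comp x (((hypProj ν₀).hasFDerivAt (x := x - y₀)).comp x h1)
  exact (h3.sub h4).congr_fderiv (by simp [ContinuousLinearMap.comp_id])

lemma norm_fderiv_graphFunction_sub_le {y₀ ν₀ x x' : Space (n + 1)} {r L β : ℝ} (hβ : 0 ≤ β)
    {γ : (Submodule.span ℝ {ν₀})ᗮ → ℝ} (hγ : ContDiffOn ℝ 1 γ (ball 0 r))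
    (hL : ∀ w ∈ ball (0 : (Submodule.span ℝ {ν₀})ᗮ) r,
      ∀ w' ∈ ball (0 : (Submodule.span ℝ {ν₀})ᗮ) r,
        ‖fderiv ℝ γ w - fderiv ℝ γ w'‖ ≤ L * ‖w - w'‖ ^ β)
    (hx : x ∈ ball y₀ r) (hx' : x' ∈ ball y₀ r) :
    ‖fderiv ℝ (graphFunction y₀ ν₀ γ) x - fderiv ℝ (graphFunction y₀ ν₀ γ) x'‖ ≤
      |L| * ‖x - x'‖ ^ β := by
  rw [(hasFDerivAt_graphFunction hγ hx).fderiv, (hasFDerivAt_graphFunction hγ hx').fderiv,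
    sub_sub_sub_cancel_left, ← ContinuousLinearMap.sub_comp, norm_sub_rev x]
  have h1 := hL _ (hypProj_mem_ball (ν₀ := ν₀) hx') _ (hypProj_mem_ball (ν₀ := ν₀) hx)
  have h2 : ‖hypProj ν₀ (x' - y₀) - hypProj ν₀ (x - y₀)‖ ≤ ‖x' - x‖ := by
    rw [← map_sub, sub_sub_sub_cancel_right]
    exact ((hypProj ν₀).le_of_opNorm_le (norm_hypProj_le ν₀) _).trans (by rw [one_mul])
  calc _ ≤ ‖fderiv ℝ γ (hypProj ν₀ (x' - y₀)) - fderiv ℝ γ (hypProj ν₀ (x - y₀))‖ *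
        ‖hypProj ν₀‖ := ContinuousLinearMap.opNorm_comp_le _ _
    _ ≤ (L * ‖hypProj ν₀ (x' - y₀) - hypProj ν₀ (x - y₀)‖ ^ β) * 1 :=
        mul_le_mul h1 (norm_hypProj_le ν₀) (ContinuousLinearMap.opNorm_nonneg _)
          (le_trans (ContinuousLinearMap.opNorm_nonneg _) h1)
    _ ≤ (|L| * ‖hypProj ν₀ (x' - y₀) - hypProj ν₀ (x - y₀)‖ ^ β) * 1 := by
        gcongr; exact le_abs_self L
    _ ≤ _ := by rw [mul_one]; gcongr

/-- The Borel representative `1_{int E} - 1_{ℝ^N ∖ closure E}` of the phase. -/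
def regularPhase (E : Set (Space (n + 1))) (x : Space (n + 1)) : ℝ :=
  (interior E).indicator (fun _ => (1 : ℝ)) x - (closure E)ᶜ.indicator (fun _ => (1 : ℝ)) x

lemma measurable_regularPhase (E : Set (Space (n + 1))) : Measurable (regularPhase E) :=
  (measurable_const.indicator isOpen_interior.measurableSet).sub
    (measurable_const.indicator isClosed_closure.measurableSet.compl)

lemma regularPhase_of_interior {x : Space (n + 1)} (hx : x ∈ interior E) :
    regularPhase E x = 1 := by
  have : x ∉ (closure E)ᶜ := fun h => h (subset_closure (interior_subset hx))
  simp [regularPhase, indicator_of_mem hx, indicator_of_notMem this]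

lemma regularPhase_of_notMem_closure {x : Space (n + 1)} (hx : x ∉ closure E) :
    regularPhase E x = -1 := by
  have h1 : x ∉ interior E := fun h => hx (subset_closure (interior_subset h))
  have h2 : x ∈ (closure E)ᶜ := hx
  simp [regularPhase, indicator_of_mem h2, indicator_of_notMem h1]

lemma abs_regularPhase_le (x : Space (n + 1)) : |regularPhase E x| ≤ 1 := by
  by_cases h1 : x ∈ interior E
  · rw [regularPhase_of_interior h1]; simp
  by_cases h2 : x ∈ closure E
  · have : x ∉ (closure E)ᶜ := fun h => h h2
    simp [regularPhase, indicator_of_notMem h1, indicator_of_notMem this]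
  · rw [regularPhase_of_notMem_closure h2]; simp

namespace IsDefiningFunction

variable {y₀ ν₀ : Space (n + 1)} {δ : ℝ} {φ : Space (n + 1) → ℝ}

lemma continuousAt (hφ : IsDefiningFunction E y₀ ν₀ δ φ) {x : Space (n + 1)}
    (hx : x ∈ ball y₀ δ) : ContinuousAt φ x :=
  hφ.contDiffOn.continuousOn.continuousAt (isOpen_ball.mem_nhds hx)

lemma differentiableAt (hφ : IsDefiningFunction E y₀ ν₀ δ φ) {x : Space (n + 1)}
    (hx : x ∈ ball y₀ δ) : DifferentiableAt ℝ φ x :=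
  (hφ.contDiffOn.differentiableOn one_ne_zero).differentiableAt (isOpen_ball.mem_nhds hx)

lemma mem_interior (hφ : IsDefiningFunction E y₀ ν₀ δ φ) {x : Space (n + 1)}
    (hx : x ∈ ball y₀ δ) (h : φ x < 0) : x ∈ interior E := by
  rw [mem_interior_iff_mem_nhds]
  filter_upwards [(hφ.continuousAt hx).eventually (gt_mem_nhds h), isOpen_ball.mem_nhds hx]
    with z hz hz' using hφ.mem z hz' hz

lemma notMem_closure (hφ : IsDefiningFunction E y₀ ν₀ δ φ) {x : Space (n + 1)}
    (hx : x ∈ ball y₀ δ) (h : 0 < φ x) : x ∉ closure E := by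
  rw [← mem_compl_iff, ← interior_compl, mem_interior_iff_mem_nhds]
  filter_upwards [(hφ.continuousAt hx).eventually (lt_mem_nhds h), isOpen_ball.mem_nhds hx]
    with z hz hz' using hφ.notMem z hz' hz

lemma regularPhase_eq (hφ : IsDefiningFunction E y₀ ν₀ δ φ) {x : Space (n + 1)}
    (hx : x ∈ ball y₀ δ) :
    (φ x < 0 → regularPhase E x = 1) ∧ (0 < φ x → regularPhase E x = -1) :=
  ⟨fun h => regularPhase_of_interior (hφ.mem_interior hx h),
    fun h => regularPhase_of_notMem_closure (hφ.notMem_closure hx h)⟩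

lemma eq_zero_of_mem_frontier (hφ : IsDefiningFunction E y₀ ν₀ δ φ) {x : Space (n + 1)}
    (hx : x ∈ ball y₀ δ) (hxE : x ∈ frontier E) : φ x = 0 := by
  rcases lt_trichotomy (φ x) 0 with h | h | h
  · exact absurd (hφ.mem_interior hx h) hxE.2
  · exact h
  · exact absurd hxE.1 (hφ.notMem_closure hx h)

lemma fderiv_normal (hφ : IsDefiningFunction E y₀ ν₀ δ φ) {x : Space (n + 1)}
    (hx : x ∈ ball y₀ δ) : fderiv ℝ φ x ν₀ = 1 := by
  have h1 : HasDerivAt (fun t : ℝ => φ (x + t • ν₀)) (fderiv ℝ φ x ν₀) 0 :=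
    (hφ.differentiableAt hx).hasFDerivAt.hasLineDerivAt ν₀
  simp only [hφ.add_smul] at h1
  exact h1.unique ((hasDerivAt_id (0 : ℝ)).const_add (φ x))

end IsDefiningFunction

/-! ### The boundary is a null set -/

/-- Every line in the direction ν₀ meets {φ = 0} at most once, since φ has slope one along it;
Fubini concludes. -/
lemma volume_frontier_inter_ball {y₀ ν₀ : Space (n + 1)} {δ : ℝ} {φ : Space (n + 1) → ℝ}
    (hφ : IsDefiningFunction E y₀ ν₀ δ φ) : volume (frontier E ∩ ball y₀ δ) = 0 := by
  obtain ⟨T, hT⟩ := exists_isometry_apply_joinLast hφ.norm_normal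
  have hm : MeasurableSet (frontier E ∩ ball y₀ δ) :=
    isClosed_frontier.measurableSet.inter measurableSet_ball
  have hmp : MeasurePreserving (fun p : Space n × ℝ => y₀ + T (joinLast p.1 p.2)) :=
    (measurePreserving_add_left volume y₀).comp
      (T.measurePreserving.comp (measurePreserving_joinEquiv n))
  rw [← hmp.measure_preimage hm.nullMeasurableSet, Measure.volume_eq_prod,
    Measure.measure_prod_null (hmp.measurable hm)]
  refine Eventually.of_forall fun w => Set.Subsingleton.measure_zero ?_ _
  intro h₁ hh₁ h₂ hh₂
  have hline : ∀ h, y₀ + T (joinLast w h) = (y₀ + T (joinLast w 0)) + h • ν₀ := by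
    intro h
    rw [← hT, ← map_smul, add_assoc, ← map_add, smul_joinLast, ← joinLast_add]
    simp
  have e₁ : φ (y₀ + T (joinLast w h₁)) = 0 := hφ.eq_zero_of_mem_frontier hh₁.2 hh₁.1
  have e₂ : φ (y₀ + T (joinLast w h₂)) = 0 := hφ.eq_zero_of_mem_frontier hh₂.2 hh₂.1
  rw [hline, hφ.add_smul] at e₁ e₂
  linarith

lemma volume_frontier_eq_zero (h : ∀ y ∈ frontier E, ∃ ν₀ δ φ, IsDefiningFunction E y ν₀ δ φ) :
    volume (frontier E) = 0 := by
  refine measure_null_of_locally_null _ fun y hy => ?_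
  obtain ⟨ν₀, δ, φ, hφ⟩ := h y hy
  exact ⟨_, inter_mem self_mem_nhdsWithin (mem_nhdsWithin_of_mem_nhds (ball_mem_nhds y hφ.pos)),
    volume_frontier_inter_ball hφ⟩

/-- E may contain any part of its boundary, so it is not assumed measurable; this lemma moves every
integral to a Borel phase. -/
lemma signIndicator_ae_eq (h : volume (frontier E) = 0) :
    signIndicator E =ᵐ[volume] regularPhase E := by
  have : ∀ᵐ x, x ∉ frontier E := measure_eq_zero_iff_ae_notMem.mp h
  filter_upwards [this] with x hx
  unfold signIndicator regularPhase
  congr 1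
  by_cases hE : x ∈ E
  · have : x ∈ interior E := by
      by_contra hi
      exact hx ⟨subset_closure hE, hi⟩
    rw [indicator_of_mem hE, indicator_of_mem this]
  · rw [indicator_of_notMem hE, indicator_of_notMem fun hi => hE (interior_subset hi)]

/-! ### Exterior normals and graphs in terms of a defining function -/

section charts

variable {y₀ ν₀ : Space (n + 1)} {δ : ℝ} {φ : Space (n + 1) → ℝ} {y ν : Space (n + 1)} {r : ℝ}
  {γ : (Submodule.span ℝ {ν})ᗮ → ℝ}

/-- If φ < 0 at a graph point, then points slightly above the graph would belong to E; if φ > 0,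
points slightly below would not. So any chart at any nearby boundary point parametrizes the zero set
of one and the same φ. -/
lemma eventually_graph_eq_zero (hφ : IsDefiningFunction E y₀ ν₀ δ φ) (hy : y ∈ ball y₀ δ)
    (hc : IsGraphChart E y ν r γ) :
    ∀ᶠ w : (Submodule.span ℝ {ν})ᗮ in 𝓝 0,
      φ (y + (w : Space (n + 1)) + γ w • ν) = 0 ∧ y + (w : Space (n + 1)) + γ w • ν ∈ ball y₀ δ := by
  obtain ⟨hν, hr, hγ0, hγd, hE⟩ := hc
  have hγc : ContinuousAt γ 0 := hγd.continuousAt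
  have h1 : ∀ᶠ w : (Submodule.span ℝ {ν})ᗮ in 𝓝 0, |γ w| < r := by
    have := hγc.abs
    rw [ContinuousAt, hγ0, abs_zero] at this
    exact this.eventually (gt_mem_nhds hr)
  have h2 : ∀ᶠ w : (Submodule.span ℝ {ν})ᗮ in 𝓝 0,
      y + (w : Space (n + 1)) + γ w • ν ∈ ball y₀ δ := by
    have : ContinuousAt (fun w : (Submodule.span ℝ {ν})ᗮ =>
        y + (w : Space (n + 1)) + γ w • ν) 0 := by fun_prop
    refine this.eventually (isOpen_ball.mem_nhds ?_)
    simpa [hγ0] using hy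
  filter_upwards [h1, h2, isOpen_ball.mem_nhds (mem_ball_self hr)] with w hw1 hw2 hw3
  refine ⟨?_, hw2⟩
  have hcv : ContinuousAt (fun h : ℝ => φ (y + (w : Space (n + 1)) + h • ν)) (γ w) :=
    ContinuousAt.comp (f := fun h : ℝ => y + (w : Space (n + 1)) + h • ν)
      (hφ.continuousAt hw2) (by fun_prop)
  have hbv : ∀ᶠ h : ℝ in 𝓝 (γ w), y + (w : Space (n + 1)) + h • ν ∈ ball y₀ δ :=
    (by fun_prop : ContinuousAt (fun h : ℝ => y + (w : Space (n + 1)) + h • ν) (γ w)).eventually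
      (isOpen_ball.mem_nhds hw2)
  have hr' : ∀ᶠ h : ℝ in 𝓝 (γ w), |h| < r := continuous_abs.continuousAt.eventually
    (gt_mem_nhds hw1)
  rcases lt_trichotomy (φ (y + (w : Space (n + 1)) + γ w • ν)) 0 with hlt | heq | hgt
  · exfalso
    have h3 := (hcv.eventually (gt_mem_nhds hlt)).and (hbv.and hr')
    obtain ⟨h, ⟨h4, h5, h6⟩, h7⟩ :=
      ((h3.filter_mono nhdsWithin_le_nhds).and (self_mem_nhdsWithin (s := Ioi (γ w)))).exists
    exact (hE w hw3 h h6).2 h7 (hφ.mem _ h5 h4)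
  · exact heq
  · exfalso
    have h3 := (hcv.eventually (lt_mem_nhds hgt)).and (hbv.and hr')
    obtain ⟨h, ⟨h4, h5, h6⟩, h7⟩ :=
      ((h3.filter_mono nhdsWithin_le_nhds).and (self_mem_nhdsWithin (s := Iio (γ w)))).exists
    exact hφ.notMem _ h5 h4 ((hE w hw3 h h6).1 h7)

/-- The graph parametrization has derivative `w ↦ w + (dγ w) ν`. -/
lemma hasFDerivAt_graph_map {γ' : (Submodule.span ℝ {ν})ᗮ →L[ℝ] ℝ} {w : (Submodule.span ℝ {ν})ᗮ}
    (h : HasFDerivAt γ γ' w) :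
    HasFDerivAt (fun w : (Submodule.span ℝ {ν})ᗮ => y + (w : Space (n + 1)) + γ w • ν)
      ((Submodule.span ℝ {ν})ᗮ.subtypeL + γ'.smulRight ν) w := by
  have h1 := ((Submodule.span ℝ {ν})ᗮ.subtypeL.hasFDerivAt (x := w)).const_add y
  exact h1.add (h.smul_const ν)

/-- Differentiating φ = 0 along the graph shows that dφ vanishes on ν^⊥, hence is l⟨ν, ·⟩, and l ≥ 0
because E lies below the graph. Then 1 = dφ(ν₀) = l⟨ν, ν₀⟩ ≤ l. Thus φ determines the normal, with a
slope bounded below uniformly. -/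
lemma exists_fderiv_eq_of_chart (hφ : IsDefiningFunction E y₀ ν₀ δ φ) (hy : y ∈ ball y₀ δ)
    (hyE : y ∈ frontier E) (hc : IsGraphChart E y ν r γ) :
    ∃ l : ℝ, 1 ≤ l ∧ ∀ v, fderiv ℝ φ y v = l * ⟪ν, v⟫ := by
  have hz := eventually_graph_eq_zero hφ hy hc
  have hφy := hφ.eq_zero_of_mem_frontier hy hyE
  obtain ⟨hν, hr, hγ0, hγd, hE⟩ := hc
  have hbase : y + ((0 : (Submodule.span ℝ {ν})ᗮ) : Space (n + 1)) + γ 0 • ν = y := by simp [hγ0]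
  have htan : ∀ w : (Submodule.span ℝ {ν})ᗮ, fderiv ℝ φ y w = 0 := by
    intro w
    have h1 : HasFDerivAt φ (fderiv ℝ φ y)
        (y + ((0 : (Submodule.span ℝ {ν})ᗮ) : Space (n + 1)) + γ 0 • ν) := by
      rw [hbase]; exact (hφ.differentiableAt hy).hasFDerivAt
    have h2 := h1.comp (0 : (Submodule.span ℝ {ν})ᗮ) (hasFDerivAt_graph_map (y := y) hγd)
    have h3 : HasFDerivAt (φ ∘ fun w : (Submodule.span ℝ {ν})ᗮ =>
        y + (w : Space (n + 1)) + γ w • ν) (0 : (Submodule.span ℝ {ν})ᗮ →L[ℝ] ℝ) 0 :=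
      (hasFDerivAt_const (0 : ℝ) _).congr_of_eventuallyEq (hz.mono fun w hw => hw.1)
    have h4 := DFunLike.congr_fun (h2.unique h3) w
    simpa using h4
  have hform : ∀ v, fderiv ℝ φ y v = fderiv ℝ φ y ν * ⟪ν, v⟫ := by
    intro v
    have h1 := htan (hypProj ν v)
    rw [coe_hypProj hν, map_sub, map_smul, smul_eq_mul] at h1
    linarith
  have hnonneg : 0 ≤ fderiv ℝ φ y ν := by
    have h1 : HasDerivAt (fun t : ℝ => φ (y + t • ν)) (fderiv ℝ φ y ν) 0 :=
      (hφ.differentiableAt hy).hasFDerivAt.hasLineDerivAt ν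
    refine ge_of_tendsto h1.tendsto_slope_zero_right ?_
    have hbv : ∀ᶠ h : ℝ in 𝓝[>] 0, y + h • ν ∈ ball y₀ δ :=
      ((by fun_prop : ContinuousAt (fun h : ℝ => y + h • ν) 0).eventually
        (isOpen_ball.mem_nhds (by simpa using hy))).filter_mono nhdsWithin_le_nhds
    filter_upwards [hbv, Ioo_mem_nhdsGT hr] with t ht htr
    have hnot : y + t • ν ∉ E := by
      have := (hE 0 (mem_ball_self hr) t (by rw [abs_of_pos htr.1]; exact htr.2)).2
        (by rw [hγ0]; exact htr.1)
      simpa using this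
    have hφt : 0 ≤ φ (y + t • ν) := by
      by_contra hcon
      exact hnot (hφ.mem _ ht (not_le.mp hcon))
    have ht0 := htr.1
    simp only [zero_add, zero_smul, add_zero, hφy, sub_zero, smul_eq_mul]
    positivity
  refine ⟨fderiv ℝ φ y ν, ?_, hform⟩
  have h1 := hφ.fderiv_normal hy
  rw [hform] at h1
  have h2 : ⟪ν, ν₀⟫ ≤ 1 := (real_inner_le_norm _ _).trans (by rw [hν, hφ.norm_normal, one_mul])
  nlinarith

lemma normal_unique {l l' : ℝ} {ν ν' : Space (n + 1)} {A : Space (n + 1) →L[ℝ] ℝ} (hl : 1 ≤ l)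
    (hl' : 1 ≤ l') (hν : ‖ν‖ = 1) (hν' : ‖ν'‖ = 1) (h : ∀ v, A v = l * ⟪ν, v⟫)
    (h' : ∀ v, A v = l' * ⟪ν', v⟫) : ν = ν' ∧ l = l' := by
  have e : l • ν = l' • ν' := by
    refine ext_inner_right ℝ fun v => ?_
    rw [real_inner_smul_left, real_inner_smul_left, ← h, ← h']
  have hll : l = l' := by
    have := congrArg norm e
    rw [norm_smul, norm_smul, hν, hν', Real.norm_of_nonneg (by linarith),
      Real.norm_of_nonneg (by linarith)] at this
    linarith
  refine ⟨?_, hll⟩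
  rw [← hll] at e
  exact smul_right_injective _ (by linarith : l ≠ 0) e

end charts

end

/-! ### The phase in a frame at a boundary point -/

noncomputable section

variable {n : ℕ} {E : Set (Space (n + 1))}

/-- The phase of `E` in the coordinates at `y` given by the isometry `T`. -/
def framePhase (E : Set (Space (n + 1))) (y : Space (n + 1))
    (T : Space (n + 1) ≃ₗᵢ[ℝ] Space (n + 1)) (p : Space n × ℝ) : ℝ :=
  regularPhase E (y + T (joinLast p.1 p.2))

lemma measurable_framePhase (E : Set (Space (n + 1))) (y : Space (n + 1))
    (T : Space (n + 1) ≃ₗᵢ[ℝ] Space (n + 1)) : Measurable (framePhase E y T) :=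
  (measurable_regularPhase E).comp
    ((continuous_const.add (T.continuous.comp continuous_joinLast)).measurable)

lemma norm_joinLast_le (w : Space n) (h : ℝ) : ‖joinLast w h‖ ≤ ‖w‖ + |h| := by
  have : joinLast w h = joinLast w 0 + joinLast 0 h := by simp [← joinLast_add]
  rw [this]
  exact (norm_add_le _ _).trans (by rw [norm_joinLast_zero, norm_joinLast_zero_left])

lemma inner_frame (T : Space (n + 1) ≃ₗᵢ[ℝ] Space (n + 1)) (w : Space n) (h : ℝ) :
    ⟪T (joinLast 0 1), T (joinLast w h)⟫ = h := by
  rw [LinearIsometryEquiv.inner_map_map, inner_joinLast]; simp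

/-! ### Uniform bands at nearby boundary points -/

section bands

variable {y₀ ν₀ : Space (n + 1)} {δ : ℝ} {φ : Space (n + 1) → ℝ}

lemma step_eq_of_sign {x a h : ℝ} {f : ℝ} (hne : h ≠ a) (hneg : h < a → x < 0)
    (hpos : a < h → 0 < x) (hf : (x < 0 → f = 1) ∧ (0 < x → f = -1)) : f = step a h := by
  unfold step
  rcases lt_or_gt_of_ne hne with hlt | hgt
  · rw [if_pos hlt, hf.1 (hneg hlt)]
  · rw [if_neg (not_lt.mpr hgt.le), hf.2 (hpos hgt)]

/-- An error smaller than |k| ≤ l|k| cannot change the sign of lk. Here x is a value of φ and k the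
height above the model interface. -/
lemma sign_of_abs_sub_mul_lt {x l k : ℝ} (hl : 1 ≤ l) (h : |x - l * k| < |k|) :
    (k < 0 → x < 0) ∧ (0 < k → 0 < x) := by
  have hd := abs_lt.mp h
  constructor
  · intro hk
    rw [abs_of_neg hk] at hd
    nlinarith [hd.2]
  · intro hk
    rw [abs_of_pos hk] at hd
    nlinarith [hd.1]

/-- The Hölder bound on dφ gives |φ(y + x) − lh| ≤ L‖x‖^(1+β) for x = T(w, h), with constants
independent of y; off the band this is less than |h|, so φ and h have the same sign. -/
lemma exists_flat_band_near (hφ : IsDefiningFunction E y₀ ν₀ δ φ) {β L : ℝ} (hβ : 0 < β)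
    (hL0 : 0 ≤ L) (hβ1 : β ≤ 1)
    (hL : ∀ x ∈ ball y₀ δ, ∀ x' ∈ ball y₀ δ,
      ‖fderiv ℝ φ x - fderiv ℝ φ x'‖ ≤ L * ‖x - x'‖ ^ β) :
    ∃ r > 0, ∃ M ≥ 0, ∀ y ∈ frontier E, y ∈ ball y₀ (δ / 2) →
      ∀ T : Space (n + 1) ≃ₗᵢ[ℝ] Space (n + 1), IsExteriorNormal E y (T (joinLast 0 1)) →
        BandPhase (framePhase E y T) r 0 fun w => M * ‖w‖ ^ (1 + β) := by
  have hδ := hφ.pos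
  -- The error is at most 4L|w|^(1+β) + 4Lr^β|h|. The choice of r makes the second term at most
  -- |h|/2, and outside the band with M = 8L + 1 the first is less than |h|/2. The bound r ≤ δ/4
  -- keeps y + x in the ball.
  refine ⟨min (δ / 4) ((1 / (8 * (L + 1))) ^ (1 / β)), by positivity, 8 * L + 1, by positivity,
    fun y hyE hy T ⟨r', γ, hc, _⟩ w h hw hh hb => ?_⟩
  set r := min (δ / 4) ((1 / (8 * (L + 1))) ^ (1 / β)) with hr
  have hr0 : 0 < r := by positivity
  have hrβ : r ^ β ≤ 1 / (8 * (L + 1)) := by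
    calc r ^ β ≤ ((1 / (8 * (L + 1))) ^ (1 / β)) ^ β :=
          Real.rpow_le_rpow hr0.le (min_le_right _ _) hβ.le
      _ = _ := by rw [← Real.rpow_mul (by positivity), one_div_mul_cancel hβ.ne', Real.rpow_one]
  have hrδ : r ≤ δ / 4 := min_le_left _ _
  have hyδ : y ∈ ball y₀ δ := ball_subset_ball (by linarith) hy
  obtain ⟨l, hl, hlin⟩ := exists_fderiv_eq_of_chart hφ hyδ hyE hc
  set x := T (joinLast w h) with hx
  have hxn : ‖x‖ ≤ ‖w‖ + |h| := by rw [hx, T.norm_map]; exact norm_joinLast_le w h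
  have hyx : y + x ∈ ball y₀ δ := by
    rw [mem_ball_iff_norm] at hy ⊢
    calc ‖y + x - y₀‖ = ‖(y - y₀) + x‖ := by congr 1; abel
      _ ≤ ‖y - y₀‖ + ‖x‖ := norm_add_le _ _
      _ < δ := by linarith
  have hφy := hφ.eq_zero_of_mem_frontier hyδ hyE
  have hmv : |φ (y + x) - l * h| ≤ L * ‖x‖ ^ β * ‖x‖ := by
    have hmem : ∀ z, ‖z - y‖ ≤ ‖x‖ → z ∈ ball y₀ δ := by
      intro z hz
      rw [mem_ball_iff_norm] at hy ⊢
      calc ‖z - y₀‖ = ‖(z - y) + (y - y₀)‖ := by congr 1; abel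
        _ ≤ ‖z - y‖ + ‖y - y₀‖ := norm_add_le _ _
        _ < δ := by linarith
    have := (convex_closedBall y ‖x‖).norm_image_sub_le_of_norm_fderiv_le' (𝕜 := ℝ) (f := φ)
      (φ := fderiv ℝ φ y) (C := L * ‖x‖ ^ β) (x := y) (y := y + x)
      (fun z hz => hφ.differentiableAt (hmem z (mem_closedBall_iff_norm.mp hz)))
      (fun z hz => ?_) (mem_closedBall_self (norm_nonneg _)) (by simp)
    · rw [hφy, sub_zero, add_sub_cancel_left, hlin, hx, inner_frame] at this
      exact this
    · rw [mem_closedBall_iff_norm] at hz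
      refine (hL z (hmem z hz) y hyδ).trans ?_
      gcongr
  have hpow : L * ‖x‖ ^ β * ‖x‖ < |h| := by
    have h1 : ‖x‖ ^ β * ‖x‖ ≤ 4 * ‖w‖ ^ (1 + β) + 4 * r ^ β * |h| := by
      have e : ‖x‖ ^ β * ‖x‖ = ‖x‖ ^ (1 + β) := by
        rcases eq_or_ne ‖x‖ 0 with h0 | h0
        · rw [h0, mul_zero, Real.zero_rpow (by linarith)]
        · rw [Real.rpow_add (lt_of_le_of_ne (norm_nonneg _) (Ne.symm h0)), Real.rpow_one, mul_comm]
      rw [e]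
      have h24 : (2 : ℝ) ^ (1 + β) ≤ 4 := by
        calc (2 : ℝ) ^ (1 + β) ≤ 2 ^ (2 : ℝ) :=
              Real.rpow_le_rpow_of_exponent_le (by norm_num) (by linarith)
          _ = 4 := by norm_num
      have hmaxp : (‖w‖ + |h|) ^ (1 + β) ≤ 4 * (max ‖w‖ |h|) ^ (1 + β) := by
        calc (‖w‖ + |h|) ^ (1 + β) ≤ (2 * max ‖w‖ |h|) ^ (1 + β) := by
              refine Real.rpow_le_rpow (by positivity) ?_ (by linarith)
              linarith [le_max_left ‖w‖ |h|, le_max_right ‖w‖ |h|]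
          _ = 2 ^ (1 + β) * (max ‖w‖ |h|) ^ (1 + β) := Real.mul_rpow (by norm_num) (by positivity)
          _ ≤ _ := by gcongr
      have hhp : |h| ^ (1 + β) ≤ r ^ β * |h| := by
        rcases eq_or_ne |h| 0 with h0 | h0
        · rw [h0, Real.zero_rpow (by linarith), mul_zero]
        · rw [Real.rpow_add (lt_of_le_of_ne (abs_nonneg _) (Ne.symm h0)), Real.rpow_one, mul_comm]
          gcongr
      have hw0 : 0 ≤ ‖w‖ ^ (1 + β) := by positivity
      have hr1 : 0 ≤ r ^ β * |h| := by positivity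
      calc ‖x‖ ^ (1 + β) ≤ (‖w‖ + |h|) ^ (1 + β) :=
            Real.rpow_le_rpow (norm_nonneg _) hxn (by linarith)
        _ ≤ _ := hmaxp
        _ ≤ _ := by
          rcases max_cases ‖w‖ |h| with ⟨h2, -⟩ | ⟨h2, -⟩ <;> rw [h2] <;> linarith
    have hb' : (8 * L + 1) * ‖w‖ ^ (1 + β) < |h| := by simpa using hb
    have hw0 : 0 ≤ ‖w‖ ^ (1 + β) := by positivity
    have h3 : L * (4 * r ^ β * |h|) ≤ |h| / 2 := by
      have : L * (4 * r ^ β) ≤ 1 / 2 := by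
        calc L * (4 * r ^ β) ≤ L * (4 * (1 / (8 * (L + 1)))) := by gcongr
          _ = (L / (L + 1)) / 2 := by field_simp; ring
          _ ≤ 1 / 2 := by
            have : L / (L + 1) ≤ 1 := by rw [div_le_one (by positivity)]; linarith
            linarith
      nlinarith [abs_nonneg h]
    have h4 := mul_le_mul_of_nonneg_left h1 hL0
    nlinarith
  have hne : h ≠ 0 := by
    rintro rfl
    rw [abs_zero] at hpow
    exact absurd hpow (not_lt.mpr (by positivity))
  have hd := sign_of_abs_sub_mul_lt hl (hmv.trans_lt hpow)
  exact step_eq_of_sign hne hd.1 hd.2 (hφ.regularPhase_eq hyx)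

/-! ### Second order expansions -/

/-- The mean value inequality is used twice: for dφ around y, then for the remainder along the
segment from y to y + x. The constant is not sharp. -/
lemma taylor_two_le {δ' L : ℝ} (hφ : ContDiffOn ℝ 2 φ (ball y₀ δ'))
    (hL0 : 0 ≤ L) (hL : ∀ x ∈ ball y₀ δ', ∀ x' ∈ ball y₀ δ',
      ‖fderiv ℝ (fderiv ℝ φ) x - fderiv ℝ (fderiv ℝ φ) x'‖ ≤ L * ‖x - x'‖)
    {y x : Space (n + 1)} (hmem : closedBall y ‖x‖ ⊆ ball y₀ δ') :
    |φ (y + x) - φ y - fderiv ℝ φ y x - fderiv ℝ (fderiv ℝ φ) y x x / 2| ≤ L * ‖x‖ ^ 3 := by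
  have hy : y ∈ ball y₀ δ' := hmem (mem_closedBall_self (norm_nonneg _))
  have hd : ∀ z ∈ ball y₀ δ', DifferentiableAt ℝ φ z := fun z hz =>
    (hφ.differentiableOn (by norm_num)).differentiableAt (isOpen_ball.mem_nhds hz)
  have hd2 : ∀ z ∈ ball y₀ δ', DifferentiableAt ℝ (fderiv ℝ φ) z := fun z hz =>
    ((hφ.fderiv_of_isOpen (m := 1) isOpen_ball (by norm_num)).differentiableOn
      (by norm_num)).differentiableAt (isOpen_ball.mem_nhds hz)
  have h1 : ∀ z ∈ closedBall y ‖x‖,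
      ‖fderiv ℝ φ z - fderiv ℝ φ y - fderiv ℝ (fderiv ℝ φ) y (z - y)‖ ≤
        L * ‖x‖ * ‖z - y‖ := by
    intro z hz
    refine (convex_closedBall y ‖x‖).norm_image_sub_le_of_norm_fderiv_le' (𝕜 := ℝ)
      (fun u hu => hd2 u (hmem hu)) (fun u hu => ?_) (mem_closedBall_self (norm_nonneg _)) hz
    refine (hL u (hmem hu) y hy).trans ?_
    rw [mem_closedBall_iff_norm] at hu
    gcongr
  set g : ℝ → ℝ := fun t => φ (y + t • x) - t * fderiv ℝ φ y x -
    t ^ 2 / 2 * fderiv ℝ (fderiv ℝ φ) y x x with hg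
  set g' : ℝ → ℝ := fun t => fderiv ℝ φ (y + t • x) x - fderiv ℝ φ y x -
    t * fderiv ℝ (fderiv ℝ φ) y x x with hg'
  have hseg : ∀ t ∈ Icc (0 : ℝ) 1, y + t • x ∈ closedBall y ‖x‖ := by
    intro t ht
    rw [mem_closedBall_iff_norm, add_sub_cancel_left, norm_smul, Real.norm_of_nonneg ht.1]
    exact mul_le_of_le_one_left (norm_nonneg _) ht.2
  have hder : ∀ t ∈ Icc (0 : ℝ) 1, HasDerivWithinAt g (g' t) (Icc 0 1) t := by
    intro t ht
    have e1 : HasDerivAt (fun t : ℝ => y + t • x) x t := by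
      simpa using ((hasDerivAt_id t).smul_const x).const_add y
    have e2 : HasDerivAt (fun t : ℝ => φ (y + t • x)) (fderiv ℝ φ (y + t • x) x) t :=
      (hd _ (hmem (hseg t ht))).hasFDerivAt.comp_hasDerivAt t e1
    have e3 : HasDerivAt (fun t : ℝ => t * fderiv ℝ φ y x) (fderiv ℝ φ y x) t := by
      simpa using (hasDerivAt_id t).mul_const (fderiv ℝ φ y x)
    have e4 : HasDerivAt (fun t : ℝ => t ^ 2 / 2 * fderiv ℝ (fderiv ℝ φ) y x x)
        (t * fderiv ℝ (fderiv ℝ φ) y x x) t := by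
      have := ((hasDerivAt_pow 2 t).div_const 2).mul_const (fderiv ℝ (fderiv ℝ φ) y x x)
      refine this.congr_deriv ?_
      push_cast
      ring
    exact ((e2.sub e3).sub e4).hasDerivWithinAt
  have hbound : ∀ t ∈ Ico (0 : ℝ) 1, ‖g' t‖ ≤ L * ‖x‖ ^ 3 := by
    intro t ht
    have h2 := h1 _ (hseg t ⟨ht.1, ht.2.le⟩)
    rw [add_sub_cancel_left] at h2
    have e : g' t = (fderiv ℝ φ (y + t • x) - fderiv ℝ φ y -
        fderiv ℝ (fderiv ℝ φ) y (t • x)) x := by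
      simp [hg']
    rw [e]
    refine (ContinuousLinearMap.le_of_opNorm_le _ h2 x).trans ?_
    have : ‖t • x‖ ≤ ‖x‖ := by
      rw [norm_smul, Real.norm_of_nonneg ht.1]
      exact mul_le_of_le_one_left (norm_nonneg _) ht.2.le
    calc _ ≤ L * ‖x‖ * ‖x‖ * ‖x‖ := by gcongr
      _ = _ := by ring
  have := norm_image_sub_le_of_norm_deriv_le_segment_01' hder hbound
  rw [Real.norm_eq_abs] at this
  convert this using 2
  simp only [hg]
  simp
  ring

/-- The inclusion `w ↦ (w, 0)`. -/
def joinLastCLM (n : ℕ) : Space n →L[ℝ] Space (n + 1) :=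
  LinearMap.mkContinuous
    { toFun := fun w => joinLast w 0
      map_add' := fun w w' => by rw [← joinLast_add, add_zero]
      map_smul' := fun c w => by rw [RingHom.id_apply, smul_joinLast, mul_zero] } 1
    fun w => by simp [norm_joinLast_zero]

@[simp] lemma joinLastCLM_apply (w : Space n) : joinLastCLM n w = joinLast w 0 := rfl

/-- Minus the second derivative of `φ` on the tangent space, divided by its slope. -/
def tangentForm (D : Space (n + 1) →L[ℝ] Space (n + 1) →L[ℝ] ℝ)
    (T : Space (n + 1) ≃ₗᵢ[ℝ] Space (n + 1)) (l : ℝ) : Space n →L[ℝ] Space n →L[ℝ] ℝ :=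
  (-l⁻¹) • D.bilinearComp
    ((T.toContinuousLinearEquiv : Space (n + 1) →L[ℝ] Space (n + 1)).comp (joinLastCLM n))
    ((T.toContinuousLinearEquiv : Space (n + 1) →L[ℝ] Space (n + 1)).comp (joinLastCLM n))

lemma tangentForm_apply (D : Space (n + 1) →L[ℝ] Space (n + 1) →L[ℝ] ℝ)
    (T : Space (n + 1) ≃ₗᵢ[ℝ] Space (n + 1)) (l : ℝ) (w w' : Space n) :
    tangentForm D T l w w' = -l⁻¹ * D (T (joinLast w 0)) (T (joinLast w' 0)) := by
  simp [tangentForm]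

lemma norm_tangentForm_le {D : Space (n + 1) →L[ℝ] Space (n + 1) →L[ℝ] ℝ}
    {T : Space (n + 1) ≃ₗᵢ[ℝ] Space (n + 1)} {l Λ : ℝ} (hl : 1 ≤ l) (hD : ‖D‖ ≤ Λ) :
    ‖tangentForm D T l‖ ≤ Λ := by
  have hΛ : 0 ≤ Λ := (norm_nonneg D).trans hD
  refine ContinuousLinearMap.opNorm_le_bound₂ _ hΛ fun w w' => ?_
  rw [tangentForm_apply, norm_mul, norm_neg, norm_inv, Real.norm_of_nonneg (by linarith)]
  have h1 := D.le_opNorm₂ (T (joinLast w 0)) (T (joinLast w' 0))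
  rw [T.norm_map, T.norm_map, norm_joinLast_zero, norm_joinLast_zero] at h1
  have h2 : l⁻¹ ≤ 1 := inv_le_one_of_one_le₀ hl
  calc _ ≤ 1 * (‖D‖ * ‖w‖ * ‖w'‖) := by gcongr
    _ ≤ Λ * ‖w‖ * ‖w'‖ := by rw [one_mul]; gcongr

/-- The band for a second order expansion, in one variable. -/
lemma quadratic_error_lt {a h b L Λ r M : ℝ} (ha : 0 ≤ a) (har : a < r) (hh : |h| < r)
    (hL : 0 ≤ L) (hΛ : 0 ≤ Λ) (hr1 : r ≤ 1) (hr : (4 * L + Λ) * (2 + Λ) * r ≤ 1 / 2)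
    (hM : M = 2 * ((4 * L + Λ) * (Λ + Λ ^ 2) + 4 * L) + 1) (hb : |b| ≤ Λ * a ^ 2)
    (hband : M * a ^ 3 < |h - b / 2|) :
    L * (a + |h|) ^ 3 + Λ * (|h| * (a + |h|)) < |h - b / 2| := by
  set k := |h - b / 2| with hk
  set z := |h| with hz
  have hz0 : 0 ≤ z := abs_nonneg _
  have hk0 : 0 ≤ k := abs_nonneg _
  -- Here a stands for ‖w‖ and b for B(w, w). The height z is controlled by the distance k to the
  -- parabola, so each error term becomes a small multiple (through r) of k plus a multiple of a³;
  -- the band makes the latter small against k as well.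
  have hzk : z ≤ k + Λ * a ^ 2 / 2 := by
    have : h = (h - b / 2) + b / 2 := by ring
    calc z = |(h - b / 2) + b / 2| := by rw [← this]
      _ ≤ k + |b / 2| := abs_add_le _ _
      _ ≤ _ := by rw [abs_div, abs_two]; linarith
  have hr0 : 0 < r := ha.trans_lt har
  have ha2 : a ^ 2 ≤ r := by nlinarith
  have ha3 : 0 ≤ a ^ 3 := by positivity
  have h2 : a ^ 2 * z ≤ r * k + Λ * a ^ 3 / 2 := by
    have : a ^ 4 ≤ a ^ 3 := by nlinarith
    calc a ^ 2 * z ≤ a ^ 2 * (k + Λ * a ^ 2 / 2) := by gcongr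
      _ = a ^ 2 * k + Λ / 2 * a ^ 4 := by ring
      _ ≤ r * k + Λ / 2 * a ^ 3 := by gcongr
      _ = _ := by ring
  have hx : z * (a + z) ≤ (2 + Λ) * r * k + (Λ + Λ ^ 2) * a ^ 3 := by
    calc z * (a + z) ≤ (k + Λ * a ^ 2 / 2) * (a + z) := by gcongr
      _ = k * (a + z) + Λ / 2 * a ^ 3 + Λ / 2 * (a ^ 2 * z) := by ring
      _ ≤ k * (r + r) + Λ / 2 * a ^ 3 + Λ / 2 * (r * k + Λ * a ^ 3 / 2) := by gcongr
      _ ≤ _ := by nlinarith [mul_nonneg hΛ ha3, mul_nonneg (mul_nonneg hΛ hr0.le) hk0,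
          mul_nonneg (sq_nonneg Λ) ha3]
  have hz3 : z ^ 3 ≤ z * (a + z) := by nlinarith [mul_nonneg hz0 ha, sq_nonneg z]
  have hcube : (a + z) ^ 3 ≤ 4 * a ^ 3 + 4 * z ^ 3 := by
    nlinarith [mul_nonneg (add_nonneg ha hz0) (sq_nonneg (a - z))]
  have hX0 : 0 ≤ z * (a + z) := by positivity
  have hmain : L * (a + z) ^ 3 + Λ * (z * (a + z)) ≤
      (4 * L + Λ) * (z * (a + z)) + 4 * L * a ^ 3 := by
    nlinarith [mul_le_mul_of_nonneg_left hcube hL, mul_le_mul_of_nonneg_left hz3 hL]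
  have h5 : (4 * L + Λ) * (z * (a + z)) ≤
      (4 * L + Λ) * ((2 + Λ) * r * k + (Λ + Λ ^ 2) * a ^ 3) :=
    mul_le_mul_of_nonneg_left hx (by positivity)
  have h6 : (4 * L + Λ) * (2 + Λ) * r * k ≤ 1 / 2 * k := mul_le_mul_of_nonneg_right hr hk0
  have h7 : M * a ^ 3 = 2 * ((4 * L + Λ) * (Λ + Λ ^ 2) * a ^ 3 + 4 * L * a ^ 3) + a ^ 3 := by
    rw [hM]; ring
  nlinarith

end bands

end

/-! ### Quadratic bands and the second fundamental form -/

noncomputable section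

variable {n : ℕ} {E : Set (Space (n + 1))}

section quadratic

variable {y₀ ν₀ : Space (n + 1)} {δ : ℝ} {φ : Space (n + 1) → ℝ}

-- Taylor's formula at y reads φ(y + x) = lh + D(x, x)/2 + O(‖x‖³). Replacing x by its tangential
-- part in D gives l(h − B(w,w)/2) with B = `tangentForm`, and `quadratic_error_lt` makes the
-- remainder too small to affect the sign off the cubic band.
set_option maxHeartbeats 400000 in
lemma exists_quadratic_band_near (hφ : IsDefiningFunction E y₀ ν₀ δ φ)
    (hφ3 : ContDiffOn ℝ 3 φ (ball y₀ δ)) :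
    ∃ δ' > 0, ∃ r > 0, ∃ M ≥ 0, r ≤ 1 ∧ δ' ≤ δ ∧ ∀ y ∈ frontier E, y ∈ ball y₀ δ' →
      ∀ T : Space (n + 1) ≃ₗᵢ[ℝ] Space (n + 1), IsExteriorNormal E y (T (joinLast 0 1)) →
        ∃ l : ℝ, 1 ≤ l ∧ (∀ v, fderiv ℝ φ y v = l * ⟪T (joinLast 0 1), v⟫) ∧
          ‖tangentForm (fderiv ℝ (fderiv ℝ φ) y) T l‖ ≤ M ∧
          BandPhase (framePhase E y T) r
            (fun w => tangentForm (fderiv ℝ (fderiv ℝ φ) y) T l w w / 2) fun w => M * ‖w‖ ^ 3 := by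
  have hδ := hφ.pos
  have hd1 : ContDiffOn ℝ 2 (fderiv ℝ φ) (ball y₀ δ) :=
    hφ3.fderiv_of_isOpen isOpen_ball (by norm_num)
  have hd2 : ContDiffOn ℝ 1 (fderiv ℝ (fderiv ℝ φ)) (ball y₀ δ) :=
    hd1.fderiv_of_isOpen isOpen_ball (by norm_num)
  -- The third derivative enters only through the local Lipschitz continuity of the second.
  obtain ⟨L, U, hU, hLip⟩ :=
    ((hd2.contDiffAt (isOpen_ball.mem_nhds (mem_ball_self hδ))).exists_lipschitzOnWith)
  obtain ⟨δ₁, hδ₁, hδ₁U⟩ := Metric.mem_nhds_iff.mp hU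
  set ε := min δ δ₁ with hε
  have hε0 : 0 < ε := lt_min hδ hδ₁
  have hεδ : ball y₀ ε ⊆ ball y₀ δ := ball_subset_ball (min_le_left _ _)
  have hL0 : (0 : ℝ) ≤ L := L.2
  have hL : ∀ x ∈ ball y₀ ε, ∀ x' ∈ ball y₀ ε,
      ‖fderiv ℝ (fderiv ℝ φ) x - fderiv ℝ (fderiv ℝ φ) x'‖ ≤ L * ‖x - x'‖ := by
    intro x hx x' hx'
    have := hLip.dist_le_mul x (hδ₁U (ball_subset_ball (min_le_right _ _) hx)) x'
      (hδ₁U (ball_subset_ball (min_le_right _ _) hx'))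
    rwa [dist_eq_norm, dist_eq_norm] at this
  set Λ : ℝ := ‖fderiv ℝ (fderiv ℝ φ) y₀‖ + L * ε with hΛ
  have hΛ0 : 0 ≤ Λ := by
    have : 0 ≤ ‖fderiv ℝ (fderiv ℝ φ) y₀‖ := ContinuousLinearMap.opNorm_nonneg _
    positivity
  have hΛle : ∀ y ∈ ball y₀ ε, ‖fderiv ℝ (fderiv ℝ φ) y‖ ≤ Λ := by
    intro y hy
    have h1 := hL y hy y₀ (mem_ball_self hε0)
    have h2 : ‖fderiv ℝ (fderiv ℝ φ) y‖ ≤ ‖fderiv ℝ (fderiv ℝ φ) y₀‖ +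
        ‖fderiv ℝ (fderiv ℝ φ) y - fderiv ℝ (fderiv ℝ φ) y₀‖ := by
      have := ContinuousLinearMap.opNorm_add_le (fderiv ℝ (fderiv ℝ φ) y₀)
        (fderiv ℝ (fderiv ℝ φ) y - fderiv ℝ (fderiv ℝ φ) y₀)
      rwa [add_sub_cancel] at this
    rw [mem_ball_iff_norm] at hy
    have : (L : ℝ) * ‖y - y₀‖ ≤ L * ε := by gcongr
    linarith
  set K : ℝ := (4 * L + Λ) * (2 + Λ) with hK
  have hK0 : 0 ≤ K := by positivity
  set r : ℝ := min (min 1 (ε / 4)) (1 / (2 * (K + 1))) with hr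
  have hr0 : 0 < r := by positivity
  have hr1 : r ≤ 1 := (min_le_left _ _).trans (min_le_left _ _)
  have hrε : r ≤ ε / 4 := (min_le_left _ _).trans (min_le_right _ _)
  have hrK : K * r ≤ 1 / 2 := by
    calc K * r ≤ K * (1 / (2 * (K + 1))) := by gcongr; exact min_le_right _ _
      _ = (K / (K + 1)) / 2 := by field_simp
      _ ≤ 1 / 2 := by
        have : K / (K + 1) ≤ 1 := by rw [div_le_one (by positivity)]; linarith
        linarith
  set M₀ : ℝ := 2 * ((4 * L + Λ) * (Λ + Λ ^ 2) + 4 * L) + 1 with hM₀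
  have hM₀0 : 0 ≤ M₀ := by positivity
  refine ⟨ε / 2, by positivity, r, hr0, M₀ + Λ, by positivity, hr1,
    by linarith [min_le_left δ δ₁], fun y hyE hy T ⟨r', γ, hc, _⟩ => ?_⟩
  have hyε : y ∈ ball y₀ ε := ball_subset_ball (by linarith) hy
  obtain ⟨l, hl, hlin⟩ := exists_fderiv_eq_of_chart hφ (hεδ hyε) hyE hc
  refine ⟨l, hl, hlin, (norm_tangentForm_le hl (hΛle y hyε)).trans (by linarith),
    fun w h hw hh hb => ?_⟩
  set D := fderiv ℝ (fderiv ℝ φ) y with hD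
  set B := tangentForm D T l with hB
  set x := T (joinLast w h) with hx
  have hxn : ‖x‖ ≤ ‖w‖ + |h| := by rw [hx, T.norm_map]; exact norm_joinLast_le w h
  have hmem : closedBall y ‖x‖ ⊆ ball y₀ ε := by
    intro z hz
    rw [mem_closedBall_iff_norm] at hz
    rw [mem_ball_iff_norm] at hy ⊢
    calc ‖z - y₀‖ = ‖(z - y) + (y - y₀)‖ := by congr 1; abel
      _ ≤ ‖z - y‖ + ‖y - y₀‖ := norm_add_le _ _
      _ < ε := by linarith
  have hyx : y + x ∈ ball y₀ ε := hmem (by simp)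
  have hφy := hφ.eq_zero_of_mem_frontier (hεδ hyε) hyE
  have ht := taylor_two_le ((hφ3.of_le (by norm_num)).mono hεδ) hL0 hL hmem
  rw [hφy, sub_zero, hlin, hx, inner_frame, ← hx] at ht
  have hBb : |B w w| ≤ Λ * ‖w‖ ^ 2 := by
    have h1 := B.le_opNorm₂ w w
    rw [Real.norm_eq_abs] at h1
    calc |B w w| ≤ ‖B‖ * ‖w‖ * ‖w‖ := h1
      _ ≤ Λ * ‖w‖ * ‖w‖ := by gcongr; exact norm_tangentForm_le hl (hΛle y hyε)
      _ = _ := by ring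
  have hb0 : M₀ * ‖w‖ ^ 3 < |h - B w w / 2| := by
    refine lt_of_le_of_lt ?_ hb
    have : 0 ≤ Λ * ‖w‖ ^ 3 := by positivity
    dsimp only
    linarith
  have hq := quadratic_error_lt (norm_nonneg w) hw hh hL0 hΛ0 hr1 (by simpa [hK] using hrK)
    hM₀ hBb hb0
  have hxw : x = T (joinLast w 0) + h • T (joinLast 0 1) := by
    rw [hx, ← map_smul, ← map_add, smul_joinLast, ← joinLast_add]; simp
  have hDx : |D x x / 2 - D (T (joinLast w 0)) (T (joinLast w 0)) / 2| ≤
      Λ * (|h| * (‖w‖ + |h|)) := by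
    have hDb : ∀ u v, |D u v| ≤ Λ * ‖u‖ * ‖v‖ := fun u v => by
      have h1 := D.le_opNorm₂ u v
      rw [Real.norm_eq_abs] at h1
      refine h1.trans ?_
      gcongr
      exact hΛle y hyε
    -- Expanding one slot at a time makes the symmetry of D unnecessary.
    have e : D x x - D (T (joinLast w 0)) (T (joinLast w 0)) =
        h * D (T (joinLast w 0)) (T (joinLast 0 1)) + h * D (T (joinLast 0 1)) x := by
      conv_lhs => rw [hxw]
      conv_rhs => rw [hxw]
      simp only [map_add, map_smul, add_apply, smul_apply, smul_eq_mul]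
      ring
    have h1 := hDb (T (joinLast w 0)) (T (joinLast 0 1))
    have h2 := hDb (T (joinLast 0 1)) x
    rw [T.norm_map, T.norm_map, norm_joinLast_zero, norm_joinLast_zero_left, abs_one,
      mul_one] at h1
    rw [T.norm_map, norm_joinLast_zero_left, abs_one, mul_one] at h2
    rw [← sub_div, e, abs_div, abs_two, ← mul_add, abs_mul]
    have h3 : |D (T (joinLast w 0)) (T (joinLast 0 1)) + D (T (joinLast 0 1)) x| ≤
        Λ * ‖w‖ + Λ * (‖w‖ + |h|) :=
      (abs_add_le _ _).trans (add_le_add h1 (h2.trans (by gcongr)))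
    have h4 : |h| * |D (T (joinLast w 0)) (T (joinLast 0 1)) + D (T (joinLast 0 1)) x| ≤
        |h| * (Λ * ‖w‖ + Λ * (‖w‖ + |h|)) := by gcongr
    have h5 : 0 ≤ |h| * Λ * |h| := by positivity
    linarith
  have hl0 : 0 < l := by linarith
  have hDB : D (T (joinLast w 0)) (T (joinLast w 0)) = -(l * B w w) := by
    rw [hB, tangentForm_apply]; field_simp
  have hmain : |φ (y + x) - l * (h - B w w / 2)| < |h - B w w / 2| := by
    refine lt_of_le_of_lt ?_ hq
    have e : φ (y + x) - l * (h - B w w / 2) = (φ (y + x) - l * h - D x x / 2) +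
        (D x x / 2 - D (T (joinLast w 0)) (T (joinLast w 0)) / 2) := by rw [hDB]; ring
    rw [e]
    refine (abs_add_le _ _).trans (add_le_add (ht.trans ?_) hDx)
    gcongr
  have hd := sign_of_abs_sub_mul_lt hl hmain
  have hne : h ≠ B w w / 2 := by
    rintro heq
    rw [← heq, sub_self, abs_zero] at hb0
    exact absurd hb0 (not_lt.mpr (by positivity))
  exact step_eq_of_sign hne (fun hlt => hd.1 (sub_neg.mpr hlt)) (fun hgt => hd.2 (sub_pos.mpr hgt))
    (hφ.regularPhase_eq (hεδ hyx))

/-- The second fundamental form in terms of a defining function. -/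
lemma fderiv_fderiv_chart {y ν : Space (n + 1)} {r : ℝ} {γ : (Submodule.span ℝ {ν})ᗮ → ℝ}
    (hφ : IsDefiningFunction E y₀ ν₀ δ φ) (hφ2 : ContDiffOn ℝ 2 φ (ball y₀ δ))
    (hy : y ∈ ball y₀ δ) (hc : IsGraphChart E y ν r γ) (hγ : ContDiffOn ℝ 2 γ (ball 0 r))
    (u v : (Submodule.span ℝ {ν})ᗮ) :
    fderiv ℝ (fderiv ℝ φ) y v u + fderiv ℝ φ y ν * fderiv ℝ (fderiv ℝ γ) 0 v u = 0 := by
  have hz := eventually_graph_eq_zero hφ hy hc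
  obtain ⟨hν, hr, hγ0, hγd, hE⟩ := hc
  set ψ : (Submodule.span ℝ {ν})ᗮ → Space (n + 1) :=
    fun w => y + (w : Space (n + 1)) + γ w • ν with hψ
  have hψ0 : ψ 0 = y := by simp [hψ, hγ0]
  have hγ1 : ∀ w ∈ ball (0 : (Submodule.span ℝ {ν})ᗮ) r, DifferentiableAt ℝ γ w := fun w hw =>
    (hγ.differentiableOn (by norm_num)).differentiableAt (isOpen_ball.mem_nhds hw)
  have hγ2 : DifferentiableAt ℝ (fderiv ℝ γ) 0 :=
    ((hγ.fderiv_of_isOpen (m := 1) isOpen_ball (by norm_num)).differentiableOn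
      (by norm_num)).differentiableAt (isOpen_ball.mem_nhds (mem_ball_self hr))
  have hφ1 : DifferentiableAt ℝ (fderiv ℝ φ) (ψ 0) := by
    rw [hψ0]
    exact ((hφ2.fderiv_of_isOpen (m := 1) isOpen_ball (by norm_num)).differentiableOn
      (by norm_num)).differentiableAt (isOpen_ball.mem_nhds hy)
  -- The identity φ(graph) = 0 is differentiated in the direction u near 0, then in the direction v
  -- at 0, where dγ = 0 removes the cross terms.
  have hfirst : ∀ᶠ w : (Submodule.span ℝ {ν})ᗮ in 𝓝 0,
      fderiv ℝ φ (ψ w) ((u : Space (n + 1)) + (fderiv ℝ γ w u) • ν) = 0 := by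
    filter_upwards [hz.eventually_nhds, isOpen_ball.mem_nhds (mem_ball_self hr)] with w hw hwr
    have h1 : HasFDerivAt φ (fderiv ℝ φ (ψ w)) (ψ w) :=
      (hφ.differentiableAt hw.self_of_nhds.2).hasFDerivAt
    have h2 := h1.comp w (hasFDerivAt_graph_map (y := y) (hγ1 w hwr).hasFDerivAt)
    have h3 : HasFDerivAt (φ ∘ ψ) (0 : (Submodule.span ℝ {ν})ᗮ →L[ℝ] ℝ) w :=
      (hasFDerivAt_const (0 : ℝ) _).congr_of_eventuallyEq (hw.mono fun z hz => hz.1)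
    have h4 := DFunLike.congr_fun (h2.unique h3) u
    simpa using h4
  have hψd : HasFDerivAt ψ ((Submodule.span ℝ {ν})ᗮ.subtypeL +
      (0 : (Submodule.span ℝ {ν})ᗮ →L[ℝ] ℝ).smulRight ν) 0 := hasFDerivAt_graph_map hγd
  have h1 : HasFDerivAt (fun w => fderiv ℝ φ (ψ w)) _ 0 := hφ1.hasFDerivAt.comp _ hψd
  have h2 : HasFDerivAt (fun w => fderiv ℝ γ w u) ((fderiv ℝ (fderiv ℝ γ) 0).flip u) 0 := by
    have := hγ2.hasFDerivAt.clm_apply (hasFDerivAt_const u (0 : (Submodule.span ℝ {ν})ᗮ))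
    simpa using this
  have h3 : HasFDerivAt (fun w => (u : Space (n + 1)) + (fderiv ℝ γ w u) • ν)
      (((fderiv ℝ (fderiv ℝ γ) 0).flip u).smulRight ν) 0 :=
    (h2.smul_const ν).const_add _
  have h4 := h1.clm_apply h3
  have h5 : HasFDerivAt (fun w => fderiv ℝ φ (ψ w) ((u : Space (n + 1)) + (fderiv ℝ γ w u) • ν))
      (0 : (Submodule.span ℝ {ν})ᗮ →L[ℝ] ℝ) 0 :=
    (hasFDerivAt_const (0 : ℝ) _).congr_of_eventuallyEq hfirst
  have h6 := DFunLike.congr_fun (h4.unique h5) v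
  have h7 : fderiv ℝ γ 0 = 0 := hγd.fderiv
  simp only [hψ0, h7] at h6
  simp at h6
  linarith

/-- The orthonormal basis of `ν^⊥` given by an isometry sending the last basis vector to `ν`. -/
lemma exists_orthonormalBasis_frame (T : Space (n + 1) ≃ₗᵢ[ℝ] Space (n + 1)) :
    ∃ b : OrthonormalBasis (Fin n) ℝ (Submodule.span ℝ {T (joinLast 0 1)})ᗮ,
      ∀ i, (b i : Space (n + 1)) = T (joinLast (EuclideanSpace.single i 1) 0) := by
  set ν := T (joinLast 0 1) with hν
  have hν1 : ‖ν‖ = 1 := by rw [hν, T.norm_map, norm_joinLast_zero_left, abs_one]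
  have hν0 : ν ≠ 0 := by rw [← norm_ne_zero_iff, hν1]; exact one_ne_zero
  have hmem : ∀ i : Fin n, T (joinLast (EuclideanSpace.single i 1) 0) ∈
      (Submodule.span ℝ {ν})ᗮ := fun i =>
    Submodule.mem_orthogonal_singleton_iff_inner_right.mpr (inner_frame T _ 0)
  set f : Fin n → (Submodule.span ℝ {ν})ᗮ := fun i => ⟨_, hmem i⟩ with hf
  have hon : Orthonormal ℝ f := by
    rw [orthonormal_iff_ite]
    intro i j
    rw [Submodule.coe_inner]
    simp only [hf]
    rw [LinearIsometryEquiv.inner_map_map, inner_joinLast]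
    simp [EuclideanSpace.inner_single_left]
  have : Fact (Module.finrank ℝ (Space (n + 1)) = n + 1) := ⟨by simp⟩
  have hfr : Module.finrank ℝ (Submodule.span ℝ {ν})ᗮ = n :=
    Submodule.finrank_orthogonal_span_singleton hν0
  have hspan : ⊤ ≤ Submodule.span ℝ (range f) :=
    (hon.linearIndependent.span_eq_top_of_card_eq_finrank' (by simp [hfr])).ge
  exact ⟨OrthonormalBasis.mk hon hspan, fun i => by simp [hf]⟩

/-- The chart defining H may differ from the one giving T, but both normals are read off dφ at y, so
`normal_unique` identifies them. Then `fderiv_fderiv_chart` turns the trace into Δγ(0) in the basis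
induced by T. -/
lemma sum_tangentForm {y : Space (n + 1)} {T : Space (n + 1) ≃ₗᵢ[ℝ] Space (n + 1)} {l H : ℝ}
    (hn : 1 ≤ n) (hφ : IsDefiningFunction E y₀ ν₀ δ φ) (hφ2 : ContDiffOn ℝ 2 φ (ball y₀ δ))
    (hy : y ∈ ball y₀ δ) (hyE : y ∈ frontier E) (hl : 1 ≤ l)
    (hlin : ∀ v, fderiv ℝ φ y v = l * ⟪T (joinLast 0 1), v⟫) (hH : IsMeanCurvature E y H) :
    ∑ i, tangentForm (fderiv ℝ (fderiv ℝ φ) y) T l (EuclideanSpace.single i 1)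
      (EuclideanSpace.single i 1) = n * H := by
  obtain ⟨ν, r, γ, hc, hγ, rfl⟩ := hH
  obtain ⟨l', hl', hlin'⟩ := exists_fderiv_eq_of_chart hφ hy hyE hc
  have hT1 : ‖T (joinLast 0 1)‖ = 1 := by rw [T.norm_map, norm_joinLast_zero_left, abs_one]
  obtain ⟨rfl, rfl⟩ := normal_unique hl' hl hc.1 hT1 hlin' hlin
  obtain ⟨b, hb⟩ := exists_orthonormalBasis_frame T
  rw [InnerProductSpace.laplacian_eq_iteratedFDeriv_orthonormalBasis γ b]
  have hn0 : (n : ℝ) ≠ 0 := by positivity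
  rw [mul_div_cancel₀ _ hn0]
  refine Finset.sum_congr rfl fun i _ => ?_
  have h1 := fderiv_fderiv_chart hφ hφ2 hy hc hγ (b i) (b i)
  rw [hlin, real_inner_self_eq_norm_sq, hT1] at h1
  rw [tangentForm_apply, iteratedFDeriv_two_apply, ← hb]
  simp only [Matrix.cons_val_zero, Matrix.cons_val_one]
  have hl0 : l' ≠ 0 := by linarith
  field_simp
  linarith

end quadratic

/-! ### Uniform bands on compact sets -/

lemma BandPhase.mono {f : Space n × ℝ → ℝ} {R R' : ℝ} {a b b' : Space n → ℝ}
    (h : BandPhase f R a b) (hR : R' ≤ R) (hb : ∀ w, b w ≤ b' w) : BandPhase f R' a b' :=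
  fun w t hw ht hlt => h w t (hw.trans_le hR) (ht.trans_le hR) ((hb w).trans_lt hlt)

/-- Uniform flatness of the boundary at `y`. -/
def FlatAt (E : Set (Space (n + 1))) (β r M : ℝ) (y : Space (n + 1)) : Prop :=
  ∀ T : Space (n + 1) ≃ₗᵢ[ℝ] Space (n + 1), T (joinLast 0 1) = exteriorNormal E y →
    BandPhase (framePhase E y T) r 0 fun w => M * ‖w‖ ^ (1 + β)

/-- Uniform second order expansion of the boundary at `y`. -/
def QuadraticAt (E : Set (Space (n + 1))) (r M : ℝ) (y : Space (n + 1)) : Prop :=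
  ∀ T : Space (n + 1) ≃ₗᵢ[ℝ] Space (n + 1), T (joinLast 0 1) = exteriorNormal E y →
    ∃ B : Space n →L[ℝ] Space n →L[ℝ] ℝ, ‖B‖ ≤ M ∧
      ∑ i, B (EuclideanSpace.single i 1) (EuclideanSpace.single i 1) = n * meanCurvature E y ∧
      BandPhase (framePhase E y T) r (fun w => B w w / 2) fun w => M * ‖w‖ ^ 3

/-- Monotonicity in r and M allows the constants of finitely many balls to be merged by min and max.
-/
lemma exists_uniform_of_local {Q : ℝ → ℝ → Space (n + 1) → Prop}
    (hQ : ∀ r r' M M' y, r' ≤ r → M ≤ M' → Q r M y → Q r' M' y)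
    (hloc : ∀ y₀ ∈ frontier E, ∃ δ > 0, ∃ r > 0, ∃ M ≥ 0, ∀ y ∈ frontier E, y ∈ ball y₀ δ → Q r M y)
    {K : Set (Space (n + 1))} (hK : IsCompact K) (hKE : K ⊆ frontier E) :
    ∃ r > 0, ∃ M ≥ 0, r ≤ 1 ∧ ∀ y ∈ K, Q r M y := by
  have : ∃ r > 0, ∃ M ≥ 0, ∀ y ∈ K, Q r M y := by
    refine hK.induction_on (p := fun S => ∃ r > 0, ∃ M ≥ 0, ∀ y ∈ S, Q r M y)
      ⟨1, one_pos, 0, le_rfl, by simp⟩ ?_ ?_ ?_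
    · rintro S S' hSS ⟨r, hr, M, hM, h⟩
      exact ⟨r, hr, M, hM, fun y hy => h y (hSS hy)⟩
    · rintro S S' ⟨r, hr, M, hM, h⟩ ⟨r', hr', M', hM', h'⟩
      refine ⟨min r r', lt_min hr hr', max M M', le_max_of_le_left hM, fun y hy => ?_⟩
      rcases hy with hy | hy
      · exact hQ _ _ _ _ _ (min_le_left _ _) (le_max_left _ _) (h y hy)
      · exact hQ _ _ _ _ _ (min_le_right _ _) (le_max_right _ _) (h' y hy)
    · intro y₀ hy₀
      obtain ⟨δ, hδ, r, hr, M, hM, h⟩ := hloc y₀ (hKE hy₀)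
      exact ⟨K ∩ ball y₀ δ, inter_mem self_mem_nhdsWithin
        (mem_nhdsWithin_of_mem_nhds (ball_mem_nhds _ hδ)), r, hr, M, hM,
        fun y hy => h y (hKE hy.1) hy.2⟩
  obtain ⟨r, hr, M, hM, h⟩ := this
  exact ⟨min r 1, lt_min hr one_pos, M, hM, min_le_right _ _,
    fun y hy => hQ _ _ _ _ _ (min_le_left _ _) le_rfl (h y hy)⟩

lemma FlatAt.mono {β r r' M M' : ℝ} {y : Space (n + 1)} (hr : r' ≤ r) (hM : M ≤ M')
    (h : FlatAt E β r M y) : FlatAt E β r' M' y :=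
  fun T hT => (h T hT).mono hr fun w => by gcongr

lemma QuadraticAt.mono {r r' M M' : ℝ} {y : Space (n + 1)} (hr : r' ≤ r) (hM : M ≤ M')
    (h : QuadraticAt E r M y) : QuadraticAt E r' M' y := by
  intro T hT
  obtain ⟨B, hB, hs, hb⟩ := h T hT
  exact ⟨B, hB.trans hM, hs, hb.mono hr fun w => by gcongr⟩

/-- Since ‖w‖ < r ≤ 1, both |B(w,w)/2| and the cubic band are at most M‖w‖². So for |t| > 2M‖w‖² the
phase is determined, and t and t − B(w,w)/2 have the same sign. The case s ≥ 1/2 thereby reuses the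
increment estimates with β = 1. -/
lemma QuadraticAt.flatAt {r M : ℝ} {y : Space (n + 1)} (hr1 : r ≤ 1) (hM : 0 ≤ M)
    (h : QuadraticAt E r M y) : FlatAt E 1 r (2 * M) y := by
  intro T hT w t hw ht hlt
  obtain ⟨B, hB, -, hb⟩ := h T hT
  have hBb : |B w w / 2| ≤ M * ‖w‖ ^ 2 / 2 := by
    have h1 := B.le_opNorm₂ w w
    rw [Real.norm_eq_abs] at h1
    rw [abs_div, abs_two]
    have : ‖B‖ * ‖w‖ * ‖w‖ ≤ M * ‖w‖ * ‖w‖ := by gcongr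
    linarith [show M * ‖w‖ * ‖w‖ = M * ‖w‖ ^ 2 by ring]
  have hlt' : 2 * M * ‖w‖ ^ 2 < |t| := by
    have e : ‖w‖ ^ ((1 : ℝ) + 1) = ‖w‖ ^ 2 := by rw [← Real.rpow_two]; norm_num
    simpa [e] using hlt
  have hw3 : M * ‖w‖ ^ 3 ≤ M * ‖w‖ ^ 2 :=
    mul_le_mul_of_nonneg_left (pow_le_pow_of_le_one (norm_nonneg _) (hw.le.trans hr1)
      (by norm_num)) hM
  have hMw : 0 ≤ M * ‖w‖ ^ 2 := by positivity
  have hband : M * ‖w‖ ^ 3 < |t - B w w / 2| := by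
    have := abs_sub_abs_le_abs_sub t (B w w / 2)
    linarith
  rw [hb w t hw ht hband]
  unfold step
  have hB2 := abs_le.mp hBb
  refine if_congr ?_ rfl rfl
  simp only [Pi.zero_apply]
  constructor
  · intro hlt2
    by_contra hcon
    rw [abs_of_nonneg (not_lt.mp hcon)] at hlt'
    linarith
  · intro hlt2
    rw [abs_of_neg hlt2] at hlt'
    linarith

lemma exteriorNormal_spec {y ν : Space (n + 1)} {r : ℝ} {γ : (Submodule.span ℝ {ν})ᗮ → ℝ}
    (hc : IsGraphChart E y ν r γ) (hγ : ContDiffOn ℝ 1 γ (ball 0 r)) :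
    IsExteriorNormal E y (exteriorNormal E y) :=
  Classical.epsilon_spec (p := IsExteriorNormal E y) ⟨ν, r, γ, hc, hγ⟩

lemma HasC1HolderBoundary.isExteriorNormal {β : ℝ} (hE : HasC1HolderBoundary E β)
    {y : Space (n + 1)} (hy : y ∈ frontier E) : IsExteriorNormal E y (exteriorNormal E y) := by
  obtain ⟨ν, r, γ, hc, hγ, -⟩ := hE y hy
  exact exteriorNormal_spec hc hγ

lemma HasC3Boundary.isExteriorNormal (hE : HasC3Boundary E)
    {y : Space (n + 1)} (hy : y ∈ frontier E) : IsExteriorNormal E y (exteriorNormal E y) := by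
  obtain ⟨ν, r, γ, hc, hγ⟩ := hE y hy
  exact exteriorNormal_spec hc (hγ.of_le (by norm_num))

lemma HasC3Boundary.isMeanCurvature (hE : HasC3Boundary E)
    {y : Space (n + 1)} (hy : y ∈ frontier E) : IsMeanCurvature E y (meanCurvature E y) := by
  obtain ⟨ν, r, γ, hc, hγ⟩ := hE y hy
  exact Classical.epsilon_spec (p := IsMeanCurvature E y)
    ⟨_, ν, r, γ, hc, hγ.of_le (by norm_num), rfl⟩

lemma HasC1HolderBoundary.volume_frontier {β : ℝ} (hE : HasC1HolderBoundary E β) :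
    volume (frontier E) = 0 := by
  refine volume_frontier_eq_zero fun y hy => ?_
  obtain ⟨ν, r, γ, hc, hγ, -⟩ := hE y hy
  exact ⟨_, _, _, isDefiningFunction_graphFunction hc hγ⟩

lemma HasC3Boundary.volume_frontier (hE : HasC3Boundary E) : volume (frontier E) = 0 := by
  refine volume_frontier_eq_zero fun y hy => ?_
  obtain ⟨ν, r, γ, hc, hγ⟩ := hE y hy
  exact ⟨_, _, _, isDefiningFunction_graphFunction hc (hγ.of_le (by norm_num))⟩

theorem HasC1HolderBoundary.exists_flatAt {β : ℝ} (hE : HasC1HolderBoundary E β) (hβ : 0 < β)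
    (hβ1 : β ≤ 1) {K : Set (Space (n + 1))} (hK : IsCompact K) (hKE : K ⊆ frontier E) :
    ∃ r > 0, ∃ M ≥ 0, r ≤ 1 ∧ ∀ y ∈ K, FlatAt E β r M y := by
  refine exists_uniform_of_local (fun r r' M M' y hr hM h => h.mono hr hM) ?_ hK hKE
  intro y₀ hy₀
  obtain ⟨ν, r, γ, hc, hγ, L, hL⟩ := hE y₀ hy₀
  have hφ := isDefiningFunction_graphFunction hc hγ
  obtain ⟨r', hr', M, hM, h⟩ := exists_flat_band_near hφ hβ (abs_nonneg L) hβ1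
    fun x hx x' hx' => norm_fderiv_graphFunction_sub_le hβ.le hγ hL hx hx'
  exact ⟨r / 2, half_pos hφ.pos, r', hr', M, hM, fun y hyE hy T hT =>
    h y hyE hy T (hT ▸ hE.isExteriorNormal hyE)⟩

theorem HasC3Boundary.exists_quadraticAt (hE : HasC3Boundary E) (hn : 1 ≤ n)
    {K : Set (Space (n + 1))} (hK : IsCompact K) (hKE : K ⊆ frontier E) :
    ∃ r > 0, ∃ M ≥ 0, r ≤ 1 ∧ ∀ y ∈ K, QuadraticAt E r M y := by
  refine exists_uniform_of_local (fun r r' M M' y hr hM h => h.mono hr hM) ?_ hK hKE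
  intro y₀ hy₀
  obtain ⟨ν, r, γ, hc, hγ⟩ := hE y₀ hy₀
  have hφ := isDefiningFunction_graphFunction hc (hγ.of_le (by norm_num))
  have hφ3 := contDiffOn_graphFunction (y₀ := y₀) hγ
  obtain ⟨δ', hδ', r', hr', M, hM, -, hδle, h⟩ := exists_quadratic_band_near hφ hφ3
  refine ⟨δ', hδ', r', hr', M, hM, fun y hyE hy T hT => ?_⟩
  obtain ⟨l, hl, hlin, hB, hband⟩ := h y hyE hy T (hT ▸ hE.isExteriorNormal hyE)
  exact ⟨_, hB, sum_tangentForm hn hφ (hφ3.of_le (by norm_num)) (ball_subset_ball hδle hy) hyE hl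
    hlin (hE.isMeanCurvature hyE), hband⟩

end

noncomputable section

/-! ### The time scale -/

lemma eventually_nhdsGT_zero_iff {p : ℝ → Prop} :
    (∀ᶠ t in 𝓝[>] (0 : ℝ), p t) ↔ ∃ t₀ > 0, ∀ t ∈ Ioo 0 t₀, p t :=
  mem_nhdsGT_iff_exists_Ioo_subset

lemma tendsto_rpow_nhdsGT_zero {q : ℝ} (hq : 0 < q) :
    Tendsto (fun t : ℝ => t ^ q) (𝓝[>] 0) (𝓝[>] 0) := by
  refine tendsto_nhdsWithin_iff.mpr ⟨?_, ?_⟩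
  · have := (Real.continuousAt_rpow_const 0 q (Or.inr hq.le)).tendsto
    rw [Real.zero_rpow hq.ne'] at this
    exact this.mono_left nhdsWithin_le_nhds
  · filter_upwards [self_mem_nhdsWithin] with t ht using Real.rpow_pos_of_pos ht q

lemma continuous_sq_mul_abs_log : Continuous fun σ : ℝ => σ ^ 2 * |Real.log σ| := by
  have h : (fun σ : ℝ => σ ^ 2 * |Real.log σ|) = fun σ => |σ| * |σ * Real.log σ| := by
    ext σ
    rw [abs_mul, ← mul_assoc, ← sq, sq_abs]
  rw [h]
  exact continuous_abs.mul Real.continuous_mul_log.abs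

/-- By the intermediate value theorem a solution below any given δ exists once t is small. For t > 0
the solution set is closed, as σ = 0 is not a solution of the equation, so the infimum is attained
and lies below δ. -/
lemma timeScale_half_spec :
    (∀ᶠ t in 𝓝[>] (0 : ℝ), 0 < timeScale (1 / 2) t ∧
      t = timeScale (1 / 2) t ^ 2 * |Real.log (timeScale (1 / 2) t)|) ∧
    Tendsto (timeScale (1 / 2)) (𝓝[>] 0) (𝓝[>] 0) := by
  have hdef : ∀ t, timeScale (1 / 2) t = sInf {σ : ℝ | 0 < σ ∧ t = σ ^ 2 * |Real.log σ|} := by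
    intro t; simp [timeScale]
  have hsol : ∀ δ ∈ Ioo (0 : ℝ) 1, ∀ t ∈ Ioo 0 (δ ^ 2 * |Real.log δ|),
      ∃ σ ∈ {σ : ℝ | 0 < σ ∧ t = σ ^ 2 * |Real.log σ|}, σ < δ := by
    intro δ hδ t ht
    have := intermediate_value_Ioo hδ.1.le continuous_sq_mul_abs_log.continuousOn
    obtain ⟨σ, hσ, hσt⟩ := this (by simpa using ht)
    exact ⟨σ, ⟨hσ.1, hσt.symm⟩, hσ.2⟩
  have hpos : ∀ δ ∈ Ioo (0 : ℝ) 1, 0 < δ ^ 2 * |Real.log δ| := fun δ hδ => by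
    have := hδ.1
    have : 0 < |Real.log δ| := abs_pos.mpr (Real.log_neg hδ.1 hδ.2).ne
    positivity
  have hbdd : ∀ t, BddBelow {σ : ℝ | 0 < σ ∧ t = σ ^ 2 * |Real.log σ|} := fun t =>
    ⟨0, fun σ hσ => hσ.1.le⟩
  have hmem : ∀ δ ∈ Ioo (0 : ℝ) 1, ∀ t ∈ Ioo 0 (δ ^ 2 * |Real.log δ|),
      timeScale (1 / 2) t ∈ {σ : ℝ | 0 < σ ∧ t = σ ^ 2 * |Real.log σ|} ∧
        timeScale (1 / 2) t < δ := by
    intro δ hδ t ht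
    obtain ⟨σ, hσ, hσδ⟩ := hsol δ hδ t ht
    have hclosed : IsClosed {σ : ℝ | 0 < σ ∧ t = σ ^ 2 * |Real.log σ|} := by
      have : {σ : ℝ | 0 < σ ∧ t = σ ^ 2 * |Real.log σ|} =
          {σ : ℝ | 0 ≤ σ} ∩ {σ : ℝ | t = σ ^ 2 * |Real.log σ|} := by
        ext σ
        constructor
        · rintro ⟨h1, h2⟩; exact ⟨h1.le, h2⟩
        · rintro ⟨h1, h2⟩
          refine ⟨lt_of_le_of_ne h1 ?_, h2⟩
          rintro rfl
          have h2 : t = 0 ^ 2 * |Real.log 0| := h2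
          simp at h2
          exact ht.1.ne' h2
      rw [this]
      exact (isClosed_le continuous_const continuous_id).inter
        (isClosed_eq continuous_const continuous_sq_mul_abs_log)
    rw [hdef]
    exact ⟨hclosed.csInf_mem ⟨σ, hσ⟩ (hbdd t), (csInf_le (hbdd t) hσ).trans_lt hσδ⟩
  have hev : ∀ δ ∈ Ioo (0 : ℝ) 1, ∀ᶠ t in 𝓝[>] (0 : ℝ),
      timeScale (1 / 2) t ∈ {σ : ℝ | 0 < σ ∧ t = σ ^ 2 * |Real.log σ|} ∧
        timeScale (1 / 2) t < δ := fun δ hδ =>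
    (Filter.Eventually.mono (Ioo_mem_nhdsGT (hpos δ hδ)) fun t ht => hmem δ hδ t ht)
  have h2 : (1 / 2 : ℝ) ∈ Ioo (0 : ℝ) 1 := by norm_num
  refine ⟨(hev _ h2).mono fun t ht => ht.1, tendsto_nhdsWithin_iff.mpr
    ⟨?_, (hev _ h2).mono fun t ht => ht.1.1⟩⟩
  rw [Metric.tendsto_nhds]
  intro ε hε
  have hδ : min ε (1 / 2) ∈ Ioo (0 : ℝ) 1 :=
    ⟨lt_min hε (by norm_num), (min_le_right _ _).trans_lt (by norm_num)⟩
  filter_upwards [hev _ hδ] with t ht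
  rw [Real.dist_eq, sub_zero, abs_of_pos ht.1.1]
  exact ht.2.trans_le (min_le_left _ _)

lemma tendsto_timeScale {s : ℝ} (hs : 0 < s) : Tendsto (timeScale s) (𝓝[>] 0) (𝓝[>] 0) := by
  rcases lt_trichotomy s (1 / 2) with h | rfl | h
  · have : timeScale s = fun t => t ^ (2 * s / (1 + 2 * s)) := by ext t; simp only [timeScale, h, if_true]
    rw [this]
    exact tendsto_rpow_nhdsGT_zero (by positivity)
  · exact timeScale_half_spec.2
  · have : timeScale s = fun t => t ^ s := by
      ext t; simp only [timeScale, not_lt.mpr h.le, h.ne', if_false]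
    rw [this]
    exact tendsto_rpow_nhdsGT_zero hs

variable {n : ℕ} {s : ℝ} {P : Space (n + 1) → ℝ} {c C : ℝ} {E : Set (Space (n + 1))}

/-! ### The diffusion in rescaled coordinates -/

/-- The phase at scale `ρ`. -/
def scaledPhase (E : Set (Space (n + 1))) (y : Space (n + 1))
    (T : Space (n + 1) ≃ₗᵢ[ℝ] Space (n + 1)) (ρ : ℝ) (p : Space n × ℝ) : ℝ :=
  framePhase E y T (ρ • p.1, ρ * p.2)

lemma measurable_scaledPhase (E : Set (Space (n + 1))) (y : Space (n + 1))
    (T : Space (n + 1) ≃ₗᵢ[ℝ] Space (n + 1)) (ρ : ℝ) : Measurable (scaledPhase E y T ρ) :=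
  (measurable_framePhase E y T).comp (by fun_prop)

lemma abs_scaledPhase_le (E : Set (Space (n + 1))) (y : Space (n + 1))
    (T : Space (n + 1) ≃ₗᵢ[ℝ] Space (n + 1)) (ρ : ℝ) (p : Space n × ℝ) :
    |scaledPhase E y T ρ p| ≤ 1 := abs_regularPhase_le _

lemma diffusion_eq_integral_regularPhase (hE : volume (frontier E) = 0) (x : Space (n + 1)) (σ : ℝ) :
    diffusion s P E x σ = ∫ z, kernel s P (x - z) σ * regularPhase E z :=
  integral_congr_ae ((signIndicator_ae_eq hE).mono fun z hz => by simp only [hz])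

/-- In the substitution z = y + ρT(w, h) the Jacobian ρ^N cancels the prefactor of the kernel, and
radial symmetry removes T from the argument of P. -/
lemma diffusion_eq_slideIntegral (hP : IsAdmissibleProfile s P c C)
    (hE : volume (frontier E) = 0) {σ : ℝ} (hσ : 0 < σ) (y : Space (n + 1))
    (T : Space (n + 1) ≃ₗᵢ[ℝ] Space (n + 1)) (η : ℝ) :
    diffusion s P E (y + (σ ^ (1 / (2 * s)) * η) • T (joinLast 0 1)) σ =
      slideIntegral P (scaledPhase E y T (σ ^ (1 / (2 * s)))) η := by
  set ρ := σ ^ (1 / (2 * s)) with hρ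
  have hρ0 : 0 < ρ := by positivity
  have hk1 : σ ^ (-((n + 1 : ℝ) / (2 * s))) = (ρ ^ (n + 1))⁻¹ := by
    rw [hρ, ← Real.rpow_natCast, ← Real.rpow_mul hσ.le, ← Real.rpow_neg hσ.le]
    congr 1; push_cast; ring
  have hk2 : σ ^ (-(1 / (2 * s))) = ρ⁻¹ := by rw [Real.rpow_neg hσ.le]
  rw [diffusion_eq_integral_regularPhase hE]
  set x := y + (ρ * η) • T (joinLast 0 1) with hx
  set F : Space (n + 1) → ℝ := fun z => kernel s P (x - z) σ * regularPhase E z with hF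
  have hscale := Measure.integral_comp_smul (volume : Measure (Space (n + 1)))
    (fun z => F (y + z)) ρ
  rw [integral_add_left_eq_self F y, finrank_euclideanSpace_fin,
    abs_of_pos (by positivity : 0 < (ρ ^ (n + 1))⁻¹), smul_eq_mul] at hscale
  have hmain : ∫ z, F z = ρ ^ (n + 1) * ∫ z, F (y + ρ • z) := by
    rw [hscale]; field_simp
  rw [hmain, integral_frame T 0, ← integral_const_mul]
  unfold slideIntegral
  congr 1
  ext ⟨w, h⟩
  simp only [hF, zero_add, kernel, hk1, hk2, scaledPhase, framePhase]
  have e1 : ρ⁻¹ • (x - (y + ρ • T (joinLast w h))) =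
      η • T (joinLast 0 1) - T (joinLast w h) := by
    rw [hx, add_sub_add_left_eq_sub, smul_sub, smul_smul, smul_smul, inv_mul_cancel₀ hρ0.ne',
      one_smul, inv_mul_cancel_left₀ hρ0.ne']
  have e2 : P (η • T (joinLast 0 1) - T (joinLast w h)) = P (joinLast w (h - η)) := by
    refine hP.radial _ _ ?_
    rw [norm_sub_rev, ← map_smul, ← map_sub, T.norm_map, smul_joinLast, ← joinLast_sub]
    simp
  rw [e1, e2, ← map_smul, smul_joinLast]
  field_simp

lemma diffusion_eq_kernel_integral (hP : IsAdmissibleProfile s P c C)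
    (hE : volume (frontier E) = 0) (σ : ℝ) (y : Space (n + 1))
    (T : Space (n + 1) ≃ₗᵢ[ℝ] Space (n + 1)) :
    diffusion s P E y σ =
      ∫ p : Space n × ℝ, kernel s P (joinLast p.1 p.2) σ * framePhase E y T p := by
  rw [diffusion_eq_integral_regularPhase hE, integral_frame T y]
  congr 1
  ext ⟨w, h⟩
  simp only [framePhase, kernel]
  congr 2
  refine hP.radial _ _ ?_
  rw [norm_smul, norm_smul, sub_add_cancel_left, norm_neg, T.norm_map]

/-- Continuity places the boundary of {u > 0} inside {u = 0} and provides the zero along the normal.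
The phase is merely bounded and Borel, so x-dependence is kept in the kernel, dominated near x₀ by
its value at x₀ plus a Lipschitz term. -/
lemma continuous_diffusion (hP : IsAdmissibleProfile s P c C) (hs : 0 < s) {σ : ℝ} (hσ : 0 < σ)
    (hE : volume (frontier E) = 0) : Continuous fun x => diffusion s P E x σ := by
  -- In this proof ρ is the reciprocal of the usual length scale.
  set ρ := σ ^ (-(1 / (2 * s))) with hρ
  have hρ0 : 0 < ρ := by positivity
  set q : ℝ := (n + 1 : ℝ) + 2 * s + 1 with hq
  set L := hP.lipConst * 2 ^ q with hL
  have hL0 : 0 < L := mul_pos hP.lipConst_pos (by positivity)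
  set a := σ ^ (-((n + 1 : ℝ) / (2 * s))) with ha
  have ha0 : 0 < a := by positivity
  have hreg := fun x => diffusion_eq_integral_regularPhase (s := s) (P := P) hE x σ
  simp only [hreg]
  refine continuous_iff_continuousAt.mpr fun x₀ => ?_
  refine continuousAt_of_dominated (bound := fun z => a * (P (ρ • (x₀ - z)) +
    L * (1 + ‖ρ • (x₀ - z)‖) ^ (-q))) ?_ ?_ ?_ ?_
  · refine Eventually.of_forall fun x => ?_
    exact (((continuous_kernel hP σ).comp (by fun_prop : Continuous fun z => x - z)).measurable.mul
      (measurable_regularPhase E)).aestronglyMeasurable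
  · have hball : closedBall x₀ ρ⁻¹ ∈ 𝓝 x₀ := closedBall_mem_nhds _ (by positivity)
    filter_upwards [hball] with x hx
    refine Eventually.of_forall fun z => ?_
    rw [norm_mul]
    have hn : ‖ρ • (x - z) - ρ • (x₀ - z)‖ ≤ 1 := by
      rw [← smul_sub, sub_sub_sub_cancel_right, norm_smul, Real.norm_of_nonneg hρ0.le]
      rw [mem_closedBall_iff_norm] at hx
      calc ρ * ‖x - x₀‖ ≤ ρ * ρ⁻¹ := by gcongr
        _ = 1 := mul_inv_cancel₀ hρ0.ne'
    have h1 := hP.abs_sub_le_of_closedBall hs (z := ρ • (x₀ - z)) (x := ρ • (x - z))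
      (x' := ρ • (x₀ - z)) hn (by simp)
    have h2 : |P (ρ • (x - z)) - P (ρ • (x₀ - z))| ≤ L * (1 + ‖ρ • (x₀ - z)‖) ^ (-q) :=
      h1.trans (mul_le_of_le_one_right (by positivity) hn)
    have h3 : ‖kernel s P (x - z) σ‖ ≤ a * (P (ρ • (x₀ - z)) +
        L * (1 + ‖ρ • (x₀ - z)‖) ^ (-q)) := by
      unfold kernel
      rw [norm_mul, Real.norm_of_nonneg ha0.le, Real.norm_of_nonneg (hP.pos _).le]
      gcongr
      linarith [(abs_le.mp h2).2]
    calc _ ≤ ‖kernel s P (x - z) σ‖ * 1 := by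
          gcongr; exact abs_regularPhase_le z
      _ ≤ _ := by rw [mul_one]; exact h3
  · have i1 : Integrable fun z => P (ρ • (x₀ - z)) :=
      ((hP.integrable hs).comp_smul hρ0.ne').comp_sub_left x₀
    have i2 : Integrable fun z : Space (n + 1) => (1 + ‖ρ • (x₀ - z)‖) ^ (-q) :=
      (((integrable_one_add_norm_space (d := n + 1) (r := q)
        (by rw [hq]; push_cast; linarith)).comp_smul hρ0.ne').comp_sub_left x₀)
    exact (i1.add (i2.const_mul L)).const_mul a
  · refine Eventually.of_forall fun z => ?_
    exact ((((continuous_kernel hP σ).comp (by fun_prop : Continuous fun x => x - z))).mul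
      continuous_const).continuousAt

lemma BandPhase.rescale {y : Space (n + 1)} {T : Space (n + 1) ≃ₗᵢ[ℝ] Space (n + 1)} {r ρ : ℝ}
    {a b : Space n → ℝ} (h : BandPhase (framePhase E y T) r a b) (hρ : 0 < ρ) :
    BandPhase (scaledPhase E y T ρ) (r / ρ) (fun w => ρ⁻¹ * a (ρ • w))
      fun w => ρ⁻¹ * b (ρ • w) := by
  intro w t hw ht hb
  have hw' : ‖ρ • w‖ < r := by
    rw [norm_smul, Real.norm_of_nonneg hρ.le, mul_comm]; exact (lt_div_iff₀ hρ).mp hw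
  have ht' : |ρ * t| < r := by
    rw [abs_mul, abs_of_pos hρ, mul_comm]; exact (lt_div_iff₀ hρ).mp ht
  have e : ρ * t - a (ρ • w) = ρ * (t - ρ⁻¹ * a (ρ • w)) := by field_simp
  have hb' : b (ρ • w) < |ρ * t - a (ρ • w)| := by
    rw [e, abs_mul, abs_of_pos hρ]
    rwa [inv_mul_lt_iff₀ hρ] at hb
  have := h _ _ hw' ht' hb'
  unfold scaledPhase
  simp only [this, step]
  refine if_congr ?_ rfl rfl
  rw [lt_inv_mul_iff₀ hρ]

end

noncomputable section

variable {n : ℕ} {s : ℝ} {P : Space (n + 1) → ℝ} {c C : ℝ} {E : Set (Space (n + 1))}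

/-! ### The zero of the diffusion along the normal -/

lemma FlatAt.bandPhase_scaledPhase {β r M ρ : ℝ} {y : Space (n + 1)} (h : FlatAt E β r M y)
    (hρ : 0 < ρ) {T : Space (n + 1) ≃ₗᵢ[ℝ] Space (n + 1)}
    (hT : T (joinLast 0 1) = exteriorNormal E y) :
    BandPhase (scaledPhase E y T ρ) (r / ρ) 0 fun w => M * ρ ^ β * ‖w‖ ^ (1 + β) := by
  have := (h T hT).rescale hρ
  convert this using 2 with w w
  · simp
  · rw [norm_smul, Real.norm_of_nonneg hρ.le, Real.mul_rpow hρ.le (norm_nonneg _),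
      Real.rpow_add hρ, Real.rpow_one]
    field_simp

lemma BandPhase.quadratic_rescale {r M ρ : ℝ} {y : Space (n + 1)}
    {T : Space (n + 1) ≃ₗᵢ[ℝ] Space (n + 1)} {B : Space n →L[ℝ] Space n →L[ℝ] ℝ}
    (h : BandPhase (framePhase E y T) r (fun w => B w w / 2) fun w => M * ‖w‖ ^ 3) (hρ : 0 < ρ) :
    BandPhase (scaledPhase E y T ρ) (r / ρ) (fun w => ρ * (B w w / 2))
      fun w => M * ρ ^ 2 * ‖w‖ ^ 3 := by
  have := h.rescale hρ
  convert this using 2 with w w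
  · simp only [map_smul, smul_apply, smul_eq_mul]
    field_simp
  · rw [norm_smul, Real.norm_of_nonneg hρ.le]
    field_simp

/-- Existence, uniqueness and location of the zero of a decreasing function. -/
lemma exists_unique_zero_of_increment {U : ℝ → ℝ} {S A κ μ : ℝ} (hU : ContinuousOn U (Icc (-1) 1))
    (hμ : 0 < μ)
    (hinc : ∀ η η' : ℝ, |η| ≤ 1 → |η'| ≤ 1 → η' ≤ η →
      |U η - U η' + S * (η - η')| ≤ A * (κ + max |η| |η'|) * (η - η') ∧
        μ * (η - η') ≤ U η' - U η) (h0 : |U 0| < μ) :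
    (∃! η, |η| < 1 ∧ U η = 0) ∧
      ∀ η, |η| < 1 → U η = 0 → |η| ≤ μ⁻¹ * |U 0| ∧ |S * η - U 0| ≤ A * (κ + |η|) * |η| := by
  have h00 : |(0 : ℝ)| ≤ 1 := by simp
  have h11 : |(1 : ℝ)| ≤ 1 := by simp
  have hm1 : |(-1 : ℝ)| ≤ 1 := by simp
  have hb := abs_lt.mp h0
  have hlt : U 1 < 0 := by linarith [(hinc 1 0 h11 h00 zero_le_one).2]
  have hgt : 0 < U (-1) := by linarith [(hinc 0 (-1) h00 hm1 (by norm_num)).2]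
  refine ⟨?_, fun η hη hz => ?_⟩
  · obtain ⟨η, hη, hz⟩ := intermediate_value_Icc' (by norm_num : (-1 : ℝ) ≤ 1) hU ⟨hlt.le, hgt.le⟩
    have hη1 : |η| < 1 := by
      refine abs_lt.mpr ⟨lt_of_le_of_ne hη.1 ?_, lt_of_le_of_ne hη.2 ?_⟩
      · rintro rfl; exact hgt.ne' hz
      · rintro rfl; exact hlt.ne hz
    refine ⟨η, ⟨hη1, hz⟩, fun η' ⟨hη', hz'⟩ => ?_⟩
    rcases le_total η' η with h | h
    · have := (hinc η η' hη1.le hη'.le h).2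
      nlinarith
    · have := (hinc η' η hη'.le hη1.le h).2
      nlinarith
  · rcases le_total 0 η with h | h
    · obtain ⟨h1, h2⟩ := hinc η 0 hη.le h00 h
      rw [hz, sub_zero] at h2
      rw [hz, abs_zero, max_eq_left (abs_nonneg η), sub_zero, zero_sub, neg_add_eq_sub] at h1
      rw [abs_of_nonneg h] at h1 ⊢
      refine ⟨?_, h1⟩
      rw [le_inv_mul_iff₀ hμ]
      linarith [le_abs_self (U 0)]
    · obtain ⟨h1, h2⟩ := hinc 0 η h00 hη.le h
      rw [hz] at h2
      rw [hz, abs_zero, max_eq_right (abs_nonneg η), zero_sub, sub_zero, ← abs_neg] at h1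
      rw [abs_of_nonpos h] at h1 ⊢
      refine ⟨?_, ?_⟩
      · rw [le_inv_mul_iff₀ hμ]
        linarith [neg_abs_le (U 0)]
      · convert h1 using 2; ring

/-- The boundary of a superlevel set along a segment on which the function decreases. -/
lemma mem_frontier_superlevel_iff {X : Type*} [TopologicalSpace X] {D : X → ℝ} (hD : Continuous D)
    {g : ℝ → X} (hg : Continuous g) (hdec : ∀ η η' : ℝ, |η| ≤ 1 → |η'| ≤ 1 → η' < η →
      D (g η) < D (g η')) {η : ℝ} (hη : |η| < 1) :
    g η ∈ frontier {x | 0 < D x} ↔ D (g η) = 0 := by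
  refine ⟨fun h => (frontier_lt_subset_eq continuous_const hD h).symm, fun h => ⟨?_, ?_⟩⟩
  · have htend : Tendsto g (𝓝[<] η) (𝓝 (g η)) := hg.continuousAt.mono_left nhdsWithin_le_nhds
    refine mem_closure_of_tendsto htend ?_
    have hη' := abs_lt.mp hη
    filter_upwards [Ioo_mem_nhdsLT hη'.1] with x hx
    have := hdec η x hη.le (abs_le.mpr ⟨hx.1.le, (hx.2.trans hη'.2).le⟩) hx.2
    rw [h] at this
    exact this
  · intro hi
    have := interior_subset hi
    rw [mem_ofPred_eq, h] at this
    exact this.false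

/-- At a small time the diffusion vanishes exactly once along the normal, at a distance
controlled by its value at the foot point. -/
theorem exists_normalSpeed_bounds (hP : IsAdmissibleProfile s P c C) (hn : 1 ≤ n) (hs : 0 < s)
    {β r M : ℝ} (hβ0 : 0 < β) (hβ1 : β ≤ 1) (hr : 0 < r) (hM : 0 ≤ M) :
    ∃ A > 0, ∃ δ > 0, ∀ (E : Set (Space (n + 1))) (y : Space (n + 1)), volume (frontier E) = 0 →
      ‖exteriorNormal E y‖ = 1 → FlatAt E β r M y → ∀ t ρ : ℝ, 0 < t → 0 < timeScale s t →
      ρ = timeScale s t ^ (1 / (2 * s)) → ρ < δ → |diffusion s P E y (timeScale s t)| < δ →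
      (∃! v, IsNormalSpeed s P E t y v) ∧ ∀ v, IsNormalSpeed s P E t y v →
        |2 * sliceMass P * (v * t / ρ) - diffusion s P E y (timeScale s t)| ≤
          A * (ρ ^ β + |diffusion s P E y (timeScale s t)|) *
            |diffusion s P E y (timeScale s t)| := by
  obtain ⟨A, hA, m, hm, hinc⟩ := exists_slideIntegral_increment hP hn hs hβ0 hβ1
  set Q := M + r ^ (-β) with hQ
  have hQ0 : 0 < Q := by positivity
  set μ := m / 2 with hμ
  have hμ0 : 0 < μ := by positivity
  -- At scale ρ both the band coefficient Mρ^β and (r/ρ)^(−β) carry the factor ρ^β, with sum Qρ^β.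
  -- The second entry of the minimum makes AQρ^β ≤ m/2, leaving slope at least μ = m/2; the first
  -- makes |U(0)| < μ, which forces a sign change on [−1, 1].
  refine ⟨A * (Q + μ⁻¹) * μ⁻¹, by positivity, min μ ((μ / (A * Q)) ^ (1 / β)), by positivity,
    fun E y hE hν hflat t ρ ht hσ hρ hρδ hu => ?_⟩
  set σ := timeScale s t with hσd
  set u := diffusion s P E y σ with hud
  have hρ0 : 0 < ρ := by rw [hρ]; positivity
  have hρβ : A * (Q * ρ ^ β) ≤ μ := by
    have h1 : ρ ^ β ≤ ((μ / (A * Q)) ^ (1 / β)) ^ β :=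
      Real.rpow_le_rpow hρ0.le (hρδ.le.trans (min_le_right _ _)) hβ0.le
    rw [← Real.rpow_mul (by positivity), one_div_mul_cancel hβ0.ne', Real.rpow_one,
      le_div_iff₀ (by positivity)] at h1
    linarith
  obtain ⟨T, hT⟩ := exists_isometry_apply_joinLast hν
  set U := slideIntegral P (scaledPhase E y T ρ) with hU
  set g : ℝ → Space (n + 1) := fun η => y + (ρ * η) • exteriorNormal E y with hg
  have hgc : Continuous g := by fun_prop
  have hDU : ∀ η, diffusion s P E (g η) σ = U η := fun η => by
    rw [hg, hU, hρ]
    simp only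
    rw [← hT]
    exact diffusion_eq_slideIntegral hP hE hσ y T η
  have hDc := continuous_diffusion hP hs hσ hE
  have hUc : Continuous U := by
    simpa only [Function.comp_def, hDU] using hDc.comp hgc
  have hU0 : U 0 = u := by rw [← hDU, hg, hud]; simp
  have hrρ : (r / ρ) ^ (-β) = r ^ (-β) * ρ ^ β := by
    rw [Real.div_rpow hr.le hρ0.le, Real.rpow_neg hρ0.le, div_inv_eq_mul]
  have hinc' : ∀ η η' : ℝ, |η| ≤ 1 → |η'| ≤ 1 → η' ≤ η →
      |U η - U η' + 2 * sliceMass P * (η - η')| ≤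
        A * (Q * ρ ^ β + max |η| |η'|) * (η - η') ∧ μ * (η - η') ≤ U η' - U η := by
    intro η η' h1 h2 h3
    have h := hinc (scaledPhase E y T ρ) (r / ρ) (M * ρ ^ β) (measurable_scaledPhase _ _ _ _)
      (abs_scaledPhase_le _ _ _ _) (by positivity) (by positivity)
      (hflat.bandPhase_scaledPhase hρ0 hT) η η' h1 h2 h3
    rw [hrρ, ← add_mul, ← hQ] at h
    refine ⟨h.1, le_trans ?_ h.2⟩
    gcongr
    linarith
  have hsmall : |U 0| < μ := by rw [hU0]; exact hu.trans_le (min_le_left _ _)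
  obtain ⟨hex, hloc⟩ := exists_unique_zero_of_increment hUc.continuousOn hμ0 hinc' hsmall
  have hfr : ∀ η : ℝ, |η| < 1 → (g η ∈ frontier (evolvedSet s P E t) ↔ U η = 0) := fun η hη => by
    rw [← hDU]
    refine mem_frontier_superlevel_iff hDc hgc (fun x x' hx hx' hlt => ?_) hη
    rw [hDU, hDU]
    have := (hinc' x x' hx hx' hlt.le).2
    nlinarith [mul_pos hμ0 (sub_pos.mpr hlt)]
  -- Speeds correspond to zeros through η = vt/ρ; membership in the ball of radius ρ is the
  -- condition |η| < 1.
  have hiff : ∀ v, IsNormalSpeed s P E t y v ↔ |v * t / ρ| < 1 ∧ U (v * t / ρ) = 0 := fun v => by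
    have e : y + (v * t) • exteriorNormal E y = g (v * t / ρ) := by
      rw [hg]; simp only; rw [mul_div_cancel₀ _ hρ0.ne']
    have hb : y + (v * t) • exteriorNormal E y ∈ ball y ρ ↔ |v * t / ρ| < 1 := by
      rw [mem_ball_iff_norm, add_sub_cancel_left, norm_smul, hν, mul_one, Real.norm_eq_abs, abs_div,
        abs_of_pos hρ0, div_lt_one hρ0]
    unfold IsNormalSpeed
    rw [← hσd, ← hρ, mem_inter_iff, hb, and_comm]
    refine and_congr_right fun h => ?_
    rw [e, hfr _ h]
  constructor
  · obtain ⟨η, hη, huniq⟩ := hex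
    have e : η * ρ / t * t / ρ = η := by field_simp
    refine ⟨η * ρ / t, (hiff _).mpr (by rwa [e]), fun v hv => ?_⟩
    rw [← huniq _ ((hiff v).mp hv)]
    field_simp
  · intro v hv
    obtain ⟨h1, h2⟩ := (hiff v).mp hv
    obtain ⟨h3, h4⟩ := hloc _ h1 h2
    rw [hU0] at h3 h4
    refine h4.trans ?_
    calc A * (Q * ρ ^ β + |v * t / ρ|) * |v * t / ρ|
        ≤ A * (Q * ρ ^ β + μ⁻¹ * |u|) * (μ⁻¹ * |u|) := by gcongr
      _ ≤ A * ((Q + μ⁻¹) * (ρ ^ β + |u|)) * (μ⁻¹ * |u|) := by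
          have : 0 ≤ ρ ^ β := by positivity
          gcongr
          have h5 : 0 ≤ μ⁻¹ * ρ ^ β := by positivity
          have h6 : 0 ≤ Q * |u| := by positivity
          nlinarith
      _ = _ := by ring

lemma IsExteriorNormal.norm_eq_one {y ν : Space (n + 1)} (h : IsExteriorNormal E y ν) : ‖ν‖ = 1 := by
  obtain ⟨r, γ, hc, -⟩ := h
  exact hc.1

/-! ### The fractional mean curvature -/

lemma truncatedFracCurvature_eq (hE : volume (frontier E) = 0) (y : Space (n + 1))
    (T : Space (n + 1) ≃ₗᵢ[ℝ] Space (n + 1)) (ε : ℝ) :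
    truncatedFracCurvature s E y ε = ∫ p : Space n × ℝ,
      ((ball (0 : Space (n + 1)) ε)ᶜ.indicator fun x => ‖x‖ ^ (-((n + 1 : ℝ) + 2 * s)))
        (joinLast p.1 p.2) * framePhase E y T p := by
  unfold truncatedFracCurvature
  rw [← integral_indicator measurableSet_ball.compl]
  have h1 : ∫ z, (ball y ε)ᶜ.indicator
      (fun z => signIndicator E z / ‖y - z‖ ^ ((n + 1 : ℝ) + 2 * s)) z =
      ∫ z, (ball y ε)ᶜ.indicator
        (fun z => regularPhase E z / ‖y - z‖ ^ ((n + 1 : ℝ) + 2 * s)) z :=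
    integral_congr_ae ((signIndicator_ae_eq hE).mono fun z hz => by simp only [indicator, hz])
  rw [h1, integral_frame T y]
  congr 1
  ext ⟨w, h⟩
  have hx : (y + T (joinLast w h) ∈ (ball y ε)ᶜ) ↔ joinLast w h ∈ (ball (0 : Space (n + 1)) ε)ᶜ := by
    simp
  by_cases hm : joinLast w h ∈ (ball (0 : Space (n + 1)) ε)ᶜ
  · rw [indicator_of_mem (hx.mpr hm), indicator_of_mem hm, sub_add_cancel_left, norm_neg,
      T.norm_map, Real.rpow_neg (norm_nonneg _), framePhase, div_eq_inv_mul]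
  · rw [indicator_of_notMem (fun h => hm (hx.mp h)), indicator_of_notMem hm, zero_mul]

lemma FlatAt.tendsto_truncatedFracCurvature (hn : 1 ≤ n) (hs : 0 < s) {β r M : ℝ}
    (hβ : 2 * s < β) (hr : 0 < r) (hM : 0 ≤ M) (hE : volume (frontier E) = 0)
    {y : Space (n + 1)} (hflat : FlatAt E β r M y) {T : Space (n + 1) ≃ₗᵢ[ℝ] Space (n + 1)}
    (hT : T (joinLast 0 1) = exteriorNormal E y) :
    Tendsto (truncatedFracCurvature s E y) (𝓝[>] 0) (𝓝 (fracIntegral s (framePhase E y T))) := by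
  have := tendsto_truncated_fracIntegral (s := s) hn hs hβ hr hM (measurable_framePhase E y T)
    (fun p => abs_regularPhase_le _) (hflat T hT)
  simpa only [← truncatedFracCurvature_eq hE y T] using this

lemma FlatAt.fracMeanCurvature_eq (hn : 1 ≤ n) (hs : 0 < s) {β r M : ℝ}
    (hβ : 2 * s < β) (hr : 0 < r) (hM : 0 ≤ M) (hE : volume (frontier E) = 0)
    {y : Space (n + 1)} (hflat : FlatAt E β r M y) {T : Space (n + 1) ≃ₗᵢ[ℝ] Space (n + 1)}
    (hT : T (joinLast 0 1) = exteriorNormal E y) :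
    fracMeanCurvature s E y = fracIntegral s (framePhase E y T) :=
  (hflat.tendsto_truncatedFracCurvature hn hs hβ hr hM hE hT).limUnder_eq

/-- The diffusion at a boundary point, for `s < 1/2`. -/
theorem diffusion_sub_fracMeanCurvature (hP : IsAdmissibleProfile s P c C) (hn : 1 ≤ n)
    (hs : 0 < s) {β r M : ℝ} (hβ : 2 * s < β) (hr : 0 < r) (hM : 0 ≤ M) :
    ∃ H₀ > 0, ∀ ε > 0, ∀ᶠ σ in 𝓝[>] (0 : ℝ), ∀ (E : Set (Space (n + 1))) (y : Space (n + 1)),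
      volume (frontier E) = 0 → ‖exteriorNormal E y‖ = 1 → FlatAt E β r M y →
      |diffusion s P E y σ - σ * (c * fracMeanCurvature s E y)| ≤ ε * σ ∧
        |fracMeanCurvature s E y| ≤ H₀ := by
  obtain ⟨H₀, hH⟩ := exists_abs_fracIntegral_le (n := n) hn hs hβ hr hM
  refine ⟨|H₀| + 1, by positivity, fun ε hε => ?_⟩
  filter_upwards [diffusion_small_time hP hn hs hβ hr hM hε, self_mem_nhdsWithin]
    with σ hσ hσ0 E y hE hν hflat
  obtain ⟨T, hT⟩ := exists_isometry_apply_joinLast hν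
  have hf := measurable_framePhase E y T
  have hf1 : ∀ p, |framePhase E y T p| ≤ 1 := fun p => abs_regularPhase_le _
  rw [hflat.fracMeanCurvature_eq hn hs hβ hr hM hE hT, diffusion_eq_kernel_integral hP hE σ y T]
  refine ⟨?_, (hH _ hf hf1 (hflat T hT)).trans (by linarith [le_abs_self H₀])⟩
  have h := hσ _ hf hf1 (hflat T hT)
  have hσ0 : 0 < σ := hσ0
  set I := ∫ p : Space n × ℝ, kernel s P (joinLast p.1 p.2) σ * framePhase E y T p
  have e : I - σ * (c * fracIntegral s (framePhase E y T)) =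
      σ * (σ⁻¹ * I - c * fracIntegral s (framePhase E y T)) := by field_simp
  rw [e, abs_mul, abs_of_pos hσ0, mul_comm ε]
  gcongr

/-! ### The classical mean curvature -/

lemma QuadraticAt.abs_meanCurvature_le (hn : 1 ≤ n) {r M : ℝ} {y : Space (n + 1)}
    (hν : ‖exteriorNormal E y‖ = 1) (h : QuadraticAt E r M y) : |meanCurvature E y| ≤ M := by
  obtain ⟨T, hT⟩ := exists_isometry_apply_joinLast hν
  obtain ⟨B, hB, hsum, -⟩ := h T hT
  have hn0 : (0 : ℝ) < n := by exact_mod_cast hn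
  have h1 : |∑ i, B (EuclideanSpace.single i 1) (EuclideanSpace.single i 1)| ≤ n * M := by
    refine (Finset.abs_sum_le_sum_abs _ _).trans ?_
    have : ∀ i ∈ (Finset.univ : Finset (Fin n)),
        |B (EuclideanSpace.single i 1) (EuclideanSpace.single i 1)| ≤ M := fun i _ => by
      have := B.le_opNorm₂ (EuclideanSpace.single i 1) (EuclideanSpace.single i 1)
      simp only [PiLp.norm_single, norm_one, mul_one] at this
      exact this.trans hB
    simpa using Finset.sum_le_sum this
  rw [hsum, abs_mul, abs_of_pos hn0] at h1
  exact le_of_mul_le_mul_left h1 hn0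

/-- The diffusion at a boundary point of class `C^3`. -/
theorem diffusion_sub_meanCurvature (hP : IsAdmissibleProfile s P c C) (hn : 1 ≤ n)
    (hs : 0 < s) (hs1 : s < 1) {r M : ℝ} (hr : 0 < r) (hM : 0 ≤ M) :
    ∃ A > 0, ∀ (E : Set (Space (n + 1))) (y : Space (n + 1)),
      volume (frontier E) = 0 → ‖exteriorNormal E y‖ = 1 → QuadraticAt E r M y →
      ∀ σ ρ : ℝ, 0 < σ → ρ = σ ^ (1 / (2 * s)) →
      |diffusion s P E y σ - ρ * (meanCurvature E y *
        ∫ w in ball (0 : Space n) (r / ρ), ‖w‖ ^ 2 * P (joinLast w 0))| ≤ A * ρ ^ (2 * s) := by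
  obtain ⟨A, hA, h⟩ := exists_slideIntegral_zero_quadratic hP hn hs hs1 hr hM
  refine ⟨A, hA, fun E y hE hν hq σ ρ hσ hρ => ?_⟩
  have hρ0 : 0 < ρ := by rw [hρ]; positivity
  have hn0 : (n : ℝ) ≠ 0 := by positivity
  obtain ⟨T, hT⟩ := exists_isometry_apply_joinLast hν
  obtain ⟨B, hB, hsum, hband⟩ := hq T hT
  have h1 := h ρ _ B hρ0 (measurable_scaledPhase E y T ρ) (abs_scaledPhase_le E y T ρ) hB
    (hband.quadratic_rescale hρ0)
  have h2 := diffusion_eq_slideIntegral hP hE hσ y T 0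
  rw [← hρ, mul_zero, zero_smul, add_zero] at h2
  rwa [h2, ← mul_div_cancel_left₀ (meanCurvature E y) hn0, ← hsum]

end

noncomputable section

variable {n : ℕ} {s : ℝ} {P : Space (n + 1) → ℝ} {c C : ℝ} {E : Set (Space (n + 1))}

/-! ### The normal speed -/

lemma tendsto_timeScale_rpow (hs : 0 < s) :
    Tendsto (fun t => timeScale s t ^ (1 / (2 * s))) (𝓝[>] 0) (𝓝[>] 0) :=
  (tendsto_rpow_nhdsGT_zero (by positivity)).comp (tendsto_timeScale hs)

/-- The step common to the three regimes: a bound b(t) → 0 for the diffusion on K yields existence,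
uniqueness and the linearized equation for v. -/
lemma eventually_normalSpeed (hP : IsAdmissibleProfile s P c C) (hn : 1 ≤ n) (hs : 0 < s)
    {β r M : ℝ} (hβ0 : 0 < β) (hβ1 : β ≤ 1) (hr : 0 < r) (hM : 0 ≤ M)
    {K : Set (Space (n + 1))} (hE : volume (frontier E) = 0)
    (hν : ∀ y ∈ K, ‖exteriorNormal E y‖ = 1) (hflat : ∀ y ∈ K, FlatAt E β r M y)
    {b : ℝ → ℝ} (hb : Tendsto b (𝓝[>] 0) (𝓝 0))
    (hu : ∀ᶠ t in 𝓝[>] (0 : ℝ), ∀ y ∈ K, |diffusion s P E y (timeScale s t)| ≤ b t) :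
    ∃ A > 0, ∀ᶠ t in 𝓝[>] (0 : ℝ), ∀ y ∈ K, (∃! v, IsNormalSpeed s P E t y v) ∧
      ∀ v, IsNormalSpeed s P E t y v →
        |2 * sliceMass P * (v * t / timeScale s t ^ (1 / (2 * s))) -
          diffusion s P E y (timeScale s t)| ≤
        A * ((timeScale s t ^ (1 / (2 * s))) ^ β + b t) * b t := by
  obtain ⟨A, hA, δ, hδ, h⟩ := exists_normalSpeed_bounds hP hn hs hβ0 hβ1 hr hM
  refine ⟨A, hA, ?_⟩
  filter_upwards [self_mem_nhdsWithin, tendsto_timeScale hs self_mem_nhdsWithin,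
    tendsto_timeScale_rpow hs (Ioo_mem_nhdsGT hδ), hb.eventually (gt_mem_nhds hδ), hu]
    with t ht hσ hρ hbt hut y hy
  obtain ⟨hex, hv⟩ := h E y hE (hν y hy) (hflat y hy) t _ ht hσ rfl hρ.2
    ((hut y hy).trans_lt hbt)
  refine ⟨hex, fun v hvs => (hv v hvs).trans ?_⟩
  have hρ0 : 0 < timeScale s t ^ (1 / (2 * s)) := hρ.1
  have := hut y hy
  have hb0 : 0 ≤ b t := (abs_nonneg _).trans this
  gcongr

lemma mul_abs_sub_div_mul {S : ℝ} (hS : 0 < S) (v q H : ℝ) :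
    2 * S * |v - q / (2 * S) * H| = |2 * S * v - H * q| := by
  rw [← abs_of_pos (by positivity : 0 < 2 * S), ← abs_mul, abs_of_pos (by positivity : 0 < 2 * S)]
  congr 1
  field_simp

theorem normalSpeed_fractional (hP : IsAdmissibleProfile s P c C) (hn : 1 ≤ n) (hs : 0 < s)
    (hs1 : s < 1 / 2) {β r M : ℝ} (hβ : 2 * s < β) (hβ1 : β ≤ 1) (hr : 0 < r) (hM : 0 ≤ M)
    {K : Set (Space (n + 1))} (hE : volume (frontier E) = 0)
    (hν : ∀ y ∈ K, ‖exteriorNormal E y‖ = 1) (hflat : ∀ y ∈ K, FlatAt E β r M y) :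
    (∀ᶠ t in 𝓝[>] (0 : ℝ), ∀ y ∈ K, ∃! v, IsNormalSpeed s P E t y v) ∧
      ∀ ε > 0, ∀ᶠ t in 𝓝[>] (0 : ℝ), ∀ y ∈ K, ∀ v, IsNormalSpeed s P E t y v →
        |v - coeffA P c * fracMeanCurvature s E y| ≤ ε := by
  obtain ⟨H₀, hH₀, hH⟩ := diffusion_sub_fracMeanCurvature hP hn hs hβ hr hM
  have hc := hP.c_pos
  have hS := sliceMass_pos hP hs
  have hβ0 : 0 < β := by linarith
  set B := 1 + c * H₀ with hB
  have hB0 : 0 < B := by positivity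
  have hσ := tendsto_timeScale hs
  have hρ := tendsto_timeScale_rpow hs
  have hσ' : Tendsto (timeScale s) (𝓝[>] 0) (𝓝 0) := hσ.mono_right nhdsWithin_le_nhds
  have hρβ : Tendsto (fun t => (timeScale s t ^ (1 / (2 * s))) ^ β) (𝓝[>] 0) (𝓝 0) :=
    ((tendsto_rpow_nhdsGT_zero hβ0).comp hρ).mono_right nhdsWithin_le_nhds
  have hb : Tendsto (fun t => B * timeScale s t) (𝓝[>] 0) (𝓝 0) := by simpa using hσ'.const_mul B
  have hu : ∀ᶠ t in 𝓝[>] (0 : ℝ), ∀ y ∈ K,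
      |diffusion s P E y (timeScale s t)| ≤ B * timeScale s t := by
    filter_upwards [hσ.eventually (hH 1 one_pos), hσ self_mem_nhdsWithin] with t ht hσt y hy
    have hσ0 : 0 < timeScale s t := hσt
    obtain ⟨h1, h2⟩ := ht E y hE (hν y hy) (hflat y hy)
    have h3 : |timeScale s t * (c * fracMeanCurvature s E y)| ≤ timeScale s t * (c * H₀) := by
      rw [abs_mul, abs_mul, abs_of_pos hσ0, abs_of_pos hc]
      gcongr
    have := abs_add_le (diffusion s P E y (timeScale s t) -
      timeScale s t * (c * fracMeanCurvature s E y)) (timeScale s t * (c * fracMeanCurvature s E y))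
    rw [sub_add_cancel] at this
    rw [hB]
    linarith
  obtain ⟨A, hA, h⟩ := eventually_normalSpeed hP hn hs hβ0 hβ1 hr hM hE hν hflat hb hu
  refine ⟨h.mono fun t ht y hy => (ht y hy).1, fun ε hε => ?_⟩
  have hsmall : Tendsto (fun t => A * ((timeScale s t ^ (1 / (2 * s))) ^ β + B * timeScale s t) * B)
      (𝓝[>] 0) (𝓝 0) := by simpa using ((hρβ.add hb).const_mul A).mul_const B
  have hεS : 0 < ε * sliceMass P := by positivity
  filter_upwards [h, hsmall.eventually (gt_mem_nhds hεS), hσ.eventually (hH _ hεS),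
    hσ self_mem_nhdsWithin, self_mem_nhdsWithin] with t ht hsm hHt hσt ht0 y hy v hv
  have ht0 : 0 < t := ht0
  have hσ0 : 0 < timeScale s t := hσt
  have h1 := (ht y hy).2 v hv
  have h2 := (hHt E y hE (hν y hy) (hflat y hy)).1
  -- The scale σ = t^(2s/(1+2s)) is chosen so that σ^(1/(2s))·σ = t; hence vt/ρ = vσ matches the
  -- size σ of the diffusion.
  have e : v * t / timeScale s t ^ (1 / (2 * s)) = v * timeScale s t := by
    have : timeScale s t ^ (1 / (2 * s)) * timeScale s t = t := by
      simp only [timeScale, hs1, if_true]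
      rw [← Real.rpow_mul ht0.le, ← Real.rpow_add ht0]
      nth_rewrite 2 [← Real.rpow_one t]
      congr 1
      field_simp
    rw [div_eq_iff (by positivity), mul_assoc, mul_comm (timeScale s t), this]
  rw [e] at h1
  set σ := timeScale s t
  set H := fracMeanCurvature s E y
  have h3 : |2 * sliceMass P * v - H * c| * σ ≤ 2 * sliceMass P * ε * σ := by
    rw [← abs_of_pos hσ0, ← abs_mul, abs_of_pos hσ0]
    have h4 := abs_add_le (2 * sliceMass P * (v * σ) - diffusion s P E y σ)
      (diffusion s P E y σ - σ * (c * H))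
    have h5 : A * ((σ ^ (1 / (2 * s))) ^ β + B * σ) * (B * σ) ≤ ε * sliceMass P * σ := by
      rw [← mul_assoc]
      gcongr
    calc _ = |2 * sliceMass P * (v * σ) - diffusion s P E y σ +
          (diffusion s P E y σ - σ * (c * H))| := by congr 1; ring
      _ ≤ _ := by linarith
  have h6 := le_of_mul_le_mul_right h3 hσ0
  rw [← mul_abs_sub_div_mul hS] at h6
  exact le_of_mul_le_mul_left h6 (by positivity)

/-- Now ρ = t^(1/2) and vt/ρ = vρ. Replacing the truncated second moment by the full one costs
O(ρ^(2s−1)), the same relative order as the remainder ρ^(2s) in the expansion of the diffusion. -/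
theorem normalSpeed_classical (hP : IsAdmissibleProfile s P c C) (hn : 1 ≤ n)
    (hs : 1 / 2 < s) (hs1 : s < 1) {r M : ℝ} (hr : 0 < r) (hr1 : r ≤ 1) (hM : 0 ≤ M)
    {K : Set (Space (n + 1))} (hE : volume (frontier E) = 0)
    (hν : ∀ y ∈ K, ‖exteriorNormal E y‖ = 1) (hq : ∀ y ∈ K, QuadraticAt E r M y) :
    (∀ᶠ t in 𝓝[>] (0 : ℝ), ∀ y ∈ K, ∃! v, IsNormalSpeed s P E t y v) ∧
      ∃ A, ∀ᶠ t in 𝓝[>] (0 : ℝ), ∀ y ∈ K, ∀ v, IsNormalSpeed s P E t y v →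
        |v - coeffC P * meanCurvature E y| ≤ A * t ^ ((2 * s - 1) / 2) := by
  have hs0 : 0 < s := by linarith
  obtain ⟨A₁, hA₁, hH⟩ := diffusion_sub_meanCurvature hP hn hs0 hs1 hr hM
  have hS := sliceMass_pos hP hs0
  set I := ∫ w : Space n, ‖w‖ ^ 2 * P (joinLast w 0) with hI
  set J := fun R => ∫ w in ball (0 : Space n) R, ‖w‖ ^ 2 * P (joinLast w 0) with hJ
  set D := C * (sphereArea n * (r ^ (-(2 * s - 1)) / (2 * s - 1))) with hD
  have hI0 : 0 ≤ I := integral_nonneg fun w => mul_nonneg (by positivity) (hP.pos _).le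
  have hJI : ∀ ρ > 0, |J (r / ρ) - I| ≤ D * ρ ^ (2 * s - 1) := fun ρ hρ => by
    have := hP.abs_second_moment_sub_le hn hs (div_pos hr hρ)
    rw [abs_sub_comm] at this
    refine this.trans (le_of_eq ?_)
    rw [Real.div_rpow hr.le hρ.le, Real.rpow_neg hρ.le, div_inv_eq_mul, hD]
    ring
  have hD0 : 0 ≤ D := by
    have := (abs_nonneg _).trans (hJI 1 one_pos)
    rwa [Real.one_rpow, mul_one] at this
  have hρt : ∀ t : ℝ, 0 < t → timeScale s t ^ (1 / (2 * s)) = t ^ (1 / 2 : ℝ) := fun t ht => by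
    simp only [timeScale, not_lt.mpr hs.le, hs.ne', if_false]
    rw [← Real.rpow_mul ht.le]
    congr 1
    field_simp
  have hcurv : ∀ᶠ t in 𝓝[>] (0 : ℝ), ∀ y ∈ K, |diffusion s P E y (timeScale s t) -
      t ^ (1 / 2 : ℝ) * (meanCurvature E y * I)| ≤
        (A₁ + M * D) * (t ^ (1 / 2 : ℝ) * t ^ ((2 * s - 1) / 2)) := by
    filter_upwards [self_mem_nhdsWithin, tendsto_timeScale hs0 self_mem_nhdsWithin]
      with t ht hσ y hy
    have ht : 0 < t := ht
    have h1 := hH E y hE (hν y hy) (hq y hy) _ _ hσ rfl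
    have h2 := (hq y hy).abs_meanCurvature_le hn (hν y hy)
    rw [hρt t ht] at h1
    have h3 := hJI (t ^ (1 / 2 : ℝ)) (by positivity)
    have e1 : (t ^ (1 / 2 : ℝ)) ^ (2 * s - 1) = t ^ ((2 * s - 1) / 2) := by
      rw [← Real.rpow_mul ht.le]; congr 1; ring
    have e2 : (t ^ (1 / 2 : ℝ)) ^ (2 * s) = t ^ (1 / 2 : ℝ) * t ^ ((2 * s - 1) / 2) := by
      rw [← Real.rpow_mul ht.le, ← Real.rpow_add ht]; congr 1; ring
    rw [e1] at h3
    rw [e2] at h1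
    set ρ := t ^ (1 / 2 : ℝ) with hρ
    have hρ0 : 0 < ρ := by positivity
    have h4 : |ρ * (meanCurvature E y * (J (r / ρ) - I))| ≤
        ρ * (M * (D * t ^ ((2 * s - 1) / 2))) := by
      rw [abs_mul, abs_mul, abs_of_pos hρ0]
      gcongr
    have h5 := abs_add_le (diffusion s P E y (timeScale s t) - ρ * (meanCurvature E y * J (r / ρ)))
      (ρ * (meanCurvature E y * (J (r / ρ) - I)))
    calc _ = |diffusion s P E y (timeScale s t) - ρ * (meanCurvature E y * J (r / ρ)) +
          ρ * (meanCurvature E y * (J (r / ρ) - I))| := by congr 1; ring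
      _ ≤ _ := h5
      _ ≤ A₁ * (ρ * t ^ ((2 * s - 1) / 2)) + ρ * (M * (D * t ^ ((2 * s - 1) / 2))) :=
          add_le_add h1 h4
      _ = _ := by ring
  set B := A₁ + M * D + M * I with hB
  have hB0 : 0 ≤ B := by positivity
  have hlt1 : ∀ᶠ t in 𝓝[>] (0 : ℝ), t ≤ 1 :=
    mem_of_superset (Ioc_mem_nhdsGT one_pos) fun t ht => ht.2
  have hb : Tendsto (fun t : ℝ => B * t ^ (1 / 2 : ℝ)) (𝓝[>] 0) (𝓝 0) := by
    have := (tendsto_rpow_nhdsGT_zero (by norm_num : (0 : ℝ) < 1 / 2)).mono_right nhdsWithin_le_nhds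
    simpa using this.const_mul B
  have hu : ∀ᶠ t in 𝓝[>] (0 : ℝ), ∀ y ∈ K,
      |diffusion s P E y (timeScale s t)| ≤ B * t ^ (1 / 2 : ℝ) := by
    filter_upwards [self_mem_nhdsWithin, hlt1, hcurv] with t ht ht1 hc y hy
    have ht : 0 < t := ht
    have h2 := (hq y hy).abs_meanCurvature_le hn (hν y hy)
    have h1 := hc y hy
    have h3 : t ^ ((2 * s - 1) / 2) ≤ 1 := Real.rpow_le_one ht.le ht1 (by linarith)
    set ρ := t ^ (1 / 2 : ℝ) with hρ
    have hρ0 : 0 < ρ := by positivity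
    have h4 : |ρ * (meanCurvature E y * I)| ≤ ρ * (M * I) := by
      rw [abs_mul, abs_mul, abs_of_pos hρ0, abs_of_nonneg hI0]
      gcongr
    have h5 := abs_add_le (diffusion s P E y (timeScale s t) - ρ * (meanCurvature E y * I))
      (ρ * (meanCurvature E y * I))
    rw [sub_add_cancel] at h5
    have h6 : (A₁ + M * D) * (ρ * t ^ ((2 * s - 1) / 2)) ≤ (A₁ + M * D) * (ρ * 1) := by gcongr
    rw [hB]
    linarith
  obtain ⟨A, hA, h⟩ := eventually_normalSpeed hP hn hs0 one_pos le_rfl hr (by positivity) hE hν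
    (fun y hy => (hq y hy).flatAt hr1 hM) hb hu
  refine ⟨h.mono fun t ht y hy => (ht y hy).1,
    (2 * sliceMass P)⁻¹ * (A * (1 + B) * B + (A₁ + M * D)), ?_⟩
  filter_upwards [h, hcurv, hlt1, self_mem_nhdsWithin] with t ht hc ht1 ht0 y hy v hv
  have ht0 : 0 < t := ht0
  have h1 := (ht y hy).2 v hv
  have h2 := hc y hy
  rw [hρt t ht0, Real.rpow_one] at h1
  -- Since s < 1, the relative error ρ made in locating the zero is dominated by that of the
  -- curvature expansion.
  have hle : t ^ (1 / 2 : ℝ) ≤ t ^ ((2 * s - 1) / 2) :=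
    Real.rpow_le_rpow_of_exponent_ge ht0 ht1 (by linarith)
  have hρρ : t = t ^ (1 / 2 : ℝ) * t ^ (1 / 2 : ℝ) := by
    rw [← Real.rpow_add ht0]; norm_num
  set ρ := t ^ (1 / 2 : ℝ) with hρ
  set κ := t ^ ((2 * s - 1) / 2) with hκ
  have hρ0 : 0 < ρ := by positivity
  have e : v * t / ρ = v * ρ := by
    rw [div_eq_iff hρ0.ne']; nth_rewrite 1 [hρρ]; ring
  rw [e] at h1
  set H := meanCurvature E y
  set u := diffusion s P E y (timeScale s t)
  have h3 : |2 * sliceMass P * v - H * I| * ρ ≤ ((A * (1 + B) * B + (A₁ + M * D)) * κ) * ρ := by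
    rw [← abs_of_pos hρ0, ← abs_mul, abs_of_pos hρ0]
    have h4 := abs_add_le (2 * sliceMass P * (v * ρ) - u) (u - ρ * (H * I))
    have h5 : A * (ρ + B * ρ) * (B * ρ) ≤ A * (κ + B * κ) * (B * ρ) := by gcongr
    calc _ = |2 * sliceMass P * (v * ρ) - u + (u - ρ * (H * I))| := by congr 1; ring
      _ ≤ A * (κ + B * κ) * (B * ρ) + (A₁ + M * D) * (ρ * κ) := by linarith
      _ = _ := by ring
  have h6 := le_of_mul_le_mul_right h3 hρ0
  rw [← mul_abs_sub_div_mul hS] at h6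
  rw [mul_assoc, le_inv_mul_iff₀ (by positivity)]
  exact h6

/-- Now ρ = σ and t = ρ²|log ρ|, so vt/ρ = vρ|log ρ|. The expansion of the diffusion has error O(ρ),
which after division leaves 1/|log ρ|. -/
theorem normalSpeed_critical (hP : IsAdmissibleProfile (1 / 2) P c C) (hn : 1 ≤ n)
    {r M : ℝ} (hr : 0 < r) (hr1 : r ≤ 1) (hM : 0 ≤ M)
    {K : Set (Space (n + 1))} (hE : volume (frontier E) = 0)
    (hν : ∀ y ∈ K, ‖exteriorNormal E y‖ = 1) (hq : ∀ y ∈ K, QuadraticAt E r M y) :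
    (∀ᶠ t in 𝓝[>] (0 : ℝ), ∀ y ∈ K, ∃! v, IsNormalSpeed (1 / 2) P E t y v) ∧
      ∃ A, ∀ᶠ t in 𝓝[>] (0 : ℝ), 0 < coeffB P t ∧
        ∀ y ∈ K, ∀ v, IsNormalSpeed (1 / 2) P E t y v →
        |v - coeffB P t * meanCurvature E y| ≤ A * (1 / |Real.log (timeScale (1 / 2) t)|) := by
  have hs0 : (0 : ℝ) < 1 / 2 := by norm_num
  obtain ⟨A₁, hA₁, hH⟩ := diffusion_sub_meanCurvature hP hn hs0 (by norm_num) hr hM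
  have hS := sliceMass_pos hP hs0
  set J := fun R => ∫ w in ball (0 : Space n) R, ‖w‖ ^ 2 * P (joinLast w 0) with hJ
  set D₁ := C * (sphereArea n * Real.log (1 / r)) with hD₁
  set D₂ := |C * sphereArea n| + J 1 with hD₂
  have hJ1 : 0 < J 1 := hP.second_moment_pos hn one_pos
  -- The radii r/ρ from the chart and 1/ρ from `coeffB` have a fixed ratio, so the moments differ by
  -- a constant independent of ρ.
  have hJr : ∀ ρ > 0, |J (1 / ρ) - J (r / ρ)| ≤ D₁ := fun ρ hρ => by
    have := hP.second_moment_log hn (div_pos hr hρ) (by gcongr : r / ρ ≤ 1 / ρ)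
    have e : 1 / ρ / (r / ρ) = 1 / r := by field_simp
    rwa [e] at this
  have hD₁0 : 0 ≤ D₁ := (abs_nonneg _).trans (hJr 1 one_pos)
  have hD₂0 : 0 < D₂ := by positivity
  have hJlog : ∀ ρ > 0, 1 ≤ |Real.log ρ| → ρ ≤ 1 → J (1 / ρ) ≤ D₂ * |Real.log ρ| :=
    fun ρ hρ hl hρ1 => by
      have := hP.second_moment_log hn one_pos ((one_le_div hρ).mpr hρ1)
      rw [div_one, one_div, Real.log_inv, ← abs_of_nonpos (Real.log_nonpos hρ.le hρ1)] at this
      have h2 := (abs_le.mp this).2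
      have h3 : C * (sphereArea n * |Real.log ρ|) ≤ |C * sphereArea n| * |Real.log ρ| := by
        rw [← mul_assoc]; gcongr; exact le_abs_self _
      have h4 : J 1 * 1 ≤ J 1 * |Real.log ρ| := by gcongr
      have h5 : J (1 / ρ) = ∫ w in ball (0 : Space n) ρ⁻¹, ‖w‖ ^ 2 * P (joinLast w 0) := by
        rw [hJ, one_div]
      rw [h5, hD₂]
      have h6 : J 1 = ∫ w in ball (0 : Space n) 1, ‖w‖ ^ 2 * P (joinLast w 0) := rfl
      linarith
  -- The last bound makes the quadratic error (ρ|log ρ|)² of the zero at most ρ.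
  have hlog : ∀ᶠ ρ in 𝓝[>] (0 : ℝ), 0 < ρ ∧ ρ ≤ 1 ∧ 1 ≤ |Real.log ρ| ∧ ρ * |Real.log ρ| ^ 2 ≤ 1 := by
    have h1 : Tendsto (fun ρ => |Real.log ρ|) (𝓝[>] 0) atTop :=
      tendsto_abs_atBot_atTop.comp Real.tendsto_log_nhdsGT_zero
    have h2 : Tendsto (fun ρ : ℝ => Real.log ρ * ρ ^ (1 / 2 : ℝ)) (𝓝[>] 0) (𝓝 0) :=
      tendsto_log_mul_rpow_nhdsGT_zero hs0
    have h3 := (h2.pow 2).eventually (gt_mem_nhds (by norm_num : (0 : ℝ) ^ 2 < 1))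
    filter_upwards [self_mem_nhdsWithin, (Ioc_mem_nhdsGT one_pos : Ioc (0 : ℝ) 1 ∈ _),
      h1.eventually_ge_atTop 1, h3] with ρ hρ hρ1 hl h3
    have hρ : 0 < ρ := hρ
    refine ⟨hρ, hρ1.2, hl, ?_⟩
    rw [mul_pow, ← Real.rpow_natCast (ρ ^ (1 / 2 : ℝ)), ← Real.rpow_mul hρ.le] at h3
    norm_num at h3
    rw [sq_abs]
    linarith
  have hρlim := tendsto_timeScale hs0
  have hexp : ∀ σ : ℝ, σ ^ (1 / (2 * (1 / 2 : ℝ))) = σ := fun σ => by norm_num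
  have hcurv : ∀ᶠ t in 𝓝[>] (0 : ℝ), ∀ y ∈ K,
      |diffusion (1 / 2) P E y (timeScale (1 / 2) t) -
      timeScale (1 / 2) t * (meanCurvature E y * J (1 / timeScale (1 / 2) t))| ≤
        (A₁ + M * D₁) * timeScale (1 / 2) t := by
    filter_upwards [hρlim.eventually hlog] with t hl y hy
    obtain ⟨hρ0, hρ1, hl1, -⟩ := hl
    have h1 := hH E y hE (hν y hy) (hq y hy) _ _ hρ0 rfl
    have h2 := (hq y hy).abs_meanCurvature_le hn (hν y hy)
    rw [hexp] at h1
    set ρ := timeScale (1 / 2) t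
    have h3 := hJr ρ hρ0
    rw [abs_sub_comm] at h3
    rw [(by norm_num : (2 : ℝ) * (1 / 2) = 1), Real.rpow_one] at h1
    have h4 : |ρ * (meanCurvature E y * (J (r / ρ) - J (1 / ρ)))| ≤ ρ * (M * D₁) := by
      rw [abs_mul, abs_mul, abs_of_pos hρ0]
      gcongr
    have h5 := abs_add_le (diffusion (1 / 2) P E y ρ - ρ * (meanCurvature E y * J (r / ρ)))
      (ρ * (meanCurvature E y * (J (r / ρ) - J (1 / ρ))))
    calc _ = |diffusion (1 / 2) P E y ρ - ρ * (meanCurvature E y * J (r / ρ)) +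
          ρ * (meanCurvature E y * (J (r / ρ) - J (1 / ρ)))| := by congr 1; ring
      _ ≤ _ := h5
      _ ≤ A₁ * ρ + ρ * (M * D₁) := add_le_add h1 h4
      _ = _ := by ring
  set B := A₁ + M * D₁ + M * D₂ with hB
  have hB0 : 0 < B := by positivity
  set b : ℝ → ℝ := fun t => B * (timeScale (1 / 2) t * |Real.log (timeScale (1 / 2) t)|) with hbdef
  have hb : Tendsto b (𝓝[>] 0) (𝓝 0) := by
    have h1 : Tendsto (fun ρ : ℝ => Real.log ρ * ρ ^ (1 : ℝ)) (𝓝[>] 0) (𝓝 0) :=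
      tendsto_log_mul_rpow_nhdsGT_zero one_pos
    have h2 := ((h1.abs).comp hρlim).const_mul B
    rw [abs_zero, mul_zero] at h2
    refine h2.congr' ?_
    filter_upwards [hρlim.eventually hlog] with t hl
    simp only [Function.comp_def, hbdef, Real.rpow_one, abs_mul, abs_of_pos hl.1]
    ring
  have hu : ∀ᶠ t in 𝓝[>] (0 : ℝ), ∀ y ∈ K,
      |diffusion (1 / 2) P E y (timeScale (1 / 2) t)| ≤ b t := by
    filter_upwards [hρlim.eventually hlog, hcurv] with t hl hc y hy
    obtain ⟨hρ0, hρ1, hl1, -⟩ := hl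
    have h2 := (hq y hy).abs_meanCurvature_le hn (hν y hy)
    have h1 := hc y hy
    simp only [hbdef]
    set ρ := timeScale (1 / 2) t
    have hJ0 : 0 < J (1 / ρ) := hP.second_moment_pos hn (by positivity)
    have h3 := hJlog ρ hρ0 hl1 hρ1
    have h4 : |ρ * (meanCurvature E y * J (1 / ρ))| ≤ ρ * (M * (D₂ * |Real.log ρ|)) := by
      rw [abs_mul, abs_mul, abs_of_pos hρ0, abs_of_pos hJ0]
      gcongr
    have h5 := abs_add_le (diffusion (1 / 2) P E y ρ - ρ * (meanCurvature E y * J (1 / ρ)))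
      (ρ * (meanCurvature E y * J (1 / ρ)))
    rw [sub_add_cancel] at h5
    have h6 : (A₁ + M * D₁) * ρ * 1 ≤ (A₁ + M * D₁) * ρ * |Real.log ρ| := by gcongr
    rw [hB]
    linarith
  obtain ⟨A, hA, h⟩ := eventually_normalSpeed hP hn hs0 one_pos le_rfl hr (by positivity) hE hν
    (fun y hy => (hq y hy).flatAt hr1 hM) hb hu
  refine ⟨h.mono fun t ht y hy => (ht y hy).1,
    (2 * sliceMass P)⁻¹ * (A * (1 + B) * B + (A₁ + M * D₁)), ?_⟩
  filter_upwards [h, hcurv, hρlim.eventually hlog, timeScale_half_spec.1] with t ht hc hl hspec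
  obtain ⟨hρ0, hρ1, hl1, hl2⟩ := hl
  have htρ := hspec.2
  set ρ := timeScale (1 / 2) t with hρ
  set l := |Real.log ρ| with hldef
  have hl0 : 0 < l := by linarith
  have hJ0 : 0 < J (1 / ρ) := hP.second_moment_pos hn (by positivity)
  have hcoeff : coeffB P t = J (1 / ρ) / l / (2 * sliceMass P) := by
    have : coeffB P t = J ρ⁻¹ / (2 * l * sliceMass P) := rfl
    rw [this, one_div]
    field_simp
  refine ⟨by rw [hcoeff]; positivity, fun y hy v hv => ?_⟩
  have h1 := (ht y hy).2 v hv
  have h2 := hc y hy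
  rw [hexp, Real.rpow_one] at h1
  have hbt : b t = B * (ρ * l) := rfl
  rw [hbt] at h1
  have e : v * t / ρ = v * (ρ * l) := by
    rw [div_eq_iff hρ0.ne', htρ]; ring
  rw [e] at h1
  set H := meanCurvature E y
  set u := diffusion (1 / 2) P E y ρ
  have h3 : |2 * sliceMass P * v - H * (J (1 / ρ) / l)| * (ρ * l) ≤
      ((A * (1 + B) * B + (A₁ + M * D₁)) * (1 / l)) * (ρ * l) := by
    have hρl : 0 < ρ * l := by positivity
    rw [← abs_of_pos hρl, ← abs_mul, abs_of_pos hρl]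
    have h4 := abs_add_le (2 * sliceMass P * (v * (ρ * l)) - u) (u - ρ * (H * J (1 / ρ)))
    have h5 : ρ ≤ ρ * l := le_mul_of_one_le_right hρ0.le hl1
    have h6 : A * (ρ + B * (ρ * l)) * (B * (ρ * l)) ≤ A * (1 + B) * B * ρ := by
      calc A * (ρ + B * (ρ * l)) * (B * (ρ * l)) ≤ A * (ρ * l + B * (ρ * l)) * (B * (ρ * l)) := by
            gcongr
        _ = A * (1 + B) * B * ρ * (ρ * l ^ 2) := by ring
        _ ≤ A * (1 + B) * B * ρ * 1 := by gcongr
        _ = _ := mul_one _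
    calc _ = |2 * sliceMass P * (v * (ρ * l)) - u + (u - ρ * (H * J (1 / ρ)))| := by
          congr 1; field_simp; ring
      _ ≤ A * (1 + B) * B * ρ + (A₁ + M * D₁) * ρ := by linarith
      _ = _ := by field_simp
  have h6 := le_of_mul_le_mul_right h3 (by positivity)
  rw [← mul_abs_sub_div_mul hS] at h6
  rw [hcoeff, mul_assoc, le_inv_mul_iff₀ (by positivity)]
  exact h6

lemma coeffC_pos (hP : IsAdmissibleProfile s P c C) (hn : 1 ≤ n) (hs : 1 / 2 < s) :
    0 < coeffC P := by
  have hI := hP.integrable_second_moment hn hs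
  have h1 : (∫ w in ball (0 : Space n) 1, ‖w‖ ^ 2 * P (joinLast w 0)) ≤
      ∫ w : Space n, ‖w‖ ^ 2 * P (joinLast w 0) :=
    setIntegral_le_integral hI
      (Eventually.of_forall fun w => mul_nonneg (by positivity) (hP.pos _).le)
  have h2 := hP.second_moment_pos hn one_pos
  exact div_pos (h2.trans_le h1) (mul_pos two_pos (sliceMass_pos hP (by linarith)))

end

/-! ### The three regimes together -/

theorem theorem1p1 {n : ℕ} (hn : 1 ≤ n) {s : ℝ} (hs0 : 0 < s) (hs1 : s < 1)
    {P : Space (n + 1) → ℝ} {c C : ℝ} (hP : IsAdmissibleProfile s P c C)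
    {E : Set (Space (n + 1))}
    (hE : s < 1 / 2 → ∃ β : ℝ, 2 * s < β ∧ β ≤ 1 ∧ HasC1HolderBoundary E β)
    (hE' : 1 / 2 ≤ s → HasC3Boundary E)
    {K : Set (Space (n + 1))} (hK : IsCompact K) (hKE : K ⊆ frontier E) :
    (∃ t₀ > 0, ∀ t ∈ Ioo 0 t₀, ∀ y ∈ K, ∃! v : ℝ, IsNormalSpeed s P E t y v) ∧
    (s < 1 / 2 →
      (∀ y ∈ frontier E, Tendsto (truncatedFracCurvature s E y) (𝓝[>] 0)
        (𝓝 (fracMeanCurvature s E y))) ∧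
      0 < coeffA P c ∧
      ∀ ε > 0, ∃ t₀ > 0, ∀ t ∈ Ioo 0 t₀, ∀ y ∈ K, ∀ v : ℝ, IsNormalSpeed s P E t y v →
        |v - coeffA P c * fracMeanCurvature s E y| ≤ ε) ∧
    (s = 1 / 2 →
      ∃ M : ℝ, ∃ t₀ > 0, ∀ t ∈ Ioo 0 t₀, 0 < coeffB P t ∧
        ∀ y ∈ K, ∀ v : ℝ, IsNormalSpeed s P E t y v →
          |v - coeffB P t * meanCurvature E y| ≤ M * (1 / |Real.log (timeScale s t)|)) ∧
    (1 / 2 < s →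
      0 < coeffC P ∧
      ∃ M : ℝ, ∃ t₀ > 0, ∀ t ∈ Ioo 0 t₀, ∀ y ∈ K, ∀ v : ℝ, IsNormalSpeed s P E t y v →
        |v - coeffC P * meanCurvature E y| ≤ M * t ^ ((2 * s - 1) / 2)) := by
  simp only [← eventually_nhdsGT_zero_iff]
  rcases lt_trichotomy s (1 / 2) with hs | hs | hs
  · obtain ⟨β, hβ, hβ1, hEβ⟩ := hE hs
    have hβ0 : 0 < β := by linarith
    obtain ⟨r, hr, M, hM, -, hflat⟩ := hEβ.exists_flatAt hβ0 hβ1 hK hKE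
    obtain ⟨h1, h2⟩ := normalSpeed_fractional hP hn hs0 hs hβ hβ1 hr hM hEβ.volume_frontier
      (fun y hy => (hEβ.isExteriorNormal (hKE hy)).norm_eq_one) hflat
    refine ⟨h1, fun _ => ⟨fun y hy => ?_, div_pos hP.c_pos
      (mul_pos two_pos (sliceMass_pos hP hs0)), h2⟩, fun h => absurd h hs.ne,
      fun h => absurd h hs.not_gt⟩
    -- The principal value is claimed at every boundary point, not only on K; the uniform statement
    -- is applied to the singleton {y}.
    obtain ⟨r, hr, M, hM, -, hflat⟩ := hEβ.exists_flatAt hβ0 hβ1 isCompact_singleton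
      (singleton_subset_iff.mpr hy)
    obtain ⟨T, hT⟩ := exists_isometry_apply_joinLast (hEβ.isExteriorNormal hy).norm_eq_one
    have hy' := hflat y rfl
    rw [hy'.fracMeanCurvature_eq hn hs0 hβ hr hM hEβ.volume_frontier hT]
    exact hy'.tendsto_truncatedFracCurvature hn hs0 hβ hr hM hEβ.volume_frontier hT
  · subst hs
    have hE3 := hE' le_rfl
    obtain ⟨r, hr, M, hM, hr1, hq⟩ := hE3.exists_quadraticAt hn hK hKE
    obtain ⟨h1, h2⟩ := normalSpeed_critical hP hn hr hr1 hM hE3.volume_frontier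
      (fun y hy => (hE3.isExteriorNormal (hKE hy)).norm_eq_one) hq
    exact ⟨h1, fun h => absurd h (lt_irrefl _), fun _ => h2, fun h => absurd h (lt_irrefl _)⟩
  · have hE3 := hE' hs.le
    obtain ⟨r, hr, M, hM, hr1, hq⟩ := hE3.exists_quadraticAt hn hK hKE
    obtain ⟨h1, h2⟩ := normalSpeed_classical hP hn hs hs1 hr hr1 hM hE3.volume_frontier
      (fun y hy => (hE3.isExteriorNormal (hKE hy)).norm_eq_one) hq
    exact ⟨h1, fun h => absurd h hs.not_gt, fun h => absurd h hs.ne',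
      fun _ => ⟨coeffC_pos hP hn hs, h2⟩⟩
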